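/- **Model.** Languages are over $\{0,1\}$, $N$ is the length of the input. An MPC algorithm has, for every $N$, $p(N)\ge 1$ machines with a local memory of $s(N)$ words each, $p(N)s(N)\ge N$, a word having $O(\log N)$ bits, and runs for $R(N)$ rounds; it is uniform: $p,s,R$ are computable, and a single deterministic algorithm prescribes, for all $N$, all machines and all rounds, what a machine does, from $N$, its number, the number of the round and the content of its local memory. The input bits, each with its position, one per word, are initially distributed adversarially, at most $s(N)$ to a machine. In each synchronous round every machine computes on the content of its memory, keeps some words and sends others to machines of its choice; at all times the words that a machine keeps and receives fit into $s(N)$ words, and it sends at most $s(N)$ words. After the last round a designated machine gives the answer. For $f\colon\mathbb N\to\mathbb R^+$, a language *can be solved in $O(f(N))$ MPC rounds* if for every constant $\varepsilon\in(0,1)$ (in particular every $\varepsilon\in(0,1/2]$) some MPC algorithm with $s(N)=O(N^{1-\varepsilon})$ and with total memory $p(N)s(N)$ that is $\Omega(N^{2(1-\varepsilon)})$ and $O(N^{1+\gamma})$ for a constant $\gamma\ge0$ decides it in $R(N)=O(f(N))$ rounds. (The algorithm and the constants may depend on $\varepsilon$.) $\mathsf L$ is the class of languages decided by a deterministic Turing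 machine with read-only input tape in work space $O(\log n)$. $A$ is $\mathsf{NC}^1$ reducible to $B$ if $A$ is decided by a logspace-uniform family of Boolean circuits of polynomial size, depth $O(\log n)$ and fan-in at most two that may also contain oracle gates for $B$ (of any fan-in $r$), which count $\lceil\log_2(r+1)\rceil$ towards the depth. $B$ is $\mathsf L$-hard if every $A\in\mathsf L$ is $\mathsf{NC}^1$ reducible to $B$, and $\mathsf L$-complete if moreover $B\in\mathsf L$. **Theorem.** Let $f\colon\mathbb N\to\mathbb R^+$ be any function, and put $f_c(N)=\max_{m\le (N+2)^c} f(m)$ for $c\in\mathbb N$. 1. If some $\mathsf L$-hard language can be solved in $O(f(N))$ MPC rounds, then for every $A\in\mathsf L$ there is a constant $c$ such that $A$ can be solved in $O(f_c(N))$ MPC rounds. 2. Suppose that $f_c(N)=O(f(N))$ for every constant $c$ (as for $f$ constant, $\log\log N$, or a power of $\log N$), or that $f(N)=\Omega(\log N)$. If some $\mathsf L$-hard language can be solved in $O(f(N))$ MPC rounds, then so can every language in $\mathsf L$. Moreover, either all $\mathsf L$-complete languages can be solved in $O(f(N))$ MPC rounds, or none of them can. -/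

import Mathlib

open Filter Asymptotics

namespace MPCLogspace

/-! ## Logarithmic space -/

/-- A move of a tape head. -/
inductive Move
  | left
  | stay
  | right

/-- The new position of a head at `pos` on a tape with a left end (cell `0`). -/
def Move.apply : Move → ℕ → ℕ
  | .left, pos => pos - 1
  | .stay, pos => pos
  | .right, pos => pos + 1

/-- A deterministic Turing machine with a read-only input tape and a read/write work tape.
State `0` is the initial state, symbol `0` is the blank of the work tape. -/
structure OfflineTM where
  numStates : ℕ
  numSymbols : ℕ
  acceptState : Fin (numStates + 1)
  rejectState : Fin (numStates + 1)
  accept_ne_reject : acceptState ≠ rejectState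
  /-- current state, scanned input symbol (`none` next to the ends of the input), scanned work
  symbol ↦ new state, written work symbol, move of the input head, move of the work head -/
  trans : Fin (numStates + 1) → Option Bool → Fin (numSymbols + 1) →
    Fin (numStates + 1) × Fin (numSymbols + 1) × Move × Move

namespace OfflineTM

/-- A configuration of the machine. -/
structure Cfg (M : OfflineTM) where
  state : Fin (M.numStates + 1)
  inputHead : ℕ
  workHead : ℕ
  work : ℕ → Fin (M.numSymbols + 1)

/-- Initially the input head is on the first input symbol and the work tape is blank. -/
def init (M : OfflineTM) : M.Cfg := ⟨0, 1, 0, fun _ => 0⟩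

/-- The input occupies the cells `1, …, n`; the cells `0` and `n + 1` are blank. -/
def scan (x : List Bool) (pos : ℕ) : Option Bool :=
  if pos = 0 then none else x[pos - 1]?

/-- One step. The input head never leaves the cells `0, …, n + 1`. The accepting and the rejecting
state are halting. -/
def step (M : OfflineTM) (x : List Bool) (c : M.Cfg) : M.Cfg :=
  if c.state = M.acceptState ∨ c.state = M.rejectState then c
  else
    let a := M.trans c.state (scan x c.inputHead) (c.work c.workHead)
    { state := a.1
      inputHead := min (a.2.2.1.apply c.inputHead) (x.length + 1)
      workHead := a.2.2.2.apply c.workHead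
      work := Function.update c.work c.workHead a.2.1 }

/-- The configuration after `t` steps on input `x`. -/
def run (M : OfflineTM) (x : List Bool) (t : ℕ) : M.Cfg := (M.step x)^[t] M.init

end OfflineTM

/-- The class `L`: languages decided by a deterministic machine that halts on every input and scans
only `O(log n)` cells of its work tape. -/
def ClassL : Set (Language Bool) :=
  {A | ∃ (M : OfflineTM) (c : ℕ), ∀ x : List Bool,
    (x ∈ A → ∃ t, (M.run x t).state = M.acceptState) ∧
    (x ∉ A → ∃ t, (M.run x t).state = M.rejectState) ∧
    ∀ t, (M.run x t).workHead < c * (Nat.log 2 x.length + 1)}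

/-! ## Oracle circuits and `NC¹` reductions -/

/-- A node of a Boolean circuit with oracle gates. The arguments of a gate are the indices of
earlier nodes; gates other than oracle gates have fan-in at most two. -/
inductive Gate
  | input (i : ℕ)
  | const (b : Bool)
  | not (a : ℕ)
  | and (a b : ℕ)
  | or (a b : ℕ)
  | oracle (args : List ℕ)

namespace Gate

/-- The predecessors of a node. -/
def args : Gate → List ℕ
  | .input _ => []
  | .const _ => []
  | .not a => [a]
  | .and a b => [a, b]
  | .or a b => [a, b]
  | .oracle l => l

open Classical in
/-- The value of a node on input `x` with oracle `B`, given the values `v` of the earlier nodes. -/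
noncomputable def value (B : Language Bool) (x : List Bool) (v : List Bool) : Gate → Bool
  | .input i => x.getD i false
  | .const b => b
  | .not a => !(v.getD a false)
  | .and a b => v.getD a false && v.getD b false
  | .or a b => v.getD a false || v.getD b false
  | .oracle l => decide (l.map (fun a => v.getD a false) ∈ B)

/-- The contribution of a node to the depth: one for an ordinary gate, `⌈log₂ (r + 1)⌉` for an
oracle gate with `r` inputs (and one output), zero for a source. -/
def cost : Gate → ℕ
  | .input _ => 0
  | .const _ => 0
  | .not _ => 1
  | .and _ _ => 1
  | .or _ _ => 1
  | .oracle l => Nat.clog 2 (l.length + 1)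

/-- A node as a sequence of numbers. -/
def code : Gate → List ℕ
  | .input i => [0, i]
  | .const b => [1, b.toNat]
  | .not a => [2, a]
  | .and a b => [3, a, b]
  | .or a b => [4, a, b]
  | .oracle l => 5 :: l.length :: l

end Gate

/-- A circuit: its nodes in a topological order. The output is the last node. -/
abbrev Circuit := List Gate

namespace Circuit

/-- All arguments of a node occur earlier, and only the inputs `0, …, n - 1` are used. -/
def WellFormed (n : ℕ) (C : Circuit) : Prop :=
  C ≠ [] ∧ ∀ (k : ℕ) (g : Gate), C[k]? = some g →
    (∀ a ∈ g.args, a < k) ∧ ∀ i, g = Gate.input i → i < n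

/-- The values of all nodes, in order. -/
noncomputable def values (B : Language Bool) (x : List Bool) (C : Circuit) : List Bool :=
  C.foldl (fun v g => v ++ [g.value B x v]) []

/-- The output of the circuit on input `x` with oracle `B`. -/
noncomputable def eval (B : Language Bool) (x : List Bool) (C : Circuit) : Bool :=
  (C.values B x).getLastD false

/-- The depths of all nodes, in order. -/
def depths (C : Circuit) : List ℕ :=
  C.foldl (fun d g => d ++ [(g.args.map fun a => d.getD a 0).foldr max 0 + g.cost]) []

/-- The depth of the circuit: the largest total cost of a path. -/
def depth (C : Circuit) : ℕ := C.depths.foldr max 0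

/-- The description of a circuit as a bit string: the sequence of the codes of its nodes, every
number `k` being written as `1ᵏ0`. -/
def description (C : Circuit) : List Bool :=
  (C.flatMap Gate.code).flatMap fun k => List.replicate k true ++ [false]

end Circuit

/-- The pair `(1ⁿ, i)` as a bit string, `i` being written in binary. -/
def pairCode (n i : ℕ) : List Bool := List.replicate n true ++ false :: Nat.bits i

/-- The function `1ⁿ ↦ d n` is implicitly computable in logarithmic space: `d n` has polynomial
length, and, given `(1ⁿ, i)`, one can decide in logarithmic space whether `d n` has a position `i`,
and whether the bit of `d n` at position `i` is `1`. -/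
def ImplicitlyLogspaceComputable (d : ℕ → List Bool) : Prop :=
  (∃ c : ℕ, ∀ n, (d n).length ≤ (n + 2) ^ c) ∧
  ({w | ∃ n i, w = pairCode n i ∧ i < (d n).length} : Language Bool) ∈ ClassL ∧
  ({w | ∃ n i, w = pairCode n i ∧ (d n)[i]? = some true} : Language Bool) ∈ ClassL

/-- `A` is `NC¹` reducible to `B`: it is decided by a logspace-uniform family of Boolean circuits
with oracle gates for `B`, of polynomial size and logarithmic depth. -/
def NC1Reducible (A B : Language Bool) : Prop :=
  ∃ C : ℕ → Circuit,
    ImplicitlyLogspaceComputable (fun n => (C n).description) ∧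
    (∃ c : ℕ, ∀ n, (C n).depth ≤ c * (Nat.log 2 n + 1)) ∧
    (∀ n, (C n).WellFormed n) ∧
    ∀ x : List Bool, (C x.length).eval B x = true ↔ x ∈ A

/-- Hardness for `L` under `NC¹` reductions. -/
def LHard (B : Language Bool) : Prop := ∀ A ∈ ClassL, NC1Reducible A B

/-- Completeness for `L` under `NC¹` reductions. -/
def LComplete (B : Language Bool) : Prop := B ∈ ClassL ∧ LHard B

/-! ## Massively parallel computation -/

/-- A uniform family of deterministic MPC computations. All parameters are computed from the input
size `N`, and one and the same algorithm is run by all machines, for all `N`, in all rounds.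
Words are natural numbers (bounded in `Respects` below). -/
structure MPCAlgorithm where
  /-- the number of machines -/
  machines : ℕ → ℕ
  /-- the size of the local memory of a machine, in words -/
  memory : ℕ → ℕ
  /-- the number of rounds -/
  rounds : ℕ → ℕ
  /-- the computation of a machine in a round: from `N`, its own number, the number of the round,
  the words that it has kept and the words that it has just received, to the words that it keeps and
  the messages `(addressee, word)` that it sends -/
  step : ℕ × ℕ × ℕ × List ℕ × List ℕ → List ℕ × List (ℕ × ℕ)
  /-- the answer that a machine gives, from `N` and the words that it has kept and received -/
  answer : ℕ × List ℕ × List ℕ → Bool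
  machines_computable : Computable machines
  memory_computable : Computable memory
  rounds_computable : Computable rounds
  step_computable : Computable step
  answer_computable : Computable answer

namespace MPCAlgorithm

variable (M : MPCAlgorithm)

/-- The local memories of all machines: the words kept and the words just received. -/
abbrev State := ℕ → List ℕ × List ℕ

/-- What machine `k` keeps and sends in round `t`. -/
def act (N t : ℕ) (σ : State) (k : ℕ) : List ℕ × List (ℕ × ℕ) :=
  M.step (N, k, t, (σ k).1, (σ k).2)

/-- One synchronous round. The words received are ordered by their senders. -/
def next (N t : ℕ) (σ : State) : State := fun j =>
  ((M.act N t σ j).1,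
    (List.range (M.machines N)).flatMap fun k =>
      ((M.act N t σ k).2.filter fun m => m.1 = j).map Prod.snd)

/-- The state after `t` rounds, when machine `k` initially holds the words `D k`. -/
def run (N : ℕ) (D : ℕ → List ℕ) : ℕ → State
  | 0 => fun k => (D k, [])
  | t + 1 => M.next N t (run N D t)

/-- The input `x` as words: one word for each bit, holding its position and its value. -/
def inputWords (x : List Bool) : List ℕ := x.zipIdx.map fun q => 2 * q.2 + q.1.toNat

/-- `D` is a distribution of the input `x` over the machines (chosen by an adversary). -/
def IsDistribution (x : List Bool) (D : ℕ → List ℕ) : Prop :=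
  ((List.range (M.machines x.length)).flatMap D).Perm (inputWords x) ∧
  ∀ k < M.machines x.length, (D k).length ≤ M.memory x.length

/-- The computation started in `D` respects the bounds: at all times the words kept and received
by a machine fit into its memory; a machine never sends more words than fit into its memory, and
only to existing machines; every word has at most `κ log₂ (N + 2)` bits. -/
def Respects (κ N : ℕ) (D : ℕ → List ℕ) : Prop :=
  ∀ k < M.machines N,
    (∀ t ≤ M.rounds N,
      (M.run N D t k).1.length + (M.run N D t k).2.length ≤ M.memory N ∧
      ∀ w ∈ (M.run N D t k).1 ++ (M.run N D t k).2, w < (N + 2) ^ κ) ∧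
    ∀ t < M.rounds N,
      (M.act N t (M.run N D t) k).2.length ≤ M.memory N ∧
      ∀ m ∈ (M.act N t (M.run N D t) k).2, m.1 < M.machines N

/-- The answer of machine `0` after the last round. -/
def result (N : ℕ) (D : ℕ → List ℕ) : Bool :=
  M.answer (N, M.run N D (M.rounds N) 0)

/-- `M` decides `A`: there are enough machines to hold the input, and for every input and every
initial distribution of it, the computation respects the bounds and yields the right answer. -/
def Decides (A : Language Bool) : Prop :=
  (∀ N, 0 < M.machines N ∧ N ≤ M.machines N * M.memory N) ∧
  ∃ κ : ℕ, ∀ (x : List Bool) (D : ℕ → List ℕ), M.IsDistribution x D →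
    M.Respects κ x.length D ∧ (M.result x.length D = true ↔ x ∈ A)

/-- The total memory of the system, in words. -/
def totalMemory (N : ℕ) : ℕ := M.machines N * M.memory N

end MPCAlgorithm

/-- `A` can be solved in `O(f(N))` rounds with local memory `O(N ^ (1 - ε))` and with a total memory
that is polynomial and `Ω(N ^ (2 (1 - ε)))`. -/
def SolvableWith (ε : ℝ) (f : ℕ → ℝ) (A : Language Bool) : Prop :=
  ∃ M : MPCAlgorithm, M.Decides A ∧
    ((fun N => (M.rounds N : ℝ)) =O[atTop] f) ∧
    ((fun N => (M.memory N : ℝ)) =O[atTop] fun N : ℕ => (N : ℝ) ^ (1 - ε)) ∧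
    ((fun N : ℕ => (N : ℝ) ^ (2 * (1 - ε))) =O[atTop] fun N => (M.totalMemory N : ℝ)) ∧
    ∃ γ : ℝ, 0 ≤ γ ∧
      (fun N => (M.totalMemory N : ℝ)) =O[atTop] fun N : ℕ => (N : ℝ) ^ (1 + γ)

/-- `A` can be solved in `O(f(N))` MPC rounds, where the constant `ε ∈ (0, 1)` that governs the local
memory can be chosen by the user. -/
def MPCSolvable (f : ℕ → ℝ) (A : Language Bool) : Prop :=
  ∀ ε : ℝ, 0 < ε → ε < 1 → SolvableWith ε f A

/-- The maximum of `f(m)` over the sizes `m ≤ (N + 2) ^ c`. -/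
noncomputable def polyMax (f : ℕ → ℝ) (c N : ℕ) : ℝ :=
  (Finset.range ((N + 2) ^ c + 1)).sup' Finset.nonempty_range_add_one f

end MPCLogspace

open MPCLogspace

/-!
# Hardness for `L` and massively parallel computation

Both an `NC¹` reduction and a logspace machine are turned into a *network*: polynomially many
Boolean cells that are recomputed in synchronous steps, each of them either by a computable
function of at most about `N ^ (2 / q)` other cells, or by a query of any length to an oracle `B`.
The parameter `q` is chosen with `2 / q ≤ 1 - ε`.

*Networks are simulated by massively parallel computations* (`Simulator.algorithm_decides`,
`solvableWith_of_network`). The machines form a square; row `u` is in charge of cell `u`. To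
simulate a step, every value is broadcast along its row, which takes a constant number of rounds
because the side of the square is a constant power of the fan-out. Then the machine in row `u` and
column `(w, i)` sends the value of `u` to row `w` if `u` is the `i`-th cell that `w` reads. In
this way a row with a query receives its string in a distribution that is legal for the algorithm
for `B`, and its machines run this algorithm. The rows with shorter running time start later.
Since the local computation of the model is an arbitrary computable function, each machine knows
the whole network.

*Circuits are networks with a constant number of steps* (`Layering.Describes.board_node`). The
nodes of a circuit of depth `O(log N)` are divided into `O(q)` levels of depth about `log N / q`.
Oracle gates whose cost exceeds the depth of a level become queries, whose arguments have lower
levels. Every other gate depends, through gates of its level with small cost, on at most about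
`N ^ (2 / q)` nodes that are queries, inputs, or of lower level (`Circuit.length_leavesAt_le`),
since a gate of cost `c` has at most `2 ^ c` arguments. Its value is computed from theirs in one
step. The small oracle gates on the way need a decision procedure for `B`, which is obtained by
running the algorithm for `B` (`MPCAlgorithm.Decides.exists_computable`). A query of polynomial
length `r` fits into the memory because the algorithm for `B` can be chosen with memory `O(r ^ δ)`
for any `δ > 0`. Queries have polynomial length, which brings in the maximum of `f` over the
polynomially bounded sizes (`mpcSolvable_of_nc1Reducible`).

*Logspace machines are networks with `O(log N)` steps and no queries* (`Squaring.board_squaring`).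
The reachability relation on the polynomially many configurations is squared `O(log N)` times,
each disjunction over the intermediate configurations being a tree of constant height. This
settles the case `f = Ω(log N)` (`mpcSolvable_of_mem_classL`). It also shows that languages in `L`
are decidable, hence that a logspace-uniform circuit family is computable (`computable_codes`), as
is needed for the uniformity of the algorithm.
-/

namespace MPCLogspace

/-! ### A calculus of computable functions -/

/- With these rules `fun_prop` derives the computability of an explicit expression from that of its
parts. -/
attribute [fun_prop] Computable
attribute [fun_prop] Computable.pair Computable.const Computable.id Computable.comp

/-- The order of the natural numbers as a Boolean function. Comparisons in algorithms are written
with `ltb`, `eqb` and `memb` because `fun_prop` identifies a function by its head symbol, and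
`decide` hides the relation. -/
def ltb (a b : ℕ) : Bool := decide (a < b)

/-- Equality as a Boolean function. -/
def eqb {β : Type*} [DecidableEq β] (a b : β) : Bool := decide (a = b)

/-- Membership in a list as a Boolean function. -/
def memb {β : Type*} [DecidableEq β] (a : β) (l : List β) : Bool := decide (a ∈ l)

@[simp]
theorem eqb_eq_true {β : Type*} [DecidableEq β] {a b : β} : eqb a b = true ↔ a = b := by simp [eqb]

@[simp]
theorem ltb_eq_true {a b : ℕ} : ltb a b = true ↔ a < b := by simp [ltb]

section Calculus

variable {α β γ σ : Type*} [Primcodable α] [Primcodable β] [Primcodable γ] [Primcodable σ]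

@[fun_prop]
theorem computable_fst {f : α → β × γ} (hf : Computable f) : Computable fun a => (f a).1 :=
  Computable.fst.comp hf

@[fun_prop]
theorem computable_snd {f : α → β × γ} (hf : Computable f) : Computable fun a => (f a).2 :=
  Computable.snd.comp hf

@[fun_prop]
theorem computable_add {f g : α → ℕ} (hf : Computable f) (hg : Computable g) :
    Computable fun a => f a + g a := Primrec.nat_add.to_comp.comp hf hg

@[fun_prop]
theorem computable_sub {f g : α → ℕ} (hf : Computable f) (hg : Computable g) :
    Computable fun a => f a - g a := Primrec.nat_sub.to_comp.comp hf hg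

@[fun_prop]
theorem computable_mul {f g : α → ℕ} (hf : Computable f) (hg : Computable g) :
    Computable fun a => f a * g a := Primrec.nat_mul.to_comp.comp hf hg

@[fun_prop]
theorem computable_div {f g : α → ℕ} (hf : Computable f) (hg : Computable g) :
    Computable fun a => f a / g a := Primrec.nat_div.to_comp.comp hf hg

@[fun_prop]
theorem computable_mod {f g : α → ℕ} (hf : Computable f) (hg : Computable g) :
    Computable fun a => f a % g a := Primrec.nat_mod.to_comp.comp hf hg

@[fun_prop]
theorem computable_pow {f g : α → ℕ} (hf : Computable f) (hg : Computable g) :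
    Computable fun a => f a ^ g a :=
  (Primrec₂.unpaired'.1 Nat.Primrec.pow).to_comp.comp hf hg

@[fun_prop]
theorem computable_max {f g : α → ℕ} (hf : Computable f) (hg : Computable g) :
    Computable fun a => max (f a) (g a) := Primrec.nat_max.to_comp.comp hf hg

@[fun_prop]
theorem computable_min {f g : α → ℕ} (hf : Computable f) (hg : Computable g) :
    Computable fun a => min (f a) (g a) := Primrec.nat_min.to_comp.comp hf hg

@[fun_prop]
theorem computable_natPair {f g : α → ℕ} (hf : Computable f) (hg : Computable g) :
    Computable fun a => Nat.pair (f a) (g a) := Primrec₂.natPair.to_comp.comp hf hg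

@[fun_prop]
theorem computable_unpair {f : α → ℕ} (hf : Computable f) :
    Computable fun a => Nat.unpair (f a) := Computable.unpair.comp hf

@[fun_prop]
theorem computable_toNat {f : α → Bool} (hf : Computable f) :
    Computable fun a => (f a).toNat := (Primrec.dom_bool Bool.toNat).to_comp.comp hf

@[fun_prop]
theorem computable_not {f : α → Bool} (hf : Computable f) :
    Computable fun a => !(f a) := (Primrec.dom_bool not).to_comp.comp hf

@[fun_prop]
theorem computable_and {f g : α → Bool} (hf : Computable f) (hg : Computable g) :
    Computable fun a => f a && g a := Primrec.and.to_comp.comp hf hg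

@[fun_prop]
theorem computable_or {f g : α → Bool} (hf : Computable f) (hg : Computable g) :
    Computable fun a => f a || g a := Primrec.or.to_comp.comp hf hg

@[fun_prop]
theorem computable_cond {c : α → Bool} {f g : α → σ} (hc : Computable c) (hf : Computable f)
    (hg : Computable g) : Computable fun a => bif c a then f a else g a := Computable.cond hc hf hg

@[fun_prop]
theorem computable_ltb {f g : α → ℕ} (hf : Computable f) (hg : Computable g) :
    Computable fun a => ltb (f a) (g a) := Primrec.nat_lt.decide.to_comp.comp hf hg

@[fun_prop]
theorem computable_eqb [DecidableEq β] {f g : α → β} (hf : Computable f)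
    (hg : Computable g) : Computable fun a => eqb (f a) (g a) :=
  Primrec.eq.decide.to_comp.comp hf hg

@[fun_prop]
theorem computable_optionGetD {f : α → Option β} {g : α → β} (hf : Computable f)
    (hg : Computable g) : Computable fun a => (f a).getD (g a) := Computable.option_getD hf hg

@[fun_prop]
theorem computable_some {f : α → β} (hf : Computable f) : Computable fun a => some (f a) :=
  Computable.option_some.comp hf

@[fun_prop]
theorem computable_append {f g : α → List β} (hf : Computable f) (hg : Computable g) :
    Computable fun a => f a ++ g a := Computable.list_append.comp hf hg

@[fun_prop]
theorem computable_cons {f : α → β} {g : α → List β} (hf : Computable f) (hg : Computable g) :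
    Computable fun a => f a :: g a := Computable.list_cons.comp hf hg

@[fun_prop]
theorem computable_length {f : α → List β} (hf : Computable f) :
    Computable fun a => (f a).length := Computable.list_length.comp hf

@[fun_prop]
theorem computable_tail {f : α → List β} (hf : Computable f) :
    Computable fun a => (f a).tail := Primrec.list_tail.to_comp.comp hf

@[fun_prop]
theorem computable_getElem? {f : α → List β} {g : α → ℕ} (hf : Computable f)
    (hg : Computable g) : Computable fun a => (f a)[g a]? := Computable.list_getElem?.comp hf hg

@[fun_prop]
theorem computable_getD {f : α → List β} {g : α → ℕ} {h : α → β} (hf : Computable f)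
    (hg : Computable g) (hh : Computable h) : Computable fun a => (f a).getD (g a) (h a) := by
  simp only [List.getD_eq_getElem?_getD]
  fun_prop

@[fun_prop]
theorem computable_headD {f : α → List β} {h : α → β} (hf : Computable f)
    (hh : Computable h) : Computable fun a => (f a).headD (h a) := by
  simp only [List.headD_eq_head?_getD, List.head?_eq_getElem?]
  fun_prop

@[fun_prop]
theorem computable_range {f : α → ℕ} (hf : Computable f) :
    Computable fun a => List.range (f a) := Primrec.list_range.to_comp.comp hf

@[fun_prop]
theorem computable_idxOf [DecidableEq β] {f : α → List β} {g : α → β} (hf : Computable f)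
    (hg : Computable g) : Computable fun a => (f a).idxOf (g a) :=
  Primrec.list_idxOf.to_comp.comp hg hf

@[fun_prop]
theorem computable_foldl {f : α → List β} {g : α → σ} {h : α → σ → β → σ} (hf : Computable f)
    (hg : Computable g) (hh : Computable fun p : α × σ × β => h p.1 p.2.1 p.2.2) :
    Computable fun a => (f a).foldl (h a) (g a) := by
  have key : ∀ (l : List β) (s : σ) (h : σ → β → σ) (n : ℕ),
      (Nat.rec s (fun i t => (l[i]?.map (h t)).getD t) n : σ) = (l.take n).foldl h s := by
    intro l s h n
    induction n with
    | zero => rfl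
    | succ n ih =>
      simp only [ih, List.take_add_one, List.foldl_append]
      cases l[n]? <;> rfl
  refine Computable.of_eq (f := fun a => (Nat.rec (g a)
    (fun i t => ((f a)[i]?.map (h a t)).getD t) (f a).length : σ))
    (Computable.nat_rec (h := fun a p => ((f a)[p.1]?.map (h a p.2)).getD p.2)
      (computable_length hf) hg ?_) fun a => by rw [key, List.take_length]
  refine Computable.option_getD (Computable.option_map ?_ ?_) ?_
  · fun_prop
  · exact hh.comp (by fun_prop : Computable
      fun p : (α × ℕ × σ) × β => (p.1.1, p.1.2.2, p.2))
  · fun_prop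

@[fun_prop]
theorem computable_flatMap {f : α → List β} {g : α → β → List γ} (hf : Computable f)
    (hg : Computable fun p : α × β => g p.1 p.2) :
    Computable fun a => (f a).flatMap (g a) := by
  have key : ∀ (l : List β) (g : β → List γ) (s : List γ),
      l.foldl (fun s b => s ++ g b) s = s ++ l.flatMap g := by
    intro l g
    induction l with
    | nil => simp
    | cons b l ih => intro s; simp [ih]
  refine Computable.of_eq (f := fun a => (f a).foldl (fun s b => s ++ g a b) [])
    (computable_foldl hf (by fun_prop) ?_) fun a => by simp [key]
  exact computable_append (by fun_prop)
    (hg.comp (by fun_prop : Computable fun p : α × List γ × β => (p.1, p.2.2)))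

@[fun_prop]
theorem computable_map {f : α → List β} {g : α → β → γ} (hf : Computable f)
    (hg : Computable fun p : α × β => g p.1 p.2) : Computable fun a => (f a).map (g a) :=
  (computable_flatMap (g := fun a b => [g a b]) hf (by fun_prop)).of_eq fun a => by
    induction f a with
    | nil => rfl
    | cons b l ih => simpa using ih

@[fun_prop]
theorem computable_filter {f : α → List β} {p : α → β → Bool} (hf : Computable f)
    (hp : Computable fun q : α × β => p q.1 q.2) : Computable fun a => (f a).filter (p a) := by
  refine Computable.of_eq (f := fun a => (f a).flatMap fun b => cond (p a b) [b] [])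
    (computable_flatMap hf (Computable.cond hp (by fun_prop) (by fun_prop))) fun a => ?_
  induction f a with
  | nil => rfl
  | cons b l ih => cases h : p a b <;> simp [h, ih]

@[fun_prop]
theorem computable_any {f : α → List β} {p : α → β → Bool} (hf : Computable f)
    (hp : Computable fun q : α × β => p q.1 q.2) : Computable fun a => (f a).any (p a) := by
  refine Computable.of_eq (f := fun a => ltb 0 ((f a).filter (p a)).length)
    (by fun_prop) fun a => ?_
  rw [Bool.eq_iff_iff]
  simp [List.length_pos_iff, List.filter_eq_nil_iff]

@[fun_prop]
theorem computable_all {f : α → List β} {p : α → β → Bool} (hf : Computable f)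
    (hp : Computable fun q : α × β => p q.1 q.2) : Computable fun a => (f a).all (p a) := by
  refine Computable.of_eq (f := fun a => !(f a).any fun b => !p a b) (by fun_prop) fun a => ?_
  simp [List.all_eq_not_any_not]

@[fun_prop]
theorem computable_memb [DecidableEq β] {f : α → β} {g : α → List β} (hf : Computable f)
    (hg : Computable g) : Computable fun a => memb (f a) (g a) := by
  refine Computable.of_eq (f := fun a => (g a).any fun b => eqb (f a) b)
    (by fun_prop) fun a => ?_
  rw [Bool.eq_iff_iff]
  simp [memb]

@[fun_prop]
theorem computable_replicate {f : α → ℕ} {g : α → β} (hf : Computable f)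
    (hg : Computable g) : Computable fun a => List.replicate (f a) (g a) := by
  refine Computable.of_eq (f := fun a => (List.range (f a)).map fun _ => g a)
    (by fun_prop) fun a => ?_
  simp

/-- A function with a decidable graph is computable: search for the value. -/
theorem computable_of_graph {f : α → β} {R : α × β → Bool} (hR : Computable R)
    (h : ∀ a b, R (a, b) = true ↔ f a = b) : Computable f := by
  have hF : Computable₂ fun (a : α) (n : ℕ) =>
      (Encodable.decode (α := β) n).bind fun b => cond (R (a, b)) (some b) none := by
    refine Computable.option_bind (Computable.decode.comp Computable.snd) ?_
    refine Computable.cond (hR.comp ?_) ?_ ?_ <;> fun_prop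
  refine (Partrec.rfindOpt hF).of_eq_tot fun a => ?_
  have hdom : (Nat.rfindOpt fun n => (Encodable.decode (α := β) n).bind
      fun b => cond (R (a, b)) (some b) none).Dom := by
    refine Nat.rfindOpt_dom.2 ⟨Encodable.encode (f a), f a, ?_⟩
    simp [(h a (f a)).2 rfl]
  obtain ⟨n, hn⟩ := Nat.rfindOpt_spec (Part.get_mem hdom)
  rw [Option.mem_def, Option.bind_eq_some_iff] at hn
  obtain ⟨b, -, hb⟩ := hn
  have hb' : f a = b ∧ b = (Nat.rfindOpt fun n => (Encodable.decode (α := β) n).bind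
      fun b => cond (R (a, b)) (some b) none).get hdom := by
    cases hR' : R (a, b)
    · simp [hR'] at hb
    · exact ⟨(h a b).1 hR', by simpa [hR'] using hb⟩
  rw [hb'.1, hb'.2]
  exact Part.get_mem hdom

@[fun_prop]
theorem computable_log {f : α → ℕ} (hf : Computable f) :
    Computable fun a => Nat.log 2 (f a) := by
  refine Computable.comp (f := Nat.log 2) ?_ hf
  refine computable_of_graph (R := fun p =>
    (eqb p.1 0 && eqb p.2 0) ||
      (ltb (2 ^ p.2) (p.1 + 1) && ltb p.1 (2 ^ (p.2 + 1)))) (by fun_prop) fun n m => ?_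
  rcases Nat.eq_zero_or_pos n with rfl | hn
  · simp [ltb, eqb, @eq_comm _ 0 m]
  · have := hn.ne'
    simp only [Bool.and_eq_true, Bool.or_eq_true, eqb_eq_true, ltb_eq_true, Nat.lt_succ_iff, this,
      false_and, false_or]
    rw [Nat.log_eq_iff (Or.inr ⟨by norm_num, this⟩)]

@[fun_prop]
theorem computable_clog {f : α → ℕ} (hf : Computable f) :
    Computable fun a => Nat.clog 2 (f a) := by
  refine Computable.comp (f := Nat.clog 2) ?_ hf
  refine computable_of_graph (R := fun p =>
    ltb p.1 (2 ^ p.2 + 1) && (eqb p.2 0 || !ltb p.1 (2 ^ (p.2 - 1) + 1)))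
    (by fun_prop) fun n m => ?_
  simp only [Bool.and_eq_true, Bool.or_eq_true, ← Bool.not_eq_true,
    Bool.not_eq_true', eqb_eq_true, ltb_eq_true, Nat.lt_succ_iff,
    ← Nat.clog_le_iff_le_pow (b := 2) (by norm_num)]
  omega

@[fun_prop]
theorem computable_size {f : α → ℕ} (hf : Computable f) :
    Computable fun a => Nat.size (f a) := by
  refine Computable.comp (f := Nat.size) ?_ hf
  refine computable_of_graph (R := fun p =>
    ltb p.1 (2 ^ p.2) && (eqb p.2 0 || !ltb p.1 (2 ^ (p.2 - 1)))) (by fun_prop) fun n m => ?_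
  simp only [Bool.and_eq_true, Bool.or_eq_true, ← Bool.not_eq_true,
    Bool.not_eq_true', eqb_eq_true, ltb_eq_true, ← Nat.size_le]
  omega

@[fun_prop]
theorem computable_bits {f : α → ℕ} (hf : Computable f) :
    Computable fun a => Nat.bits (f a) := by
  refine Computable.comp (f := Nat.bits) ?_ hf
  refine Computable.of_eq (f := fun n => (List.range n.size).map
    fun i => eqb (n / 2 ^ i % 2) 1) (by fun_prop) fun n => ?_
  refine List.ext_getElem (by simp [Nat.size_eq_bits_len]) fun i h₁ h₂ => ?_
  have := Nat.testBit_eq_inth n i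
  rw [List.getI_eq_getElem _ h₂] at this
  simp [← this, eqb, Nat.testBit_eq_decide_div_mod_eq]

end Calculus

/-! ### Lists of messages -/

section Lists

variable {α β : Type*}

/-- Only the indices in the image of a strictly increasing `φ` contribute. -/
theorem flatMap_range_of_support {m M : ℕ} {φ : ℕ → ℕ} {g : ℕ → List α}
    (hφ : ∀ i j, i < j → j < m → φ i < φ j) (hM : ∀ i < m, φ i < M)
    (hg : ∀ k < M, (∀ i < m, φ i ≠ k) → g k = []) :
    (List.range M).flatMap g = (List.range m).flatMap fun i => g (φ i) := by
  have h₁ : ∀ (l : List ℕ) (p : ℕ → Bool), (∀ k ∈ l, p k = false → g k = []) →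
      (l.filter p).flatMap g = l.flatMap g := by
    intro l p
    induction l with
    | nil => simp
    | cons a l ih =>
      intro h
      have ih := ih fun k hk => h k (List.mem_cons_of_mem _ hk)
      cases hp : p a
      · simp [hp, ih, h a List.mem_cons_self hp]
      · simp [hp, ih]
  have h₂ : (List.range M).filter (fun k => decide (k ∈ (List.range m).map φ)) =
      (List.range m).map φ := by
    have hs : ((List.range m).map φ).Pairwise (· < ·) := by
      rw [List.pairwise_map]
      refine List.Pairwise.imp_of_mem ?_ List.pairwise_lt_range
      intro a b _ hb hab
      exact hφ a b hab (List.mem_range.1 hb)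
    have hs' := (List.pairwise_lt_range (n := M)).filter
      (fun k => decide (k ∈ (List.range m).map φ))
    refine List.Perm.eq_of_pairwise (le := (· < ·)) ?_ hs' hs ?_
    · intro a b _ _ hab hba
      omega
    · rw [List.perm_ext_iff_of_nodup (hs'.imp fun h => h.ne) (hs.imp fun h => h.ne)]
      intro a
      simp only [List.mem_filter, List.mem_range, List.mem_map, decide_eq_true_eq]
      constructor
      · exact fun h => h.2
      · rintro ⟨i, hi, rfl⟩
        exact ⟨hM i hi, i, hi, rfl⟩
  rw [← h₁ (List.range M) fun k => decide (k ∈ (List.range m).map φ), h₂, List.flatMap_map]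
  intro k hk hk'
  refine hg k (List.mem_range.1 hk) fun i hi h => ?_
  simp only [decide_eq_false_iff_not, List.mem_map, List.mem_range, not_exists, not_and] at hk'
  exact hk' i hi h

theorem flatMap_range_of_unique {M k₀ : ℕ} {g : ℕ → List α} (h₀ : k₀ < M)
    (hg : ∀ k < M, k ≠ k₀ → g k = []) : (List.range M).flatMap g = g k₀ := by
  rw [flatMap_range_of_support (m := 1) (φ := fun _ => k₀) (by omega) (fun _ _ => h₀)
    fun k hk h => hg k hk fun h' => h 0 one_pos h'.symm]
  simp

theorem filter_range_eq_singleton {n a : ℕ} {p : ℕ → Bool} (ha : a < n)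
    (hp : ∀ i, p i = true ↔ i = a) : (List.range n).filter p = [a] := by
  have h : ((List.range n).filter p).Perm [a] := by
    rw [List.perm_ext_iff_of_nodup (List.nodup_range.filter _) (List.nodup_singleton a)]
    intro b
    simp only [List.mem_filter, List.mem_range, hp, List.mem_singleton]
    constructor
    · exact fun h => h.2
    · rintro rfl
      exact ⟨ha, rfl⟩
  exact List.perm_singleton.1 h

/-- Splitting a list by the values of a function only permutes it. -/
theorem flatMap_filter_perm {l : List α} (hl : l.Nodup) {f : α → ℕ} {p : ℕ}
    (hf : ∀ a ∈ l, f a < p) :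
    ((List.range p).flatMap fun j => l.filter fun a => f a = j).Perm l := by
  rw [List.perm_ext_iff_of_nodup _ hl]
  · intro a
    simp only [List.mem_flatMap, List.mem_range, List.mem_filter, decide_eq_true_eq]
    exact ⟨fun ⟨_, _, h, _⟩ => h, fun h => ⟨f a, hf a h, h, rfl⟩⟩
  · rw [List.nodup_flatMap]
    refine ⟨fun _ _ => hl.filter _, List.nodup_range.pairwise_of_forall_ne ?_⟩
    intro i _ j _ hij a hai haj
    simp only [List.mem_filter, decide_eq_true_eq] at hai haj
    exact hij (hai.2.symm.trans haj.2)

end Lists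

theorem inputWords_eq (x : List Bool) : MPCAlgorithm.inputWords x =
    (List.range x.length).map fun i => 2 * i + (x.getD i false).toNat := by
  refine List.ext_getElem (by simp [MPCAlgorithm.inputWords]) fun i h₁ h₂ => ?_
  have h : i < x.length := by simpa using h₂
  simp [MPCAlgorithm.inputWords, h]

theorem mem_inputWords {x : List Bool} {w : ℕ} : w ∈ MPCAlgorithm.inputWords x ↔
    w / 2 < x.length ∧ w % 2 = (x.getD (w / 2) false).toNat := by
  rw [inputWords_eq]
  simp only [List.mem_map, List.mem_range]
  constructor
  · rintro ⟨i, hi, rfl⟩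
    have := Bool.toNat_le (x.getD i false)
    have h : (2 * i + (x.getD i false).toNat) / 2 = i := by omega
    exact ⟨by rwa [h], by rw [h]; omega⟩
  · rintro ⟨h, h'⟩
    exact ⟨w / 2, h, by omega⟩

theorem nodup_inputWords (x : List Bool) : (MPCAlgorithm.inputWords x).Nodup := by
  rw [inputWords_eq]
  refine List.nodup_range.map fun i j hij => ?_
  have h₁ := Bool.toNat_le (x.getD i false)
  have h₂ := Bool.toNat_le (x.getD j false)
  omega

/-- Reading the bits of a string off its words, in whatever order these are stored. -/
theorem map_memb_eq_of_perm_inputWords {x : List Bool} {l : List ℕ}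
    (h : l.Perm (MPCAlgorithm.inputWords x)) :
    (List.range x.length).map (fun i => memb (2 * i + 1) l) = x := by
  refine List.ext_getElem (by simp) fun i h₁ h₂ => ?_
  have h₃ : (2 * i + 1) / 2 = i := by omega
  simp only [List.getElem_map, List.getElem_range, memb, h.mem_iff, mem_inputWords, h₃]
  cases hx : x[i] <;> simp [h₂, hx]

/-! ### Networks of cells -/

/-- A uniform family of networks of Boolean cells. In every step all cells are recomputed: a cell
`u` reads the cells `args (N, u)` and either asks the oracle about the string that it reads or
applies the local function `loc` to it. -/
structure Network where
  args : ℕ × ℕ → List ℕ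
  query : ℕ × ℕ → Bool
  loc : ℕ × ℕ × List Bool → Bool
  args_computable : Computable args
  query_computable : Computable query
  loc_computable : Computable loc

attribute [fun_prop] Network.args_computable Network.query_computable Network.loc_computable

namespace Network

variable (net : Network)

open Classical in
/-- The value of cell `u` after one step, from the present values `v`. -/
noncomputable def update (B : Language Bool) (N : ℕ) (v : ℕ → Bool) (u : ℕ) : Bool :=
  bif net.query (N, u) then decide ((net.args (N, u)).map v ∈ B)
  else net.loc (N, u, (net.args (N, u)).map v)

/-- Initially the bit at position `i` of the input is in the cell `2 * i + 1`. -/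
def initial (x : List Bool) (u : ℕ) : Bool := eqb (u % 2) 1 && x.getD (u / 2) false

/-- The values of all cells after `t` steps. -/
noncomputable def board (B : Language Bool) (x : List Bool) (t : ℕ) : ℕ → Bool :=
  (net.update B x.length)^[t] (initial x)

theorem board_succ (B : Language Bool) (x : List Bool) (t : ℕ) :
    net.board B x (t + 1) = net.update B x.length (net.board B x t) := by
  simp only [board, Function.iterate_succ', Function.comp_apply]

end Network

/-! ### The simulation of a network by a massively parallel computation -/

theorem pair_lt_mul_self_iff {a b n : ℕ} : Nat.pair a b < n * n ↔ a < n ∧ b < n := by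
  constructor
  · intro h
    have h₁ : a * a ≤ Nat.pair a b := by
      unfold Nat.pair; split <;> nlinarith
    have h₂ : b * b ≤ Nat.pair a b := by
      unfold Nat.pair; split <;> nlinarith
    exact ⟨Nat.mul_self_lt_mul_self_iff.1 (h₁.trans_lt h),
      Nat.mul_self_lt_mul_self_iff.1 (h₂.trans_lt h)⟩
  · rintro ⟨h₁, h₂⟩
    calc Nat.pair a b < (max a b + 1) ^ 2 := Nat.pair_lt_max_add_one_sq a b
      _ ≤ n ^ 2 := Nat.pow_le_pow_left (by omega) 2
      _ = n * n := sq n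

/-- The data from which the simulation of a network is built. The machines form a square with
`branch N ^ height` rows and columns; the machine in row `u` and column `w` has the number
`Nat.pair u w`, and row `u` is in charge of cell `u`. Oracle queries are answered by the algorithm
`orc`, run in parallel in all rows for at most `oracleRounds N` rounds. -/
structure Simulator where
  net : Network
  orc : MPCAlgorithm
  branch : ℕ → ℕ
  height : ℕ
  oracleRounds : ℕ → ℕ
  phases : ℕ → ℕ
  mem : ℕ → ℕ
  branch_computable : Computable branch
  oracleRounds_computable : Computable oracleRounds
  phases_computable : Computable phases
  mem_computable : Computable mem

attribute [fun_prop] Simulator.branch_computable Simulator.oracleRounds_computable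
  Simulator.phases_computable Simulator.mem_computable
  MPCAlgorithm.machines_computable MPCAlgorithm.memory_computable
  MPCAlgorithm.rounds_computable MPCAlgorithm.step_computable MPCAlgorithm.answer_computable

namespace Simulator

variable (S : Simulator)

/-- The number of rows and of columns. -/
def side (N : ℕ) : ℕ := S.branch N ^ S.height

/-- The number of rounds that simulate one step of the network. -/
def period (N : ℕ) : ℕ := S.height + S.oracleRounds N + 3

/-- The number of cells that cell `u` reads. -/
def arity (N u : ℕ) : ℕ := (S.net.args (N, u)).length

/-- The time at which row `u` starts the oracle algorithm, such that all rows end together. -/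
def start (N u : ℕ) : ℕ :=
  S.oracleRounds N + 1 - bif S.net.query (N, u) then S.orc.rounds (S.arity N u) else 0

/-- The column of row `u` that receives the bit at position `pos` of the string that cell `u`
reads. -/
def target (N u pos : ℕ) : ℕ :=
  bif S.net.query (N, u) then pos / S.orc.memory (S.arity N u) else 0

/-- Whether the machine in row `u` and column `j` takes part in an oracle computation. -/
def active (N u j : ℕ) : Bool := S.net.query (N, u) && ltb j (S.orc.machines (S.arity N u))

/-- The first round: input words are sent to column `0` of the row of their cell. -/
def scatter (c : List ℕ) : List ℕ × List (ℕ × ℕ) :=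
  ([], c.map fun w => (Nat.pair (2 * (w / 2) + 1) 0, w % 2))

/-- Round `e` of the broadcast of the value of a cell along its row: the first `branch N ^ e`
columns know the value, and each of them informs `branch N - 1` others. -/
def spread (N e m : ℕ) (c : List ℕ) : List ℕ × List (ℕ × ℕ) :=
  bif ltb m.unpair.2 (S.branch N ^ e) then
    ([c.headD 0], (List.range (S.branch N - 1)).map fun d =>
      (Nat.pair m.unpair.1 (m.unpair.2 + (d + 1) * S.branch N ^ e), c.headD 0))
  else (c, [])

/-- Row `u` sends the value of cell `u` to the rows of the cells that read it: the machine in column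
`Nat.pair w pos` serves the position `pos` of the string that cell `w` reads. -/
def route (N m : ℕ) (c : List ℕ) : List ℕ × List (ℕ × ℕ) :=
  bif eqb ((S.net.args (N, m.unpair.2.unpair.1))[m.unpair.2.unpair.2]?) (some m.unpair.1) then
    ([], [(Nat.pair m.unpair.2.unpair.1 (S.target N m.unpair.2.unpair.1 m.unpair.2.unpair.2),
      2 * m.unpair.2.unpair.2 + c.headD 0)])
  else ([], [])

/-- Round `s` of the time allotted to the oracle algorithm. -/
def consult (N s m : ℕ) (kept recv : List ℕ) : List ℕ × List (ℕ × ℕ) :=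
  bif S.active N m.unpair.1 m.unpair.2 && !ltb s (S.start N m.unpair.1) then
    ((S.orc.step (S.arity N m.unpair.1, m.unpair.2, s - S.start N m.unpair.1, kept, recv)).1,
      (S.orc.step (S.arity N m.unpair.1, m.unpair.2, s - S.start N m.unpair.1, kept, recv)).2.map
        fun a => (Nat.pair m.unpair.1 a.1, a.2))
  else (kept ++ recv, [])

/-- The new value of cell `u`, from the local memory of the machine in row `u` and column `0`. -/
def newValue (N u : ℕ) (kept recv : List ℕ) : Bool :=
  bif S.net.query (N, u) then S.orc.answer (S.arity N u, kept, recv)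
  else S.net.loc (N, u, (List.range (S.arity N u)).map fun i => memb (2 * i + 1) (kept ++ recv))

/-- The last round of a step: the machines in column `0` compute the new values of the cells. -/
def finish (N m : ℕ) (kept recv : List ℕ) : List ℕ × List (ℕ × ℕ) :=
  bif eqb m.unpair.2 0 then ([(S.newValue N m.unpair.1 kept recv).toNat], []) else ([], [])

/-- What a machine does in round `e` of the simulation of a step of the network. -/
def phaseStep (N m e : ℕ) (kept recv : List ℕ) : List ℕ × List (ℕ × ℕ) :=
  bif ltb e S.height then S.spread N e m (kept ++ recv)
  else bif eqb e S.height then S.route N m (kept ++ recv)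
  else bif ltb e (S.height + S.oracleRounds N + 2) then
    S.consult N (e - (S.height + 1)) m kept recv
  else S.finish N m kept recv

section Computability

variable {α : Type*} [Primcodable α]

theorem computable_arity {f g : α → ℕ} (hf : Computable f) (hg : Computable g) :
    Computable fun a => S.arity (f a) (g a) := by
  unfold arity; fun_prop

attribute [local fun_prop] computable_arity

theorem computable_start {f g : α → ℕ} (hf : Computable f) (hg : Computable g) :
    Computable fun a => S.start (f a) (g a) := by
  unfold start; fun_prop

theorem computable_target {f g h : α → ℕ} (hf : Computable f) (hg : Computable g)
    (hh : Computable h) : Computable fun a => S.target (f a) (g a) (h a) := by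
  unfold target; fun_prop

theorem computable_active {f g h : α → ℕ} (hf : Computable f) (hg : Computable g)
    (hh : Computable h) : Computable fun a => S.active (f a) (g a) (h a) := by
  unfold active; fun_prop

attribute [local fun_prop] computable_start computable_target computable_active

theorem computable_scatter {c : α → List ℕ} (hc : Computable c) :
    Computable fun a => scatter (c a) := by
  unfold scatter; fun_prop

theorem computable_spread {f g h : α → ℕ} {c : α → List ℕ} (hf : Computable f)
    (hg : Computable g) (hh : Computable h) (hc : Computable c) :
    Computable fun a => S.spread (f a) (g a) (h a) (c a) := by
  unfold spread; fun_prop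

theorem computable_route {f g : α → ℕ} {c : α → List ℕ} (hf : Computable f)
    (hg : Computable g) (hc : Computable c) :
    Computable fun a => S.route (f a) (g a) (c a) := by
  unfold route; fun_prop

theorem computable_consult {f g h : α → ℕ} {c d : α → List ℕ} (hf : Computable f)
    (hg : Computable g) (hh : Computable h) (hc : Computable c) (hd : Computable d) :
    Computable fun a => S.consult (f a) (g a) (h a) (c a) (d a) := by
  unfold consult; fun_prop

theorem computable_finish {f g : α → ℕ} {c d : α → List ℕ} (hf : Computable f)
    (hg : Computable g) (hc : Computable c) (hd : Computable d) :
    Computable fun a => S.finish (f a) (g a) (c a) (d a) := by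
  unfold finish newValue; fun_prop

attribute [local fun_prop] computable_spread computable_route computable_consult computable_finish

theorem computable_phaseStep {f g h : α → ℕ} {c d : α → List ℕ} (hf : Computable f)
    (hg : Computable g) (hh : Computable h) (hc : Computable c) (hd : Computable d) :
    Computable fun a => S.phaseStep (f a) (g a) (h a) (c a) (d a) := by
  unfold phaseStep; fun_prop

end Computability

/-- The simulation of a network, as an algorithm. -/
def algorithm : MPCAlgorithm where
  machines N := S.side N * S.side N
  memory := S.mem
  rounds N := S.phases N * S.period N + 1
  step p := bif eqb p.2.2.1 0 then scatter (p.2.2.2.1 ++ p.2.2.2.2)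
    else S.phaseStep p.1 p.2.1 ((p.2.2.1 - 1) % S.period p.1) p.2.2.2.1 p.2.2.2.2
  answer p := eqb ((p.2.1 ++ p.2.2).headD 0) 1
  machines_computable := by unfold side; fun_prop
  memory_computable := S.mem_computable
  rounds_computable := by unfold period; fun_prop
  step_computable := by
    unfold period
    refine computable_cond (by fun_prop) (computable_scatter (by fun_prop))
      (S.computable_phaseStep ?_ ?_ ?_ ?_ ?_) <;> fun_prop
  answer_computable := by fun_prop

end Simulator

/-- The words that machine `j` receives when machine `k < n` sends the messages `o k`. -/
def inbox (n : ℕ) (o : ℕ → List (ℕ × ℕ)) (j : ℕ) : List ℕ :=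
  (List.range n).flatMap fun k => ((o k).filter fun m => m.1 = j).map Prod.snd

theorem mem_inbox {n : ℕ} {o : ℕ → List (ℕ × ℕ)} {j w : ℕ} :
    w ∈ inbox n o j ↔ ∃ k < n, (j, w) ∈ o k := by
  simp [inbox]

theorem inbox_eq_nil {n : ℕ} {o : ℕ → List (ℕ × ℕ)} {j : ℕ}
    (h : ∀ k < n, ∀ m ∈ o k, m.1 ≠ j) : inbox n o j = [] := by
  refine List.eq_nil_iff_forall_not_mem.2 fun w hw => ?_
  obtain ⟨k, hk, hm⟩ := mem_inbox.1 hw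
  exact h k hk _ hm rfl

theorem inbox_eq_of_unique {n : ℕ} {o : ℕ → List (ℕ × ℕ)} {j k₀ : ℕ} (h₀ : k₀ < n)
    (h : ∀ k < n, ∀ m ∈ o k, m.1 = j → k = k₀) :
    inbox n o j = ((o k₀).filter fun m => m.1 = j).map Prod.snd := by
  refine flatMap_range_of_unique h₀ fun k hk hne => ?_
  rw [List.map_eq_nil_iff, List.filter_eq_nil_iff]
  intro m hm hmj
  exact hne (h k hk m hm (by simpa using hmj))

namespace Simulator

variable (S : Simulator) (N : ℕ)

/-- The conditions on the parameters under which the simulation on inputs of length `N` is correct.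
`W` bounds the words that are used. -/
structure Sound (κ W : ℕ) : Prop where
  args_lt : ∀ u pos a, (S.net.args (N, u))[pos]? = some a →
    a < S.side N ∧ u < S.side N ∧ Nat.pair u pos < S.side N
  rounds_le : ∀ u, S.net.query (N, u) = true →
    S.orc.rounds (S.arity N u) ≤ S.oracleRounds N
  machines_le : ∀ u, S.net.query (N, u) = true →
    S.orc.machines (S.arity N u) ≤ S.side N
  memory_le : ∀ u, S.net.query (N, u) = true → S.orc.memory (S.arity N u) ≤ S.mem N
  arity_le : ∀ u, S.net.query (N, u) = false → S.arity N u ≤ S.mem N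
  branch_pos : 1 ≤ S.branch N
  branch_le : S.branch N ≤ S.mem N
  two_mul_arity_le : ∀ u, 2 * S.arity N u ≤ W
  pow_le : ∀ u, S.net.query (N, u) = true → (S.arity N u + 2) ^ κ ≤ W
  two_le : 2 ≤ W

/-- What machine `k` keeps and sends in round `e` of a phase. -/
def out (e : ℕ) (σ : MPCAlgorithm.State) (k : ℕ) : List ℕ × List (ℕ × ℕ) :=
  S.phaseStep N k e (σ k).1 (σ k).2

/-- The state after round `e` of a phase. -/
def advance (e : ℕ) (σ : MPCAlgorithm.State) : MPCAlgorithm.State := fun j =>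
  ((S.out N e σ j).1, inbox (S.side N * S.side N) (fun k => (S.out N e σ k).2) j)

theorem next_algorithm (t : ℕ) (σ : MPCAlgorithm.State) :
    S.algorithm.next N (t + 1) σ = S.advance N (t % S.period N) σ := rfl

/-- All words in the local memory of machine `m`. -/
def content (σ : MPCAlgorithm.State) (m : ℕ) : List ℕ := (σ m).1 ++ (σ m).2

/-- Exactly the first `branch N ^ e` columns know the value of the cell of their row. An empty
memory stands for the value `false`. -/
def Knows (e : ℕ) (v : ℕ → Bool) (σ : MPCAlgorithm.State) : Prop :=
  ∀ u < S.side N, ∀ w < S.side N,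
    (w < S.branch N ^ e → (content σ (Nat.pair u w)).length ≤ 1 ∧
      (content σ (Nat.pair u w)).headD 0 = (v u).toNat) ∧
    (S.branch N ^ e ≤ w → content σ (Nat.pair u w) = [])

variable {S N} {e κ W : ℕ} {v : ℕ → Bool} {σ : MPCAlgorithm.State}

theorem exists_pair_of_lt {k n : ℕ} (hk : k < n * n) :
    ∃ u w, k = Nat.pair u w ∧ u < n ∧ w < n := by
  refine ⟨k.unpair.1, k.unpair.2, (Nat.pair_unpair k).symm, pair_lt_mul_self_iff.1 ?_⟩
  rwa [Nat.pair_unpair]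

theorem out_spread (he : e < S.height) (u w : ℕ) :
    S.out N e σ (Nat.pair u w) = if w < S.branch N ^ e then
      ([(content σ (Nat.pair u w)).headD 0], (List.range (S.branch N - 1)).map fun d =>
        (Nat.pair u (w + (d + 1) * S.branch N ^ e), (content σ (Nat.pair u w)).headD 0))
      else (content σ (Nat.pair u w), []) := by
  simp [out, phaseStep, spread, he, content, Bool.cond_eq_ite]

/-- In a round of the broadcast, column `w` hears from column `w % branch N ^ e` only. -/
theorem Knows.advance (hS : S.Sound N κ W) (h : S.Knows N e v σ) (he : e < S.height) :
    S.Knows N (e + 1) v (S.advance N e σ) := by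
  intro u hu w hw
  have hb : 0 < S.branch N ^ e := pow_pos hS.branch_pos e
  have hpow : S.branch N ^ (e + 1) = (S.branch N - 1) * S.branch N ^ e + S.branch N ^ e := by
    obtain ⟨b, hb'⟩ := Nat.exists_eq_add_of_le' hS.branch_pos
    rw [hb', pow_succ]; simp only [Nat.add_sub_cancel]; ring
  -- who sends a message to column `w` of row `u`
  have hsend : ∀ k < S.side N * S.side N, ∀ m ∈ (S.out N e σ k).2, m.1 = Nat.pair u w →
      k = Nat.pair u (w % S.branch N ^ e) ∧ S.branch N ^ e ≤ w ∧ w < S.branch N ^ (e + 1) := by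
    intro k hk m hm hmj
    obtain ⟨u', w', rfl, -, -⟩ := exists_pair_of_lt hk
    rw [out_spread he] at hm
    split_ifs at hm with hw'
    · simp only [List.mem_map, List.mem_range] at hm
      obtain ⟨d, hd, rfl⟩ := hm
      obtain ⟨rfl, rfl⟩ := Nat.pair_eq_pair.1 hmj
      refine ⟨?_, ?_, ?_⟩
      · rw [Nat.add_mul_mod_self_right, Nat.mod_eq_of_lt hw']
      · nlinarith
      · have : (d + 1) * S.branch N ^ e ≤ (S.branch N - 1) * S.branch N ^ e :=
          Nat.mul_le_mul_right _ hd
        omega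
    · simp at hm
  have hcontent : content (S.advance N e σ) (Nat.pair u w) =
      (S.out N e σ (Nat.pair u w)).1 ++
        inbox (S.side N * S.side N) (fun k => (S.out N e σ k).2) (Nat.pair u w) := rfl
  rw [hcontent, out_spread he]
  rcases lt_or_ge w (S.branch N ^ e) with hwb | hwb
  · rw [inbox_eq_nil fun k hk m hm hmj => (hsend k hk m hm hmj).2.1.not_gt hwb]
    refine ⟨fun _ => ?_, fun h' => ?_⟩
    · simpa [hwb] using ((h u hu w hw).1 hwb).2
    · have : S.branch N ^ e ≤ S.branch N ^ (e + 1) := by omega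
      omega
  · have hnil := (h u hu w hw).2 hwb
    refine ⟨fun hw' => ?_, fun hw' => ?_⟩
    · have hmod : w % S.branch N ^ e < S.branch N ^ e := Nat.mod_lt _ hb
      have hside : w % S.branch N ^ e < S.side N := (Nat.mod_le _ _).trans_lt hw
      have hdiv : 1 ≤ w / S.branch N ^ e := (Nat.one_le_div_iff hb).2 hwb
      have hdiv' : w / S.branch N ^ e < S.branch N := by
        rw [Nat.div_lt_iff_lt_mul hb, ← pow_succ']; exact hw'
      rw [inbox_eq_of_unique (pair_lt_mul_self_iff.2 ⟨hu, hside⟩)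
        fun k hk m hm hmj => (hsend k hk m hm hmj).1, out_spread he, if_pos hmod]
      simp only [not_lt.2 hwb, if_false, hnil, List.nil_append, List.filter_map, List.map_map]
      rw [filter_range_eq_singleton (a := w / S.branch N ^ e - 1) (by omega)]
      · simpa using ((h u hu _ hside).1 hmod).2
      · intro d
        simp only [Function.comp_apply, decide_eq_true_eq, Nat.pair_eq_pair, true_and]
        have := Nat.mod_add_div' w (S.branch N ^ e)
        constructor
        · intro h'
          have h'' : (d + 1) * S.branch N ^ e = w / S.branch N ^ e * S.branch N ^ e := by omega
          have := Nat.eq_of_mul_eq_mul_right hb h''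
          omega
        · rintro rfl
          rw [Nat.sub_add_cancel hdiv]
          exact this
    · rw [inbox_eq_nil fun k hk m hm hmj => (hsend k hk m hm hmj).2.2.not_ge hw']
      simp [hnil, not_lt.2 hwb]

theorem out_spread_length_le (hS : S.Sound N κ W) (he : e < S.height) (k : ℕ) :
    (S.out N e σ k).2.length ≤ S.mem N := by
  rw [← Nat.pair_unpair k, out_spread he]
  have := hS.branch_le
  split_ifs
  · simp only [List.length_map, List.length_range]; omega
  · simp

theorem out_spread_address_lt (hS : S.Sound N κ W) (he : e < S.height) {k : ℕ}
    (hk : k < S.side N * S.side N) :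
    ∀ m ∈ (S.out N e σ k).2, m.1 < S.side N * S.side N := by
  obtain ⟨u, w, rfl, hu, -⟩ := exists_pair_of_lt hk
  rw [out_spread he]
  intro m hm
  split_ifs at hm with hw
  · simp only [List.mem_map, List.mem_range] at hm
    obtain ⟨d, hd, rfl⟩ := hm
    refine pair_lt_mul_self_iff.2 ⟨hu, ?_⟩
    have h₁ : (d + 1) * S.branch N ^ e ≤ (S.branch N - 1) * S.branch N ^ e :=
      Nat.mul_le_mul_right _ hd
    have h₂ : S.branch N ^ (e + 1) ≤ S.side N := Nat.pow_le_pow_right hS.branch_pos he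
    have hpow : S.branch N ^ (e + 1) = (S.branch N - 1) * S.branch N ^ e + S.branch N ^ e := by
      obtain ⟨b, hb'⟩ := Nat.exists_eq_add_of_le' hS.branch_pos
      rw [hb', pow_succ]; simp only [Nat.add_sub_cancel]; ring
    omega
  · simp at hm

end Simulator

/-- `M` decides `A` with words of at most `κ log₂ (N + 2)` bits. -/
def MPCAlgorithm.DecidesWith (M : MPCAlgorithm) (κ : ℕ) (A : Language Bool) : Prop :=
  (∀ N, 0 < M.machines N ∧ N ≤ M.machines N * M.memory N) ∧
  ∀ (x : List Bool) (D : ℕ → List ℕ), M.IsDistribution x D →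
    M.Respects κ x.length D ∧ (M.result x.length D = true ↔ x ∈ A)

namespace Simulator

variable (S : Simulator) (N : ℕ)

/-- The string that cell `u` reads when the cells have the values `v`. -/
def reading (v : ℕ → Bool) (u : ℕ) : List Bool := (S.net.args (N, u)).map v

/-- `D` is what row `u` starts its computation from: a distribution, among the machines running the
oracle algorithm, of the string that cell `u` reads, or the whole string in column `0`. -/
structure Dealt (v : ℕ → Bool) (u : ℕ) (D : ℕ → List ℕ) : Prop where
  of_query : S.net.query (N, u) = true → S.orc.IsDistribution (S.reading N v u) D ∧
    ∀ j, S.orc.machines (S.arity N u) ≤ j → D j = []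
  of_not_query : S.net.query (N, u) = false →
    (D 0).Perm (MPCAlgorithm.inputWords (S.reading N v u)) ∧ ∀ j, j ≠ 0 → D j = []

/-- The state after `s` of the rounds that are allotted to the oracle algorithm. -/
def Ready (s : ℕ) (v : ℕ → Bool) (σ : MPCAlgorithm.State) : Prop :=
  ∀ u < S.side N, ∃ D, S.Dealt N v u D ∧ ∀ j < S.side N,
    content σ (Nat.pair u j) = (if S.active N u j = true then
      (S.orc.run (S.arity N u) D (s - S.start N u) j).1 ++
        (S.orc.run (S.arity N u) D (s - S.start N u) j).2 else D j) ∧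
    (0 < s → S.active N u j = true →
      σ (Nat.pair u j) = S.orc.run (S.arity N u) D (s - S.start N u) j)

variable {S N} {κ W : ℕ} {v : ℕ → Bool} {σ : MPCAlgorithm.State} {B : Language Bool}

@[simp]
theorem length_reading (u : ℕ) : (S.reading N v u).length = S.arity N u := by
  simp [reading, arity]

theorem out_route (u w : ℕ) : S.out N S.height σ (Nat.pair u w) =
    if (S.net.args (N, w.unpair.1))[w.unpair.2]? = some u then
      ([], [(Nat.pair w.unpair.1 (S.target N w.unpair.1 w.unpair.2),
        2 * w.unpair.2 + (content σ (Nat.pair u w)).headD 0)])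
    else ([], []) := by
  simp [out, phaseStep, route, ltb, eqb, content, Bool.cond_eq_ite]

/-- The words that the machine in row `u` and column `j` receives when the values are routed. -/
theorem inbox_route_perm (hS : S.Sound N κ W) (h : S.Knows N S.height v σ) (u j : ℕ) :
    (inbox (S.side N * S.side N) (fun k => (S.out N S.height σ k).2) (Nat.pair u j)).Perm
      (((List.range (S.arity N u)).filter fun i => S.target N u i = j).map
        fun i => 2 * i + ((S.reading N v u).getD i false).toNat) := by
  -- the only message that a machine may send
  have hmsg : ∀ k < S.side N * S.side N, ∀ x, (Nat.pair u j, x) ∈ (S.out N S.height σ k).2 ↔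
      ∃ i a, (S.net.args (N, u))[i]? = some a ∧ k = Nat.pair a (Nat.pair u i) ∧
        S.target N u i = j ∧ x = 2 * i + (v a).toNat := by
    intro k hk x
    obtain ⟨a, w, rfl, ha, hw⟩ := exists_pair_of_lt hk
    have hv := ((h a ha w hw).1 hw).2
    rw [out_route, hv]
    constructor
    · intro hm
      split_ifs at hm with hw'
      · simp only [List.mem_singleton, Prod.mk.injEq, Nat.pair_eq_pair] at hm
        obtain ⟨⟨rfl, rfl⟩, rfl⟩ := hm
        exact ⟨w.unpair.2, a, hw', by rw [Nat.pair_unpair], rfl, rfl⟩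
      · simp at hm
    · rintro ⟨i, a', hi, hk', rfl, rfl⟩
      obtain ⟨rfl, rfl⟩ := Nat.pair_eq_pair.1 hk'
      simp [hi]
  rw [List.perm_ext_iff_of_nodup]
  · intro x
    simp only [mem_inbox, List.mem_map, List.mem_filter, List.mem_range, decide_eq_true_eq]
    constructor
    · rintro ⟨k, hk, hx⟩
      obtain ⟨i, a, hi, -, ht, rfl⟩ := (hmsg k hk x).1 hx
      have hi' : i < S.arity N u := (List.getElem?_eq_some_iff.1 hi).1
      refine ⟨i, ⟨hi', ht⟩, ?_⟩
      simp [reading, List.getD_eq_getElem?_getD, hi]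
    · rintro ⟨i, ⟨hi, ht⟩, rfl⟩
      have hi' : (S.net.args (N, u))[i]? = some ((S.net.args (N, u))[i]'hi) :=
        List.getElem?_eq_getElem hi
      obtain ⟨h₁, h₂, h₃⟩ := hS.args_lt u i _ hi'
      refine ⟨_, pair_lt_mul_self_iff.2 ⟨h₁, h₃⟩,
        (hmsg _ (pair_lt_mul_self_iff.2 ⟨h₁, h₃⟩) _).2 ⟨i, _, hi', rfl, ht, ?_⟩⟩
      simp [reading, List.getD_eq_getElem?_getD, hi']
  · rw [inbox, List.nodup_flatMap]
    refine ⟨fun k _ => ?_, List.Pairwise.imp_of_mem ?_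
      (List.nodup_range.pairwise_of_forall_ne (r := (· ≠ ·)) fun a _ b _ hab => hab)⟩
    · rw [← Nat.pair_unpair k, out_route]
      split_ifs
      · rw [List.filter_singleton]
        rw [Bool.cond_eq_ite]
        split <;> simp
      · simp
    · intro k k' hk hk' hne x hx hx'
      have hb : (Nat.pair u j, x) ∈ (S.out N S.height σ k).2 := by simpa using hx
      have hb' : (Nat.pair u j, x) ∈ (S.out N S.height σ k').2 := by simpa using hx'
      obtain ⟨i, a, hi, rfl, -, hx⟩ := (hmsg k (List.mem_range.1 hk) _).1 hb
      obtain ⟨i', a', hi', rfl, -, hx'⟩ := (hmsg k' (List.mem_range.1 hk') _).1 hb'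
      have h₁ := Bool.toNat_le (v a)
      have h₂ := Bool.toNat_le (v a')
      have : i = i' := by omega
      subst this
      rw [hi] at hi'
      simp only [Option.some.injEq] at hi'
      exact hne (by rw [hi'])
  · refine (List.nodup_range.filter _).map fun i i' hii => ?_
    have h₁ := Bool.toNat_le ((S.reading N v u).getD i false)
    have h₂ := Bool.toNat_le ((S.reading N v u).getD i' false)
    omega

theorem start_pos (hS : S.Sound N κ W) (u : ℕ) : 1 ≤ S.start N u := by
  have := hS.rounds_le u
  unfold start
  cases hq : S.net.query (N, u)
  · simp
  · simp only [cond_true]; have := this hq; omega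

theorem length_filter_div_le (r s j : ℕ) (hs : 0 < s) :
    ((List.range r).filter fun i => i / s = j).length ≤ s := by
  have hsub : ((List.range r).filter fun i => i / s = j) ⊆ (List.range s).map (j * s + ·) := by
    intro i hi
    simp only [List.mem_filter, decide_eq_true_eq] at hi
    simp only [List.mem_map, List.mem_range]
    exact ⟨i % s, Nat.mod_lt _ hs, by rw [← hi.2]; exact Nat.div_add_mod' i s⟩
  simpa using ((List.nodup_range.filter _).subperm hsub).length_le

/-- After the broadcast, the routing of the values deals the string that a cell reads to its row. -/
theorem Knows.ready (hS : S.Sound N κ W) (hB : S.orc.DecidesWith κ B)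
    (h : S.Knows N S.height v σ) : S.Ready N 0 v (S.advance N S.height σ) := by
  intro u hu
  set D : ℕ → List ℕ := fun j =>
    inbox (S.side N * S.side N) (fun k => (S.out N S.height σ k).2) (Nat.pair u j) with hD
  have hperm := fun j => inbox_route_perm hS h u j
  refine ⟨D, ⟨fun hq => ?_, fun hq => ?_⟩, fun j hj => ⟨?_, fun h0 => absurd h0 (lt_irrefl 0)⟩⟩
  · have hmem := (hB.1 (S.arity N u)).2
    have htar : ∀ i ∈ List.range (S.arity N u),
        S.target N u i < S.orc.machines (S.arity N u) := by
      intro i hi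
      simp only [target, hq, cond_true]
      refine Nat.div_lt_of_lt_mul ?_
      rw [mul_comm]
      exact (List.mem_range.1 hi).trans_le hmem
    refine ⟨⟨?_, fun k _ => ?_⟩, fun j hj => ?_⟩
    · rw [length_reading, inputWords_eq, length_reading]
      refine (List.Perm.flatMap_left _ fun j _ => hperm j).trans ?_
      rw [← List.map_flatMap]
      exact (flatMap_filter_perm List.nodup_range htar).map _
    · rw [(hperm k).length_eq, List.length_map, length_reading]
      rcases Nat.eq_zero_or_pos (S.orc.memory (S.arity N u)) with h0 | h0
      · rw [h0, mul_zero] at hmem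
        simp [Nat.le_zero.1 hmem]
      · simpa [target, hq] using length_filter_div_le _ _ k h0
    · have hp := hperm j
      rw [List.filter_eq_nil_iff.2] at hp
      · exact List.perm_nil.1 hp
      · intro i hi
        have := htar i hi
        simp only [decide_eq_true_eq]
        omega
  · refine ⟨?_, fun j hj => ?_⟩
    · have hp := hperm 0
      rw [List.filter_eq_self.2 (by simp [target, hq])] at hp
      rwa [inputWords_eq, length_reading]
    · have hp := hperm j
      rw [List.filter_eq_nil_iff.2 (by simp [target, hq, hj.symm])] at hp
      exact List.perm_nil.1 hp
  · have h₁ : (S.out N S.height σ (Nat.pair u j)).1 = [] := by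
      rw [out_route]; split_ifs <;> rfl
    have h₂ : content (S.advance N S.height σ) (Nat.pair u j) = D j := by
      rw [content, show (S.advance N S.height σ (Nat.pair u j)).1 = [] from h₁]
      rfl
    rw [h₂, Nat.zero_sub]
    simp [MPCAlgorithm.run]

theorem out_consult {s : ℕ} (hs : s ≤ S.oracleRounds N) (u j : ℕ) :
    S.out N (S.height + 1 + s) σ (Nat.pair u j) =
      if S.active N u j = true ∧ S.start N u ≤ s then
        ((S.orc.step (S.arity N u, j, s - S.start N u, σ (Nat.pair u j))).1,
          (S.orc.step (S.arity N u, j, s - S.start N u, σ (Nat.pair u j))).2.map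
            fun a => (Nat.pair u a.1, a.2))
      else (content σ (Nat.pair u j), []) := by
  have h₁ : ltb (S.height + 1 + s) S.height = false := by simp [ltb]; omega
  have h₂ : eqb (S.height + 1 + s) S.height = false := by simp [eqb]; omega
  have h₃ : ltb (S.height + 1 + s) (S.height + S.oracleRounds N + 2) = true := by
    simp [ltb]; omega
  have h₄ : S.height + 1 + s - (S.height + 1) = s := by omega
  rw [out, phaseStep, h₁, h₂, h₃, h₄]
  simp only [cond_false, cond_true, consult, content, Nat.unpair_pair]
  simp only [Bool.cond_eq_ite, Bool.and_eq_true, Bool.not_eq_true', ← Bool.not_eq_true,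
    ltb_eq_true, not_lt, Prod.mk.eta]

theorem active_eq_true {u j : ℕ} : S.active N u j = true ↔
    S.net.query (N, u) = true ∧ j < S.orc.machines (S.arity N u) := by
  simp [active]

/-- A row whose start has not come keeps what it has been dealt; afterwards it follows the oracle
algorithm. -/
theorem Ready.consult {s : ℕ} (hS : S.Sound N κ W) (hB : S.orc.DecidesWith κ B)
    (hs : s ≤ S.oracleRounds N) (h : S.Ready N s v σ) :
    S.Ready N (s + 1) v (S.advance N (S.height + 1 + s) σ) := by
  intro u hu
  obtain ⟨D, hD, hσ⟩ := h u hu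
  refine ⟨D, hD, ?_⟩
  -- machines communicate within their rows only
  have hrow : ∀ k < S.side N * S.side N, ∀ m ∈ (S.out N (S.height + 1 + s) σ k).2, ∀ j,
      m.1 = Nat.pair u j → ∃ j' < S.side N, k = Nat.pair u j' ∧ S.active N u j' = true ∧
        S.start N u ≤ s ∧ ∃ a ∈ (S.orc.step (S.arity N u, j', s - S.start N u,
          σ (Nat.pair u j'))).2, a.1 = j := by
    intro k hk m hm j hmj
    obtain ⟨u', j', rfl, -, hj'⟩ := exists_pair_of_lt hk
    rw [out_consult hs] at hm
    split_ifs at hm with hc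
    · simp only [List.mem_map] at hm
      obtain ⟨a, ha, rfl⟩ := hm
      obtain ⟨rfl, rfl⟩ := Nat.pair_eq_pair.1 hmj
      exact ⟨j', hj', rfl, hc.1, hc.2, a, ha, rfl⟩
    · simp at hm
  have hadv : ∀ j, S.advance N (S.height + 1 + s) σ (Nat.pair u j) =
      ((S.out N (S.height + 1 + s) σ (Nat.pair u j)).1,
        inbox (S.side N * S.side N) (fun k => (S.out N (S.height + 1 + s) σ k).2)
          (Nat.pair u j)) := fun _ => rfl
  rcases lt_or_ge s (S.start N u) with hlt | hge
  · have hz : s + 1 - S.start N u = 0 := by omega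
    have hz' : s - S.start N u = 0 := by omega
    intro j hj
    have hst : S.advance N (S.height + 1 + s) σ (Nat.pair u j) = (D j, []) := by
      rw [hadv, inbox_eq_nil fun k hk m hm hmj => ?_, out_consult hs, if_neg (by omega),
        (hσ j hj).1, hz']
      · simp [MPCAlgorithm.run]
      · obtain ⟨_, _, _, _, h', _⟩ := hrow k hk m hm j hmj
        omega
    rw [content, hst, hz]
    simp [MPCAlgorithm.run]
  · have hq : S.net.query (N, u) = true := by
      by_contra hq
      simp [start, Bool.eq_false_iff.2 hq] at hge
      omega
    have hs0 : 0 < s := (start_pos hS u).trans hge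
    have hsub : s + 1 - S.start N u = s - S.start N u + 1 := by omega
    obtain ⟨hdist, hout⟩ := hD.of_query hq
    have hlen : (S.reading N v u).length = S.arity N u := length_reading u
    have hresp := (hB.2 _ D hdist).1
    rw [hlen] at hresp
    have hround : s - S.start N u < S.orc.rounds (S.arity N u) := by
      have := hS.rounds_le u hq
      simp only [start, hq, cond_true] at hge ⊢
      omega
    have hact : ∀ j < S.side N, S.active N u j = true →
        S.orc.step (S.arity N u, j, s - S.start N u, σ (Nat.pair u j)) =
        S.orc.act (S.arity N u) (s - S.start N u)
          (S.orc.run (S.arity N u) D (s - S.start N u)) j := by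
      intro j hj ha
      rw [(hσ j hj).2 hs0 ha, MPCAlgorithm.act]
    intro j hj
    by_cases ha : S.active N u j = true
    · have hst : S.advance N (S.height + 1 + s) σ (Nat.pair u j) =
          S.orc.run (S.arity N u) D (s + 1 - S.start N u) j := by
        rw [hadv, hsub, MPCAlgorithm.run, MPCAlgorithm.next, out_consult hs,
          if_pos ⟨ha, hge⟩, hact j hj ha]
        refine Prod.ext rfl ?_
        simp only
        rw [inbox, flatMap_range_of_support (m := S.orc.machines (S.arity N u))
          (φ := fun j' => Nat.pair u j')]
        · refine List.flatMap_congr fun j' hj' => ?_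
          have hj'' := (List.mem_range.1 hj').trans_le (hS.machines_le u hq)
          have ha' := active_eq_true.2 ⟨hq, List.mem_range.1 hj'⟩
          rw [out_consult hs, if_pos ⟨ha', hge⟩, hact j' hj'' ha']
          simp only [List.filter_map, List.map_map]
          refine congrArg₂ _ rfl (List.filter_congr fun a _ => ?_)
          simp
        · exact fun i i' hi _ => Nat.pair_lt_pair_right u hi
        · exact fun i hi => pair_lt_mul_self_iff.2 ⟨hu, hi.trans_le (hS.machines_le u hq)⟩
        · intro k hk hne
          rw [List.map_eq_nil_iff, List.filter_eq_nil_iff]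
          intro m hm hmj
          obtain ⟨j', _, rfl, ha', _⟩ := hrow k hk m hm j (by simpa using hmj)
          exact hne j' (active_eq_true.1 ha').2 rfl
      exact ⟨by rw [content, hst, if_pos ha], fun _ _ => hst⟩
    · have hj' : S.orc.machines (S.arity N u) ≤ j := by
        by_contra hj'
        exact ha (active_eq_true.2 ⟨hq, by omega⟩)
      refine ⟨?_, fun _ ha' => absurd ha' ha⟩
      rw [content, hadv, inbox_eq_nil fun k hk m hm hmj => ?_, out_consult hs,
        if_neg (fun h' => ha h'.1), (hσ j hj).1]
      · simp [ha]
      · obtain ⟨j', hj', _, ha', _, a, haa, haj⟩ := hrow k hk m hm j hmj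
        rw [hact j' hj' ha'] at haa
        have := ((hresp j' (active_eq_true.1 ha').2).2 _ hround).2 a haa
        omega

end Simulator

namespace Simulator

variable {S : Simulator} {N κ W : ℕ} {v : ℕ → Bool} {σ : MPCAlgorithm.State} {B : Language Bool}

theorem side_pos (hS : S.Sound N κ W) : 0 < S.side N := pow_pos hS.branch_pos _

theorem out_finish (u w : ℕ) :
    S.out N (S.height + 1 + (S.oracleRounds N + 1)) σ (Nat.pair u w) =
      if w = 0 then ([(S.newValue N u (σ (Nat.pair u w)).1 (σ (Nat.pair u w)).2).toNat], [])
      else ([], []) := by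
  have h₁ : ltb (S.height + 1 + (S.oracleRounds N + 1)) S.height = false := by simp [ltb]; omega
  have h₂ : eqb (S.height + 1 + (S.oracleRounds N + 1)) S.height = false := by simp [eqb]; omega
  have h₃ : ltb (S.height + 1 + (S.oracleRounds N + 1)) (S.height + S.oracleRounds N + 2) =
      false := by simp [ltb]; omega
  rw [out, phaseStep, h₁, h₂, h₃]
  simp [finish, eqb, Bool.cond_eq_ite]

/-- All rows end their oracle computations together, and column `0` knows the new values. -/
theorem Ready.finish (hS : S.Sound N κ W) (hB : S.orc.DecidesWith κ B)
    (h : S.Ready N (S.oracleRounds N + 1) v σ) :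
    S.Knows N 0 (S.net.update B N v)
      (S.advance N (S.height + 1 + (S.oracleRounds N + 1)) σ) := by
  intro u hu w hw
  have hcontent : content (S.advance N (S.height + 1 + (S.oracleRounds N + 1)) σ)
      (Nat.pair u w) = (S.out N (S.height + 1 + (S.oracleRounds N + 1)) σ (Nat.pair u w)).1 := by
    rw [content, show (S.advance N (S.height + 1 + (S.oracleRounds N + 1)) σ
      (Nat.pair u w)).2 = [] from inbox_eq_nil fun k _ m hm => ?_]
    · exact List.append_nil _
    · rw [← Nat.pair_unpair k, out_finish] at hm
      split_ifs at hm <;> simp at hm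
  rw [hcontent, out_finish, pow_zero]
  refine ⟨fun hw1 => ?_, fun hw1 => by rw [if_neg (by omega)]⟩
  obtain rfl : w = 0 := by omega
  simp only [if_true, List.length_singleton, le_refl, List.headD_cons, true_and]
  congr 1
  obtain ⟨D, hD, hσ⟩ := h u hu
  obtain ⟨hc, hst⟩ := hσ 0 hw
  have hlen : (S.reading N v u).length = S.arity N u := length_reading u
  cases hq : S.net.query (N, u)
  · have hact : ¬ S.active N u 0 = true := by simp [active, hq]
    have hp := (hD.of_not_query hq).1
    rw [if_neg hact] at hc
    have hval := map_memb_eq_of_perm_inputWords hp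
    rw [hlen, ← hc] at hval
    simp only [newValue, hq, cond_false, Network.update]
    rw [content] at hval
    rw [hval, reading]
  · obtain ⟨hdist, -⟩ := hD.of_query hq
    have hact : S.active N u 0 = true := active_eq_true.2 ⟨hq, (hB.1 _).1⟩
    have hans := (hB.2 _ D hdist).2
    rw [hlen, MPCAlgorithm.result] at hans
    have hend : S.oracleRounds N + 1 - S.start N u = S.orc.rounds (S.arity N u) := by
      have := hS.rounds_le u hq
      simp only [start, hq, cond_true]
      omega
    have hst := hst (Nat.succ_pos _) hact
    rw [hend] at hst
    simp only [newValue, hq, cond_true, Network.update, hst, Prod.mk.eta]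
    rw [Bool.eq_iff_iff, hans, reading]
    simp

/-- The words in the memory of every machine obey the bounds. -/
def Fits (S : Simulator) (N W : ℕ) (σ : MPCAlgorithm.State) : Prop :=
  ∀ k < S.side N * S.side N, (content σ k).length ≤ S.mem N ∧ ∀ w ∈ content σ k, w < W

theorem Knows.fits {e : ℕ} (hS : S.Sound N κ W) (h : S.Knows N e v σ) : S.Fits N W σ := by
  intro k hk
  obtain ⟨u, w, rfl, hu, hw⟩ := exists_pair_of_lt hk
  have h₁ := hS.branch_pos
  have h₂ := hS.branch_le
  have h₃ := hS.two_le
  rcases lt_or_ge w (S.branch N ^ e) with hwb | hwb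
  · obtain ⟨hl, hv⟩ := (h u hu w hw).1 hwb
    refine ⟨by omega, fun a ha => ?_⟩
    have h₄ := Bool.toNat_le (v u)
    rcases hc : content σ (Nat.pair u w) with _ | ⟨b, l⟩
    · simp [hc] at ha
    · rw [hc] at hl hv ha
      obtain rfl : l = [] := by
        rw [← List.length_eq_zero_iff]; simpa using hl
      simp only [List.mem_singleton] at ha
      simp only [List.headD_cons] at hv
      omega
  · rw [(h u hu w hw).2 hwb]
    simp

theorem Ready.fits {s : ℕ} (hS : S.Sound N κ W) (hB : S.orc.DecidesWith κ B)
    (hs : s ≤ S.oracleRounds N + 1) (h : S.Ready N s v σ) : S.Fits N W σ := by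
  intro k hk
  obtain ⟨u, j, rfl, hu, hj⟩ := exists_pair_of_lt hk
  obtain ⟨D, hD, hσ⟩ := h u hu
  have hlen : (S.reading N v u).length = S.arity N u := length_reading u
  rw [(hσ j hj).1]
  split_ifs with ha
  · obtain ⟨hq, hj'⟩ := active_eq_true.1 ha
    have hresp := (hB.2 _ D (hD.of_query hq).1).1
    rw [hlen] at hresp
    have hround : s - S.start N u ≤ S.orc.rounds (S.arity N u) := by
      have := hS.rounds_le u hq
      simp only [start, hq, cond_true]
      omega
    obtain ⟨h₁, h₂⟩ := (hresp j hj').1 _ hround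
    refine ⟨?_, fun w hw => (h₂ w hw).trans_le (hS.pow_le u hq)⟩
    rw [List.length_append]
    exact h₁.trans (hS.memory_le u hq)
  · cases hq : S.net.query (N, u)
    · obtain ⟨h₁, h₂⟩ := hD.of_not_query hq
      rcases eq_or_ne j 0 with rfl | hj0
      · have hlen' : (D 0).length = S.arity N u := by
          rw [h₁.length_eq, inputWords_eq, List.length_map, List.length_range, hlen]
        refine ⟨hlen' ▸ hS.arity_le u hq, fun w hw => ?_⟩
        have := (mem_inputWords.1 (h₁.mem_iff.1 hw)).1
        have := hS.two_mul_arity_le u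
        omega
      · simp [h₂ j hj0]
    · have : D j = [] := (hD.of_query hq).2 j (by
        by_contra hj'
        exact ha (active_eq_true.2 ⟨hq, by omega⟩))
      simp [this]

/-- The messages of every machine obey the bounds. -/
def SendsWell (S : Simulator) (N e : ℕ) (σ : MPCAlgorithm.State) : Prop :=
  ∀ k < S.side N * S.side N, (S.out N e σ k).2.length ≤ S.mem N ∧
    ∀ m ∈ (S.out N e σ k).2, m.1 < S.side N * S.side N

theorem sendsWell_route (hS : S.Sound N κ W) (hB : S.orc.DecidesWith κ B) :
    S.SendsWell N S.height σ := by
  intro k hk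
  have h₁ := hS.branch_pos
  have h₂ := hS.branch_le
  rw [← Nat.pair_unpair k, out_route]
  split_ifs with h
  · refine ⟨by simp only [List.length_singleton]; omega, ?_⟩
    simp only [List.mem_singleton, forall_eq]
    refine pair_lt_mul_self_iff.2 ⟨(hS.args_lt _ _ _ h).2.1, ?_⟩
    unfold target
    cases hq : S.net.query (N, k.unpair.2.unpair.1)
    · exact side_pos hS
    · refine lt_of_lt_of_le (Nat.div_lt_of_lt_mul ?_) (hS.machines_le _ hq)
      rw [mul_comm]
      exact (List.getElem?_eq_some_iff.1 h).1.trans_le (hB.1 _).2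
  · simp

theorem Ready.sendsWell {s : ℕ} (hS : S.Sound N κ W) (hB : S.orc.DecidesWith κ B)
    (hs : s ≤ S.oracleRounds N) (h : S.Ready N s v σ) :
    S.SendsWell N (S.height + 1 + s) σ := by
  intro k hk
  obtain ⟨u, j, rfl, hu, hj⟩ := exists_pair_of_lt hk
  rw [out_consult hs]
  split_ifs with hc
  · obtain ⟨hq, hj'⟩ := active_eq_true.1 hc.1
    obtain ⟨D, hD, hσ⟩ := h u hu
    have hlen : (S.reading N v u).length = S.arity N u := length_reading u
    have hresp := (hB.2 _ D (hD.of_query hq).1).1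
    rw [hlen] at hresp
    have hround : s - S.start N u < S.orc.rounds (S.arity N u) := by
      have := hS.rounds_le u hq
      have hge := hc.2
      have := start_pos hS u
      simp only [start, hq, cond_true] at *
      omega
    rw [(hσ j hj).2 ((start_pos hS u).trans hc.2) hc.1]
    obtain ⟨h₁, h₂⟩ := (hresp j hj').2 _ hround
    refine ⟨?_, fun m hm => ?_⟩
    · rw [List.length_map]
      exact h₁.trans (hS.memory_le u hq)
    · simp only [List.mem_map] at hm
      obtain ⟨a, ha, rfl⟩ := hm
      exact pair_lt_mul_self_iff.2 ⟨hu, (h₂ a ha).trans_le (hS.machines_le u hq)⟩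
  · simp

theorem sendsWell_finish : S.SendsWell N (S.height + 1 + (S.oracleRounds N + 1)) σ := by
  intro k hk
  rw [← Nat.pair_unpair k, out_finish]
  split_ifs <;> simp

/-- The state before round `e` of a phase, `v` being the values of the cells. -/
def Invariant (S : Simulator) (N e : ℕ) (v : ℕ → Bool) (σ : MPCAlgorithm.State) : Prop :=
  if e ≤ S.height then S.Knows N e v σ else S.Ready N (e - (S.height + 1)) v σ

theorem Invariant.fits {e : ℕ} (hS : S.Sound N κ W) (hB : S.orc.DecidesWith κ B)
    (he : e < S.period N) (h : S.Invariant N e v σ) : S.Fits N W σ := by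
  unfold Invariant at h
  unfold period at he
  split_ifs at h
  · exact h.fits hS
  · exact h.fits hS hB (by omega)

theorem Invariant.sendsWell {e : ℕ} (hS : S.Sound N κ W) (hB : S.orc.DecidesWith κ B)
    (he : e < S.period N) (h : S.Invariant N e v σ) : S.SendsWell N e σ := by
  unfold Invariant at h
  unfold period at he
  split_ifs at h with h'
  · rcases h'.lt_or_eq with h' | rfl
    · exact fun k hk => ⟨out_spread_length_le hS h' k, out_spread_address_lt hS h' hk⟩
    · exact sendsWell_route hS hB
  · obtain ⟨s, rfl⟩ := Nat.exists_eq_add_of_le (show S.height + 1 ≤ e by omega)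
    rcases Nat.lt_or_ge (S.oracleRounds N) s with hs | hs
    · obtain rfl : s = S.oracleRounds N + 1 := by omega
      exact sendsWell_finish
    · rw [Nat.add_sub_cancel_left] at h
      exact h.sendsWell hS hB hs

theorem Invariant.advance {e : ℕ} (hS : S.Sound N κ W) (hB : S.orc.DecidesWith κ B)
    (he : e + 1 < S.period N) (h : S.Invariant N e v σ) :
    S.Invariant N (e + 1) v (S.advance N e σ) := by
  unfold Invariant at h ⊢
  unfold period at he
  split_ifs at h with h'
  · rcases h'.lt_or_eq with h' | rfl
    · rw [if_pos (by omega)]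
      exact Knows.advance hS h h'
    · rw [if_neg (by omega), Nat.sub_self]
      exact h.ready hS hB
  · obtain ⟨s, rfl⟩ := Nat.exists_eq_add_of_le (show S.height + 1 ≤ e by omega)
    rw [Nat.add_sub_cancel_left] at h
    rw [if_neg (by omega), show S.height + 1 + s + 1 - (S.height + 1) = s + 1 by omega]
    exact h.consult hS hB (by omega)

theorem Invariant.advance_last {e : ℕ} (hS : S.Sound N κ W) (hB : S.orc.DecidesWith κ B)
    (he : e + 1 = S.period N) (h : S.Invariant N e v σ) :
    S.Invariant N 0 (S.net.update B N v) (S.advance N e σ) := by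
  unfold period at he
  obtain rfl : e = S.height + 1 + (S.oracleRounds N + 1) := by omega
  unfold Invariant at h ⊢
  rw [if_neg (by omega), Nat.add_sub_cancel_left] at h
  rw [if_pos (Nat.zero_le _)]
  exact h.finish hS hB

section Run

variable {x : List Bool} {D : ℕ → List ℕ}

theorem knows_initial (hD : S.algorithm.IsDistribution x D) :
    S.Knows x.length 0 (Network.initial x) (S.algorithm.run x.length D 1) := by
  intro u hu w hw
  set f : ℕ → ℕ × ℕ := fun a => (Nat.pair (2 * (a / 2) + 1) 0, a % 2) with hf
  have hcontent : content (S.algorithm.run x.length D 1) (Nat.pair u w) =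
      inbox (S.side x.length * S.side x.length) (fun k => (D k).map f) (Nat.pair u w) := by
    simp [content, MPCAlgorithm.run, MPCAlgorithm.next, MPCAlgorithm.act, algorithm, scatter,
      eqb, inbox, hf]
  rw [hcontent, pow_zero]
  refine ⟨fun hw1 => ?_, fun hw1 => inbox_eq_nil fun k _ m hm hmj => ?_⟩
  · obtain rfl : w = 0 := by omega
    have hperm : (inbox (S.side x.length * S.side x.length) (fun k => (D k).map f)
        (Nat.pair u 0)).Perm (((MPCAlgorithm.inputWords x).filter
          fun a => 2 * (a / 2) + 1 = u).map (· % 2)) := by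
      refine List.Perm.trans (List.Perm.of_eq ?_) ((hD.1.filter _).map _)
      simp only [inbox, List.filter_flatMap, List.map_flatMap, List.filter_map, List.map_map]
      refine List.flatMap_congr fun k _ => congrArg₂ _ rfl (List.filter_congr fun a _ => ?_)
      simp [hf]
    by_cases hux : u % 2 = 1 ∧ u / 2 < x.length
    · have hone : ((MPCAlgorithm.inputWords x).filter fun a => 2 * (a / 2) + 1 = u).Perm
          [2 * (u / 2) + (x.getD (u / 2) false).toNat] := by
        rw [List.perm_ext_iff_of_nodup ((nodup_inputWords x).filter _) (List.nodup_singleton _)]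
        intro a
        have h₁ := Bool.toNat_le (x.getD (u / 2) false)
        simp only [List.mem_filter, mem_inputWords, decide_eq_true_eq, List.mem_singleton]
        constructor
        · rintro ⟨⟨h₂, h₃⟩, h₄⟩
          have h₅ : a / 2 = u / 2 := by omega
          rw [h₅] at h₃
          omega
        · rintro rfl
          have h₅ : (2 * (u / 2) + (x.getD (u / 2) false).toNat) / 2 = u / 2 := by omega
          rw [h₅]
          omega
      have := hperm.trans (hone.map _)
      simp only [List.map_cons, List.map_nil, List.perm_singleton] at this
      have h₁ := Bool.toNat_le (x.getD (u / 2) false)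
      rw [this]
      simp only [List.length_singleton, le_refl, List.headD_cons, true_and, Network.initial,
        eqb, hux.1, decide_true, Bool.true_and]
      omega
    · rw [List.filter_eq_nil_iff.2] at hperm
      · rw [List.perm_nil.1 hperm]
        simp only [List.length_nil, List.headD_nil, zero_le, true_and, Network.initial, eqb]
        by_cases h₁ : u % 2 = 1
        · have h₂ : x.length ≤ u / 2 := by omega
          simp [List.getD_eq_getElem?_getD, List.getElem?_eq_none h₂]
        · simp [h₁]
      · intro a ha
        have := (mem_inputWords.1 ha).1
        simp only [decide_eq_true_eq]
        omega
  · simp only [List.mem_map] at hm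
    obtain ⟨a, -, rfl⟩ := hm
    simp only [hf, Nat.pair_eq_pair] at hmj
    omega

theorem invariant_run (hS : S.Sound x.length κ W) (hB : S.orc.DecidesWith κ B)
    (hD : S.algorithm.IsDistribution x D) (t : ℕ) :
    S.Invariant x.length (t % S.period x.length)
      (S.net.board B x (t / S.period x.length)) (S.algorithm.run x.length D (t + 1)) := by
  have hpos : 0 < S.period x.length := by unfold period; omega
  induction t with
  | zero =>
    rw [Nat.zero_mod, Nat.zero_div, Invariant, if_pos (Nat.zero_le _)]
    exact knows_initial hD
  | succ t ih =>
    rw [MPCAlgorithm.run, next_algorithm]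
    have hlt := Nat.mod_lt t hpos
    have hdm := Nat.div_add_mod t (S.period x.length)
    rcases Nat.lt_or_ge (t % S.period x.length + 1) (S.period x.length) with h | h
    · have hdiv : (t + 1) / S.period x.length = t / S.period x.length := by
        refine Nat.div_eq_of_lt_le ?_ ?_
        · rw [mul_comm]; omega
        · rw [Nat.succ_mul, mul_comm]; omega
      have hmod : (t + 1) % S.period x.length = t % S.period x.length + 1 := by
        have := Nat.div_add_mod (t + 1) (S.period x.length)
        rw [hdiv] at this
        omega
      rw [hdiv, hmod]
      exact ih.advance hS hB h
    · have hdiv : (t + 1) / S.period x.length = t / S.period x.length + 1 := by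
        refine Nat.div_eq_of_lt_le ?_ ?_
        · rw [Nat.succ_mul, mul_comm]; omega
        · rw [Nat.succ_mul, Nat.succ_mul, mul_comm]; omega
      have hmod : (t + 1) % S.period x.length = 0 := by
        have := Nat.div_add_mod (t + 1) (S.period x.length)
        rw [hdiv, Nat.mul_add] at this
        omega
      rw [hdiv, hmod, Network.board_succ]
      exact ih.advance_last hS hB (by omega)

end Run

/-- The simulation decides the language that is decided by the network. -/
theorem algorithm_decides {A : Language Bool} {κ' : ℕ} (hB : S.orc.DecidesWith κ B)
    (hS : ∀ N, S.Sound N κ ((N + 2) ^ κ')) (hside : ∀ N, 2 * N ≤ S.side N)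
    (hA : ∀ x : List Bool, S.net.board B x (S.phases x.length) 0 = true ↔ x ∈ A) :
    S.algorithm.Decides A := by
  refine ⟨fun N => ⟨Nat.mul_pos (side_pos (hS N)) (side_pos (hS N)), ?_⟩, κ' + 1,
    fun x D hD => ⟨fun k hk => ⟨fun t ht => ?_, fun t ht => ?_⟩, ?_⟩⟩
  · have h₁ : 1 ≤ S.mem N := (hS N).branch_pos.trans (hS N).branch_le
    have h₂ := side_pos (hS N)
    have h₃ := hside N
    calc N ≤ S.side N * 1 * 1 := by omega
      _ ≤ S.side N * S.side N * S.mem N := by gcongr; exact h₂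
  · have hpos : 0 < S.period x.length := by unfold period; omega
    have hpow : (x.length + 2) ^ κ' ≤ (x.length + 2) ^ (κ' + 1) :=
      Nat.pow_le_pow_right (by omega) (Nat.le_succ _)
    cases t with
    | zero =>
      simp only [MPCAlgorithm.run, List.length_nil, add_zero, List.append_nil]
      refine ⟨hD.2 k hk, fun w hw => ?_⟩
      have hw' : w ∈ (List.range (S.algorithm.machines x.length)).flatMap D :=
        List.mem_flatMap.2 ⟨k, List.mem_range.2 hk, hw⟩
      have h₁ := (mem_inputWords.1 (hD.1.mem_iff.1 hw')).1
      have h₂ := (hS x.length).two_le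
      have h₃ : (x.length + 2) ^ κ' * (x.length + 2) = (x.length + 2) ^ (κ' + 1) :=
        (pow_succ _ _).symm
      nlinarith [Nat.div_add_mod w 2, Nat.mod_lt w two_pos]
    | succ t =>
      have h := (invariant_run (hS x.length) hB hD t).fits (hS x.length) hB
        (Nat.mod_lt _ hpos) k hk
      rw [content, List.length_append] at h
      exact ⟨h.1, fun w hw => (h.2 w hw).trans_le hpow⟩
  · have hpos : 0 < S.period x.length := by unfold period; omega
    cases t with
    | zero =>
      have hact : (S.algorithm.act x.length 0 (S.algorithm.run x.length D 0) k).2 =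
          (D k).map fun w => (Nat.pair (2 * (w / 2) + 1) 0, w % 2) := by
        simp [MPCAlgorithm.act, MPCAlgorithm.run, algorithm, eqb, scatter]
      rw [hact, List.length_map]
      refine ⟨hD.2 k hk, fun m hm => ?_⟩
      simp only [List.mem_map] at hm
      obtain ⟨w, hw, rfl⟩ := hm
      have hw' : w ∈ (List.range (S.algorithm.machines x.length)).flatMap D :=
        List.mem_flatMap.2 ⟨k, List.mem_range.2 hk, hw⟩
      have h₁ := (mem_inputWords.1 (hD.1.mem_iff.1 hw')).1
      have h₃ := hside x.length
      exact pair_lt_mul_self_iff.2 ⟨by omega, side_pos (hS _)⟩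
    | succ t =>
      exact (invariant_run (hS x.length) hB hD t).sendsWell (hS x.length) hB
        (Nat.mod_lt _ hpos) k hk
  · have hpos : 0 < S.period x.length := by unfold period; omega
    have h := invariant_run (hS x.length) hB hD (S.phases x.length * S.period x.length)
    rw [Nat.mul_mod_left, Nat.mul_div_cancel _ hpos, Invariant, if_pos (Nat.zero_le _)] at h
    have h₀ := ((h 0 (side_pos (hS _)) 0 (side_pos (hS _))).1 (by simp)).2
    have hres : S.algorithm.result x.length D = eqb ((content (S.algorithm.run x.length D
        (S.phases x.length * S.period x.length + 1)) (Nat.pair 0 0)).headD 0) 1 := rfl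
    rw [hres, h₀, ← hA x, eqb_eq_true]
    cases S.net.board B x (S.phases x.length) 0 <;> simp

end Simulator

/-! ### Languages decided by an algorithm are decidable -/

namespace MPCAlgorithm

variable (M : MPCAlgorithm)

/-- The distribution of the input in consecutive blocks. -/
def blocks (x : List Bool) (k : ℕ) : List ℕ :=
  ((List.range x.length).filter fun i => eqb (i / M.memory x.length) k).map
    fun i => 2 * i + (x.getD i false).toNat

theorem isDistribution_blocks {x : List Bool}
    (h : x.length ≤ M.machines x.length * M.memory x.length) :
    M.IsDistribution x (M.blocks x) := by
  refine ⟨?_, fun k _ => ?_⟩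
  · rw [inputWords_eq]
    rw [show M.blocks x = fun k => ((List.range x.length).filter fun i =>
      eqb (i / M.memory x.length) k).map fun i => 2 * i + (x.getD i false).toNat from rfl,
      ← List.map_flatMap]
    refine (flatMap_filter_perm List.nodup_range fun i hi => ?_).map _
    refine Nat.div_lt_of_lt_mul ?_
    rw [mul_comm]
    exact (List.mem_range.1 hi).trans_le h
  · rw [blocks, List.length_map]
    rcases Nat.eq_zero_or_pos (M.memory x.length) with h0 | h0
    · rw [h0, mul_zero] at h
      simp [Nat.le_zero.1 h]
    · exact Simulator.length_filter_div_le _ _ k h0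

/-- The list of the states of all machines after `t` rounds, on the distribution in blocks. -/
def trace (x : List Bool) (t : ℕ) : List (List ℕ × List ℕ) :=
  (List.range t).foldl (fun L t => (List.range (M.machines x.length)).map fun j =>
    ((M.step (x.length, j, t, L.getD j ([], []))).1,
      (List.range (M.machines x.length)).flatMap fun k =>
        ((M.step (x.length, k, t, L.getD k ([], []))).2.filter fun m => eqb m.1 j).map Prod.snd))
    ((List.range (M.machines x.length)).map fun k => (M.blocks x k, []))

theorem trace_eq (x : List Bool) (t : ℕ) : M.trace x t =
    (List.range (M.machines x.length)).map (M.run x.length (M.blocks x) t) := by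
  induction t with
  | zero => rfl
  | succ t ih =>
    rw [trace, List.range_succ, List.foldl_append]
    change List.map _ _ = _
    rw [← trace, ih]
    have hget : ∀ j < M.machines x.length,
        ((List.range (M.machines x.length)).map (M.run x.length (M.blocks x) t)).getD j ([], []) =
          M.run x.length (M.blocks x) t j := by
      intro j hj
      simp [List.getD_eq_getElem?_getD, hj]
    refine List.map_congr_left fun j hj => Prod.ext ?_ ?_
    · simp only [hget j (List.mem_range.1 hj)]
      rfl
    · refine List.flatMap_congr fun k hk => ?_
      simp only [hget k (List.mem_range.1 hk)]
      rfl

theorem computable_trace : Computable fun p : List Bool × ℕ => M.trace p.1 p.2 := by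
  unfold trace blocks
  fun_prop

variable {M}

theorem Decides.exists_decidesWith {A : Language Bool} (h : M.Decides A) :
    ∃ κ, M.DecidesWith κ A := by
  obtain ⟨h₁, κ, h₂⟩ := h
  exact ⟨κ, h₁, h₂⟩

theorem Decides.exists_computable {A : Language Bool} (h : M.Decides A) :
    ∃ d : List Bool → Bool, Computable d ∧ ∀ x, d x = true ↔ x ∈ A := by
  have hM := M.computable_trace
  refine ⟨fun x => M.answer (x.length, (M.trace x (M.rounds x.length)).getD 0 ([], [])), ?_,
    fun x => ?_⟩
  · have h₁ : Computable fun x : List Bool => M.trace x (M.rounds x.length) :=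
      hM.comp (f := fun p : List Bool × ℕ => M.trace p.1 p.2)
        (g := fun x => (x, M.rounds x.length)) (by fun_prop)
    fun_prop
  · obtain ⟨h₁, κ, h₂⟩ := h
    have h₀ := (h₁ x.length).1
    rw [← (h₂ x _ (M.isDistribution_blocks (h₁ x.length).2)).2, result]
    simp [trace_eq, List.getD_eq_getElem?_getD, h₀]

end MPCAlgorithm

/-! ### The choice of the parameters -/

/-- A power of two that is about `N ^ (1 / q)`. -/
def root (q N : ℕ) : ℕ := 2 ^ (Nat.log 2 N / q + 1)

@[fun_prop]
theorem computable_root {α : Type*} [Primcodable α] {q : ℕ} {f : α → ℕ} (hf : Computable f) :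
    Computable fun a => root q (f a) := by
  unfold root; fun_prop

theorem two_le_root (q N : ℕ) : 2 ≤ root q N := by
  unfold root
  calc 2 = 2 ^ 1 := rfl
    _ ≤ _ := Nat.pow_le_pow_right two_pos (Nat.le_add_left _ _)

theorem log_lt_mul {q : ℕ} (hq : 1 ≤ q) (N : ℕ) :
    Nat.log 2 N + 1 ≤ q * (Nat.log 2 N / q + 1) := by
  have := Nat.div_add_mod (Nat.log 2 N) q
  have := Nat.mod_lt (Nat.log 2 N) hq
  rw [Nat.mul_add]
  omega

theorem add_two_le_root_pow {q : ℕ} (hq : 1 ≤ q) (N : ℕ) : N + 2 ≤ root q N ^ (q + 1) := by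
  have h₁ : N + 1 ≤ root q N ^ q := by
    have h₂ : N < 2 ^ (Nat.log 2 N + 1) := Nat.lt_pow_succ_log_self one_lt_two N
    have h₃ : 2 ^ (Nat.log 2 N + 1) ≤ root q N ^ q := by
      rw [root, ← pow_mul, mul_comm]
      exact Nat.pow_le_pow_right two_pos (log_lt_mul hq N)
    omega
  rw [pow_succ]
  have := two_le_root q N
  nlinarith

theorem add_two_pow_le_root_pow {q : ℕ} (hq : 1 ≤ q) (N z : ℕ) :
    (N + 2) ^ z ≤ root q N ^ ((q + 1) * z) := by
  rw [pow_mul]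
  exact Nat.pow_le_pow_left (add_two_le_root_pow hq N) z

theorem root_le {q N : ℕ} (hq : 1 ≤ q) (hN : 1 ≤ N) :
    (root q N : ℝ) ≤ 2 * (N : ℝ) ^ (1 / q : ℝ) := by
  have h₁ : ((2 : ℝ) ^ (Nat.log 2 N / q)) ^ q ≤ N := by
    rw [← pow_mul]
    have h₂ : 2 ^ (Nat.log 2 N / q * q) ≤ N :=
      (Nat.pow_le_pow_right two_pos (Nat.div_mul_le_self _ _)).trans
        (Nat.pow_log_le_self 2 (by omega))
    exact_mod_cast h₂
  have h₃ : (2 : ℝ) ^ (Nat.log 2 N / q) ≤ (N : ℝ) ^ (1 / q : ℝ) := by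
    rw [one_div, Real.le_rpow_inv_iff_of_pos (by positivity) (by positivity) (by positivity),
      Real.rpow_natCast]
    exact h₁
  rw [root, pow_succ]
  push_cast
  linarith

/-- A network whose size is polynomial, whose local cells read at most about `N ^ (2 / q)` cells,
and whose oracle queries can be answered in memory of about this size, yields an algorithm. The
number of rounds is, up to constants, the number of steps of the network times that of an oracle
query. -/
theorem solvableWith_of_network {A B : Language Bool} {f : ℕ → ℝ} {ε : ℝ} (hε : 0 < ε)
    (net : Network) (orc : MPCAlgorithm) {κ : ℕ} (hB : orc.DecidesWith κ B)
    {q z K : ℕ} (hq : 1 ≤ q) (hqε : 2 / (q : ℝ) ≤ 1 - ε) {R T : ℕ → ℕ} (hR : Computable R)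
    (hT : Computable T)
    (hargs : ∀ N u, ∀ a ∈ net.args (N, u), a < (N + 2) ^ z ∧ u < (N + 2) ^ z)
    (hlen : ∀ N u, (net.args (N, u)).length ≤ (N + 2) ^ z)
    (hlocal : ∀ N u, net.query (N, u) = false → (net.args (N, u)).length ≤ root q N ^ 2)
    (hmem : ∀ N u, net.query (N, u) = true →
      orc.memory (net.args (N, u)).length ≤ K * root q N ^ 2)
    (hmach : ∀ N u, net.query (N, u) = true →
      orc.machines (net.args (N, u)).length ≤ (N + 2) ^ z)
    (hrounds : ∀ N u, net.query (N, u) = true →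
      orc.rounds (net.args (N, u)).length ≤ R N)
    (hA : ∀ x : List Bool, net.board B x (T x.length) 0 = true ↔ x ∈ A)
    (hf₁ : (fun _ : ℕ => (1 : ℝ)) =O[atTop] f)
    (hf : (fun N => (T N * (R N + 1) : ℝ)) =O[atTop] f) : SolvableWith ε f A := by
  let S : Simulator :=
    { net := net, orc := orc, branch := root q, height := (q + 1) * (2 * z + 2),
      oracleRounds := R, phases := T, mem := fun N => (K + 1) * root q N ^ 2
      branch_computable := by fun_prop
      oracleRounds_computable := hR
      phases_computable := hT
      mem_computable := by fun_prop }
  have hside : ∀ N, (N + 2) ^ (2 * z + 2) ≤ S.side N := fun N => add_two_pow_le_root_pow hq N _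
  have hpow : ∀ {a b : ℕ} (N : ℕ), a ≤ b → (N + 2) ^ a ≤ (N + 2) ^ b :=
    fun N h => Nat.pow_le_pow_right (by omega) h
  have hroot := two_le_root q
  have hsq : ∀ N, root q N ≤ root q N ^ 2 := fun N => Nat.le_self_pow two_ne_zero _
  have hle : ∀ N u, S.arity N u ≤ (N + 2) ^ z := hlen
  have hS : ∀ N, S.Sound N κ ((N + 2) ^ ((z + 2) * κ + (z + 1))) := by
    intro N
    refine ⟨fun u pos a ha => ?_, hrounds N, fun u hu => ?_, fun u hu => ?_, fun u hu => ?_,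
      ?_, ?_, fun u => ?_, fun u hu => ?_, ?_⟩
    · obtain ⟨h₁, h₂⟩ := hargs N u a (List.mem_of_getElem? ha)
      have h₃ : pos < (N + 2) ^ z :=
        (List.getElem?_eq_some_iff.1 ha).1.trans_le (hlen N u)
      have h₄ := (hpow N (show z ≤ 2 * z + 2 by omega)).trans (hside N)
      refine ⟨h₁.trans_le h₄, h₂.trans_le h₄, ?_⟩
      calc Nat.pair u pos < (max u pos + 1) ^ 2 := Nat.pair_lt_max_add_one_sq _ _
        _ ≤ ((N + 2) ^ z) ^ 2 := Nat.pow_le_pow_left (by omega) 2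
        _ = (N + 2) ^ (z * 2) := (pow_mul _ _ _).symm
        _ ≤ (N + 2) ^ (2 * z + 2) := hpow N (by omega)
        _ ≤ S.side N := hside N
    · exact (hmach N u hu).trans ((hpow N (by omega)).trans (hside N))
    · refine (hmem N u hu).trans ?_
      exact Nat.mul_le_mul_right _ (Nat.le_succ K)
    · refine (hlocal N u hu).trans ?_
      exact Nat.le_mul_of_pos_left _ (Nat.succ_pos K)
    · exact one_le_two.trans (hroot N)
    · exact (hsq N).trans (Nat.le_mul_of_pos_left _ (Nat.succ_pos K))
    · calc 2 * S.arity N u ≤ (N + 2) * (N + 2) ^ z := Nat.mul_le_mul (by omega) (hle N u)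
        _ = (N + 2) ^ (z + 1) := (pow_succ' _ _).symm
        _ ≤ _ := hpow N (by omega)
    · calc (S.arity N u + 2) ^ κ ≤ ((N + 2) ^ (z + 2)) ^ κ := by
            refine Nat.pow_le_pow_left ?_ κ
            have h₁ := hle N u
            have h₂ : 1 ≤ (N + 2) ^ z := Nat.one_le_pow _ _ (by omega)
            have h₃ : (N + 2) ^ (z + 2) = (N + 2) ^ z * ((N + 2) * (N + 2)) := by ring
            have h₄ : (N + 2) ^ z * 4 ≤ (N + 2) ^ z * ((N + 2) * (N + 2)) :=
              Nat.mul_le_mul_left _ (by nlinarith)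
            omega
        _ = (N + 2) ^ ((z + 2) * κ) := (pow_mul _ _ _).symm
        _ ≤ _ := hpow N (by omega)
    · calc 2 ≤ (N + 2) ^ 1 := by simp
        _ ≤ _ := hpow N (by omega)
  have htwo : ∀ N, 2 * N ≤ S.side N := fun N =>
    calc 2 * N ≤ (N + 2) ^ 2 := by nlinarith
      _ ≤ (N + 2) ^ (2 * z + 2) := hpow N (by omega)
      _ ≤ _ := hside N
  refine ⟨S.algorithm, S.algorithm_decides hB hS htwo hA, ?_, ?_, ?_,
    2 * S.height + 1, by positivity, ?_⟩
  · have hrw : (fun N => (S.algorithm.rounds N : ℝ)) =O[atTop]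
        fun N => (T N * (R N + 1) : ℝ) + 1 := by
      refine IsBigO.of_bound (S.height + 3) (Eventually.of_forall fun N => ?_)
      have h : (S.algorithm.rounds N : ℝ) = T N * (S.height + R N + 3) + 1 := by
        change ((T N * (S.height + R N + 3) + 1 : ℕ) : ℝ) = _
        push_cast
        ring
      rw [h, Real.norm_of_nonneg (by positivity), Real.norm_of_nonneg (by positivity)]
      have h₁ : (0 : ℝ) ≤ T N := Nat.cast_nonneg _
      have h₂ : (0 : ℝ) ≤ R N := Nat.cast_nonneg _
      have h₃ : (0 : ℝ) ≤ S.height := Nat.cast_nonneg _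
      have h₄ : (0 : ℝ) ≤ T N * R N * S.height := by positivity
      have h₅ : (0 : ℝ) ≤ T N * R N := by positivity
      nlinarith
    exact hrw.trans (hf.add hf₁)
  · refine IsBigO.of_bound ((K + 1) * 4) ((eventually_ge_atTop 1).mono fun N hN => ?_)
    have hN' : (1 : ℝ) ≤ N := by exact_mod_cast hN
    have h : (S.algorithm.memory N : ℝ) = (K + 1) * (root q N : ℝ) ^ 2 := by
      change (((K + 1) * root q N ^ 2 : ℕ) : ℝ) = _
      push_cast
      ring
    rw [h, Real.norm_of_nonneg (by positivity), Real.norm_of_nonneg (by positivity), mul_assoc]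
    refine mul_le_mul_of_nonneg_left ?_ (by positivity)
    calc (root q N : ℝ) ^ 2 ≤ (2 * (N : ℝ) ^ (1 / q : ℝ)) ^ 2 :=
          pow_le_pow_left₀ (by positivity) (root_le hq hN) 2
      _ = 4 * ((N : ℝ) ^ (1 / q : ℝ)) ^ 2 := by ring
      _ = 4 * (N : ℝ) ^ (2 / q : ℝ) := by
          rw [← Real.rpow_natCast, ← Real.rpow_mul (by positivity)]
          congr 2
          push_cast
          ring
      _ ≤ 4 * (N : ℝ) ^ (1 - ε) := by gcongr
  · refine IsBigO.of_bound 1 ((eventually_ge_atTop 1).mono fun N hN => ?_)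
    have hN' : (1 : ℝ) ≤ N := by exact_mod_cast hN
    rw [Real.norm_of_nonneg (by positivity), Real.norm_of_nonneg (by positivity), one_mul]
    have h₁ : N ^ 2 ≤ S.algorithm.totalMemory N := by
      change N ^ 2 ≤ S.side N * S.side N * ((K + 1) * root q N ^ 2)
      have h₂ : 1 ≤ (K + 1) * root q N ^ 2 :=
        Nat.mul_pos (Nat.succ_pos K) (pow_pos (by have := hroot N; omega) 2)
      have h₃ := htwo N
      calc N ^ 2 = N * N * 1 := by ring
        _ ≤ _ := Nat.mul_le_mul (Nat.mul_le_mul (by omega) (by omega)) h₂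
    calc (N : ℝ) ^ (2 * (1 - ε)) ≤ (N : ℝ) ^ (2 : ℝ) :=
          Real.rpow_le_rpow_of_exponent_le hN' (by linarith)
      _ = ((N ^ 2 : ℕ) : ℝ) := by norm_cast
      _ ≤ _ := by exact_mod_cast h₁
  · refine IsBigO.of_bound ((K + 1) * 2 ^ (2 * S.height + 2))
      ((eventually_ge_atTop 1).mono fun N hN => ?_)
    have hN' : (1 : ℝ) ≤ N := by exact_mod_cast hN
    have h : (S.algorithm.totalMemory N : ℝ) =
        (K + 1) * (root q N : ℝ) ^ (2 * S.height + 2) := by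
      change ((root q N ^ S.height * root q N ^ S.height *
        ((K + 1) * root q N ^ 2) : ℕ) : ℝ) = _
      push_cast
      ring
    have hrootN : (root q N : ℝ) ≤ 2 * N := by
      refine (root_le hq hN).trans ?_
      have : (N : ℝ) ^ (1 / q : ℝ) ≤ (N : ℝ) ^ (1 : ℝ) := by
        refine Real.rpow_le_rpow_of_exponent_le hN' ?_
        rw [div_le_one (by positivity)]
        exact_mod_cast hq
      rw [Real.rpow_one] at this
      linarith
    rw [h, Real.norm_of_nonneg (by positivity), Real.norm_of_nonneg (by positivity), mul_assoc]
    refine mul_le_mul_of_nonneg_left ?_ (by positivity)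
    calc (root q N : ℝ) ^ (2 * S.height + 2) ≤ (2 * N : ℝ) ^ (2 * S.height + 2) :=
          pow_le_pow_left₀ (by positivity) hrootN _
      _ = 2 ^ (2 * S.height + 2) * (N : ℝ) ^ ((2 * S.height + 2 : ℕ) : ℝ) := by
          rw [mul_pow, Real.rpow_natCast]
      _ = _ := by push_cast; ring_nf

/-! ### Polynomial bounds -/

/-- `f` is bounded by a polynomial. -/
def PolyBounded (f : ℕ → ℕ) : Prop := ∃ c : ℕ, ∀ N, f N ≤ (N + 2) ^ c

namespace PolyBounded

variable {f g : ℕ → ℕ}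

theorem mono (hg : PolyBounded g) (h : ∀ N, f N ≤ g N) : PolyBounded f :=
  hg.imp fun _ hc N => (h N).trans (hc N)

theorem const (k : ℕ) : PolyBounded fun _ => k :=
  ⟨k, fun N => (Nat.lt_two_pow_self (n := k)).le.trans (Nat.pow_le_pow_left (by omega) k)⟩

theorem id : PolyBounded fun N => N := ⟨1, fun N => by simp⟩

theorem mul (hf : PolyBounded f) (hg : PolyBounded g) : PolyBounded fun N => f N * g N := by
  obtain ⟨a, ha⟩ := hf
  obtain ⟨b, hb⟩ := hg
  exact ⟨a + b, fun N => by rw [pow_add]; exact Nat.mul_le_mul (ha N) (hb N)⟩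

theorem add (hf : PolyBounded f) (hg : PolyBounded g) : PolyBounded fun N => f N + g N := by
  obtain ⟨a, ha⟩ := hf
  obtain ⟨b, hb⟩ := hg
  refine ⟨a + b + 1, fun N => ?_⟩
  have h₁ : (N + 2) ^ a ≤ (N + 2) ^ (a + b) := Nat.pow_le_pow_right (by omega) (by omega)
  have h₂ : (N + 2) ^ b ≤ (N + 2) ^ (a + b) := Nat.pow_le_pow_right (by omega) (by omega)
  have h₃ : (N + 2) ^ (a + b) * 2 ≤ (N + 2) ^ (a + b) * (N + 2) :=
    Nat.mul_le_mul_left _ (by omega)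
  have := ha N
  have := hb N
  rw [pow_succ]
  change f N + g N ≤ _
  omega

theorem pow (hf : PolyBounded f) (k : ℕ) : PolyBounded fun N => f N ^ k := by
  obtain ⟨a, ha⟩ := hf
  exact ⟨a * k, fun N => by rw [pow_mul]; exact Nat.pow_le_pow_left (ha N) k⟩

theorem two_pow_log : PolyBounded fun N => 2 ^ Nat.log 2 N := by
  refine ⟨1, fun N => ?_⟩
  rcases Nat.eq_zero_or_pos N with rfl | hN
  · simp
  · have := Nat.pow_log_le_self 2 hN.ne'
    rw [pow_one]
    exact this.trans (Nat.le_add_right _ _)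

theorem root (q : ℕ) : PolyBounded fun N => root q N :=
  (two_pow_log.mul (const 2)).mono fun N => by
    rw [MPCLogspace.root, pow_succ]
    exact Nat.mul_le_mul_right _ (Nat.pow_le_pow_right two_pos (Nat.div_le_self _ _))

end PolyBounded

theorem pair_lt_sq {a b X : ℕ} (ha : a < X) (hb : b < X) : Nat.pair a b < X ^ 2 :=
  (Nat.pair_lt_max_add_one_sq a b).trans_le (Nat.pow_le_pow_left (by omega) 2)

/-! ### Configurations as numbers -/

section TapeCode

/-- The first `m` cells of a tape over the symbols `0, …, s - 1`, as a number in base `s`. -/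
def tapeCode (s m : ℕ) (w : ℕ → ℕ) : ℕ := ∑ i ∈ Finset.range m, w i * s ^ i

variable {s m h : ℕ} {w : ℕ → ℕ}

theorem tapeCode_succ : tapeCode s (m + 1) w = tapeCode s m w + w m * s ^ m :=
  Finset.sum_range_succ _ _

theorem tapeCode_lt (hw : ∀ i, w i < s) (m : ℕ) : tapeCode s m w < s ^ m := by
  induction m with
  | zero => simp [tapeCode]
  | succ m ih =>
    rw [tapeCode_succ, pow_succ']
    have := Nat.mul_le_mul_right (s ^ m) (hw m)
    rw [Nat.succ_mul] at this
    omega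

theorem tapeCode_digit (hw : ∀ i, w i < s) (hh : h < m) : tapeCode s m w / s ^ h % s = w h := by
  have hs : 0 < s := (Nat.zero_le _).trans_lt (hw 0)
  induction m with
  | zero => omega
  | succ m ih =>
    rw [tapeCode_succ]
    rcases Nat.lt_succ_iff_lt_or_eq.1 hh with hlt | rfl
    · obtain ⟨d, rfl⟩ := Nat.exists_eq_add_of_lt hlt
      have : w (h + d + 1) * s ^ (h + d + 1) = w (h + d + 1) * s ^ d * s * s ^ h := by ring
      rw [this, Nat.add_mul_div_right _ _ (pow_pos hs h), Nat.add_mul_mod_self_right, ih (by omega)]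
    · rw [Nat.add_mul_div_right _ _ (pow_pos hs h), Nat.div_eq_of_lt (tapeCode_lt hw h),
        zero_add, Nat.mod_eq_of_lt (hw h)]

theorem tapeCode_update (a : ℕ) (hh : h < m) :
    tapeCode s m (Function.update w h a) = tapeCode s m w + a * s ^ h - w h * s ^ h := by
  have h₁ := Finset.add_sum_erase (Finset.range m) (fun i => w i * s ^ i)
    (Finset.mem_range.2 hh)
  have h₂ := Finset.add_sum_erase (Finset.range m)
    (fun i => Function.update w h a i * s ^ i) (Finset.mem_range.2 hh)
  have h₃ : ∑ i ∈ (Finset.range m).erase h, Function.update w h a i * s ^ i =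
      ∑ i ∈ (Finset.range m).erase h, w i * s ^ i := by
    refine Finset.sum_congr rfl fun i hi => ?_
    rw [Function.update_of_ne (Finset.ne_of_mem_erase hi)]
  simp only [Function.update_self] at h₂
  rw [h₃] at h₂
  unfold tapeCode
  omega

end TapeCode

/-- A move of a head is addition of `up` followed by subtraction of `down`. -/
def Move.up : Move → ℕ
  | .right => 1
  | _ => 0

/-- See `Move.up`. -/
def Move.down : Move → ℕ
  | .left => 1
  | _ => 0

theorem Move.apply_eq (d : Move) (pos : ℕ) : d.apply pos = pos + d.up - d.down := by
  cases d <;> simp [Move.apply, Move.up, Move.down]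

namespace OfflineTM

variable (M : OfflineTM)

/-- The code of a configuration. All accepting configurations have the code `0`. -/
def mkCode (q i h T : ℕ) : ℕ :=
  bif eqb q M.acceptState then 0 else Nat.pair (Nat.pair q i) (Nat.pair h T) + 1

/-- The state in the configuration with code `y`. -/
def codeState (y : ℕ) : ℕ := (y - 1).unpair.1.unpair.1

/-- The position of the input head in the configuration with code `y`. -/
def codeInput (y : ℕ) : ℕ := (y - 1).unpair.1.unpair.2

/-- The position of the work head in the configuration with code `y`. -/
def codeHead (y : ℕ) : ℕ := (y - 1).unpair.2.unpair.1

/-- The tape in the configuration with code `y`. -/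
def codeTape (y : ℕ) : ℕ := (y - 1).unpair.2.unpair.2

/-- The transition function on numbers: the new state, the new symbol, and the two moves. -/
def action (q : ℕ) (b : Option Bool) (a : ℕ) : ℕ × ℕ × (ℕ × ℕ) × (ℕ × ℕ) :=
  let r := M.trans (Fin.ofNat (M.numStates + 1) q) b (Fin.ofNat (M.numSymbols + 1) a)
  (r.1, r.2.1, (r.2.2.1.up, r.2.2.1.down), (r.2.2.2.up, r.2.2.2.down))

/-- The symbol under the work head in the configuration with code `y`. -/
def codeSymbol (y : ℕ) : ℕ := codeTape y / (M.numSymbols + 1) ^ codeHead y % (M.numSymbols + 1)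

/-- A step of the machine on codes, for inputs of length `N`, when the symbol `b` is scanned. -/
def stepCode (N y : ℕ) (b : Option Bool) : ℕ :=
  bif eqb y 0 then 0 else bif eqb (codeState y) M.rejectState then y else
    M.mkCode (M.action (codeState y) b (M.codeSymbol y)).1
      (min (codeInput y + (M.action (codeState y) b (M.codeSymbol y)).2.2.1.1 -
        (M.action (codeState y) b (M.codeSymbol y)).2.2.1.2) (N + 1))
      (codeHead y + (M.action (codeState y) b (M.codeSymbol y)).2.2.2.1 -
        (M.action (codeState y) b (M.codeSymbol y)).2.2.2.2)
      (codeTape y + (M.action (codeState y) b (M.codeSymbol y)).2.1 *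
        (M.numSymbols + 1) ^ codeHead y -
        M.codeSymbol y * (M.numSymbols + 1) ^ codeHead y)

section Computability

variable {α : Type*} [Primcodable α]

theorem computable_finOfNat (n : ℕ) : Computable fun a : ℕ => Fin.ofNat (n + 1) a :=
  (Primrec.fin_val_iff.1 (Primrec.nat_mod.comp Primrec.id (Primrec.const (n + 1)))).to_comp

theorem computable_action {f g : α → ℕ} {b : α → Option Bool} (hf : Computable f)
    (hb : Computable b) (hg : Computable g) :
    Computable fun a => M.action (f a) (b a) (g a) := by
  have h := (Primrec.dom_finite fun p : Fin (M.numStates + 1) × Option Bool ×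
    Fin (M.numSymbols + 1) => M.action p.1 p.2.1 p.2.2).to_comp
  refine (h.comp (g := fun a => (Fin.ofNat (M.numStates + 1) (f a), b a,
    Fin.ofNat (M.numSymbols + 1) (g a))) ?_).of_eq fun a => ?_
  · exact ((computable_finOfNat _).comp hf).pair (hb.pair ((computable_finOfNat _).comp hg))
  · simp only [action, Fin.ofNat, Nat.mod_mod]

attribute [local fun_prop] computable_action

theorem computable_codeInput {f : α → ℕ} (hf : Computable f) :
    Computable fun a => codeInput (f a) := by
  unfold codeInput; fun_prop

theorem computable_stepCode {f g : α → ℕ} {b : α → Option Bool} (hf : Computable f)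
    (hg : Computable g) (hb : Computable b) :
    Computable fun a => M.stepCode (f a) (g a) (b a) := by
  unfold stepCode mkCode codeSymbol codeState codeInput codeHead codeTape; fun_prop

end Computability

variable {M}

/-- The code of a configuration that uses only the first `m` cells of the work tape. -/
def Cfg.code (m : ℕ) (c : M.Cfg) : ℕ :=
  M.mkCode c.state c.inputHead c.workHead
    (tapeCode (M.numSymbols + 1) m fun i => (c.work i : ℕ))

theorem Cfg.code_eq_zero_iff {m : ℕ} {c : M.Cfg} :
    c.code m = 0 ↔ c.state = M.acceptState := by
  rw [Cfg.code, mkCode, Bool.cond_eq_ite]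
  simp [Fin.ext_iff]

theorem Cfg.codeInput_code {m : ℕ} {c : M.Cfg} (h : c.state ≠ M.acceptState) :
    codeInput (c.code m) = c.inputHead := by
  have : eqb (c.state : ℕ) M.acceptState = false := by simpa [eqb, Fin.ext_iff] using h
  simp [codeInput, Cfg.code, mkCode, this]

/-- The map on codes simulates the machine as long as the work head stays in the first `m` cells. -/
theorem code_step {m : ℕ} {x : List Bool} {c : M.Cfg} (hm : c.workHead < m) :
    (M.step x c).code m = M.stepCode x.length (c.code m) (scan x (codeInput (c.code m))) := by
  by_cases ha : c.state = M.acceptState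
  · have h₁ : M.step x c = c := by simp [step, ha]
    rw [h₁, Cfg.code_eq_zero_iff.2 ha]
    rfl
  rw [Cfg.codeInput_code ha]
  have ha' : eqb (c.state : ℕ) M.acceptState = false := by simpa [eqb, Fin.ext_iff] using ha
  have hcode : c.code m = Nat.pair (Nat.pair c.state c.inputHead) (Nat.pair c.workHead
      (tapeCode (M.numSymbols + 1) m fun i => (c.work i : ℕ))) + 1 := by
    simp [Cfg.code, mkCode, ha']
  have hne : eqb (c.code m) 0 = false := by simp [eqb, hcode]
  have hq : codeState (c.code m) = c.state := by simp [codeState, hcode]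
  have hi : codeInput (c.code m) = c.inputHead := by simp [codeInput, hcode]
  have hh : codeHead (c.code m) = c.workHead := by simp [codeHead, hcode]
  have hT : codeTape (c.code m) =
      tapeCode (M.numSymbols + 1) m fun i => (c.work i : ℕ) := by simp [codeTape, hcode]
  have hs : M.codeSymbol (c.code m) = c.work c.workHead := by
    rw [codeSymbol, hT, hh, tapeCode_digit (fun i => (c.work i).isLt) hm]
  rw [stepCode, hne, hq, cond_false, Bool.cond_eq_ite]
  by_cases hr : c.state = M.rejectState
  · have h₁ : M.step x c = c := by simp [step, hr]
    rw [h₁, if_pos (by simp [hr])]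
  · rw [if_neg (by simpa [Fin.ext_iff] using hr), hi, hh, hT, hs]
    have hact : ∀ b, M.action c.state b (c.work c.workHead) =
        (((M.trans c.state b (c.work c.workHead)).1 : ℕ),
          ((M.trans c.state b (c.work c.workHead)).2.1 : ℕ),
          ((M.trans c.state b (c.work c.workHead)).2.2.1.up,
            (M.trans c.state b (c.work c.workHead)).2.2.1.down),
          ((M.trans c.state b (c.work c.workHead)).2.2.2.up,
            (M.trans c.state b (c.work c.workHead)).2.2.2.down)) := by
      intro b
      have e₁ : Fin.ofNat (M.numStates + 1) (c.state : ℕ) = c.state := by simp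
      have e₂ : Fin.ofNat (M.numSymbols + 1) (c.work c.workHead : ℕ) = c.work c.workHead := by
        simp
      simp only [action, e₁, e₂]
    have hstep : M.step x c =
        { state := (M.trans c.state (scan x c.inputHead) (c.work c.workHead)).1
          inputHead := min ((M.trans c.state (scan x c.inputHead)
            (c.work c.workHead)).2.2.1.apply c.inputHead) (x.length + 1)
          workHead := (M.trans c.state (scan x c.inputHead)
            (c.work c.workHead)).2.2.2.apply c.workHead
          work := Function.update c.work c.workHead
            (M.trans c.state (scan x c.inputHead) (c.work c.workHead)).2.1 } := by
      simp [step, ha, hr]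
    rw [hact, hstep, Cfg.code]
    simp only [Move.apply_eq]
    rw [← tapeCode_update _ hm]
    congr 2
    funext i
    by_cases h : i = c.workHead
    · subst h; simp
    · simp [Function.update_of_ne h]

end OfflineTM

/-- If the orbit of `y` under a map of `{0, …, Q - 1}` reaches the fixed point `0`, then it does so
within `Q` steps. -/
theorem iterate_eq_zero_of_le {F : ℕ → ℕ} {Q y t T : ℕ} (h0 : F 0 = 0) (hF : ∀ z, F z < Q)
    (hy : y < Q) (ht : F^[t] y = 0) (hT : Q ≤ T) : F^[T] y = 0 := by
  classical
  have hex : ∃ n, F^[n] y = 0 := ⟨t, ht⟩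
  have hn := Nat.find_spec hex
  set n := Nat.find hex with hn'
  have hlt : ∀ i, F^[i] y < Q := fun i => by
    cases i with
    | zero => exact hy
    | succ i => rw [Function.iterate_succ_apply']; exact hF _
  rcases Nat.lt_or_ge T n with hTn | hTn
  · exfalso
    obtain ⟨i, hi, j, hj, hij, heq⟩ := Finset.exists_ne_map_eq_of_card_lt_of_maps_to
      (s := Finset.range n) (t := Finset.range Q) (f := fun i => F^[i] y) (by simp; omega)
      (fun i _ => by simpa using hlt i)
    -- a repetition before time `n` would allow to reach `0` earlier
    have key : ∀ i j, i < j → j < n → F^[i] y = F^[j] y → False := by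
      intro i j hij hj heq
      have h : F^[n - j + i] y = 0 := by
        rw [Function.iterate_add_apply, heq, ← Function.iterate_add_apply,
          Nat.sub_add_cancel hj.le]
        exact hn
      exact Nat.find_min hex (show n - j + i < n by omega) h
    rcases lt_or_gt_of_ne hij with h | h
    · exact key i j h (Finset.mem_range.1 hj) heq
    · exact key j i h (Finset.mem_range.1 hi) heq.symm
  · obtain ⟨d, rfl⟩ := Nat.exists_eq_add_of_le' hTn
    rw [Function.iterate_add_apply, hn, Function.iterate_fixed h0]

namespace OfflineTM

variable {M : OfflineTM} {x : List Bool}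

theorem run_succ (t : ℕ) : M.run x (t + 1) = M.step x (M.run x t) :=
  Function.iterate_succ_apply' _ _ _

theorem run_add_of_halting {t : ℕ} (k : ℕ) (h : (M.run x t).state = M.acceptState ∨
    (M.run x t).state = M.rejectState) : M.run x (t + k) = M.run x t := by
  induction k with
  | zero => rfl
  | succ k ih => rw [← add_assoc, run_succ, ih, step, if_pos h]

theorem not_accept_and_reject {t t' : ℕ} (h : (M.run x t).state = M.acceptState)
    (h' : (M.run x t').state = M.rejectState) : False := by
  have h₁ := run_add_of_halting t' (Or.inl h)
  have h₂ := run_add_of_halting t (Or.inr h')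
  rw [add_comm, h₁] at h₂
  exact M.accept_ne_reject (by rw [← h, ← h', h₂])

theorem inputHead_le (t : ℕ) : (M.run x t).inputHead ≤ x.length + 1 := by
  induction t with
  | zero => simp [run, init]
  | succ t ih =>
    rw [run_succ, step]
    split_ifs
    · exact ih
    · exact min_le_right _ _

theorem code_lt {m X : ℕ} {c : M.Cfg} (h₁ : M.numStates + 1 ≤ X) (h₂ : c.inputHead < X)
    (h₃ : m ≤ X) (h₄ : (M.numSymbols + 1) ^ m ≤ X) (hm : c.workHead < m) :
    c.code m < X ^ 4 + 1 := by
  rw [Cfg.code, mkCode, Bool.cond_eq_ite]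
  split_ifs
  · omega
  · have hT := tapeCode_lt (fun i => (c.work i).isLt) m
    have := pair_lt_sq (pair_lt_sq (c.state.isLt.trans_le h₁) h₂)
      (pair_lt_sq (hm.trans_le h₃) (hT.trans_le h₄))
    rw [← pow_mul] at this
    exact Nat.succ_lt_succ this

/-- The machine's step on codes, on input `x`, cut off at `Q`. -/
def codeMap (M : OfflineTM) (x : List Bool) (Q y : ℕ) : ℕ :=
  bif ltb (M.stepCode x.length y (scan x (codeInput y))) Q then
    M.stepCode x.length y (scan x (codeInput y)) else 0

theorem codeMap_lt {Q : ℕ} (hQ : 0 < Q) (y : ℕ) : M.codeMap x Q y < Q := by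
  rw [codeMap, Bool.cond_eq_ite]
  split_ifs with h
  · simpa using h
  · exact hQ

theorem codeMap_zero {Q : ℕ} : M.codeMap x Q 0 = 0 := by
  have : M.stepCode x.length 0 (scan x (codeInput 0)) = 0 := rfl
  rw [codeMap, this]
  cases ltb 0 Q <;> rfl

theorem iterate_codeMap {m Q : ℕ} (hm : ∀ t, (M.run x t).workHead < m)
    (hQ : ∀ t, (M.run x t).code m < Q) (t : ℕ) :
    (M.codeMap x Q)^[t] (M.init.code m) = (M.run x t).code m := by
  induction t with
  | zero => rfl
  | succ t ih =>
    have h := hQ (t + 1)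
    rw [run_succ, code_step (hm t)] at h
    rw [Function.iterate_succ_apply', ih, run_succ, code_step (hm t), codeMap, Bool.cond_eq_ite,
      if_pos (by simpa using h)]

/-- The code of the initial configuration, which does not depend on the length of the tape. -/
def initCode (M : OfflineTM) : ℕ := M.mkCode 0 1 0 0

theorem code_init (m : ℕ) : M.init.code m = M.initCode := by
  simp [Cfg.code, initCode, init, tapeCode]

/-- Acceptance is an iteration of the map on codes. -/
theorem mem_iff_iterate_codeMap {A : Language Bool} {m Q T : ℕ}
    (hacc : x ∈ A → ∃ t, (M.run x t).state = M.acceptState)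
    (hrej : x ∉ A → ∃ t, (M.run x t).state = M.rejectState)
    (hm : ∀ t, (M.run x t).workHead < m) (hQ : ∀ t, (M.run x t).code m < Q) (hT : Q ≤ T) :
    (M.codeMap x Q)^[T] M.initCode = 0 ↔ x ∈ A := by
  have hit := iterate_codeMap hm hQ
  simp only [code_init] at hit
  have hpos : 0 < Q := (Nat.zero_le _).trans_lt (hQ 0)
  constructor
  · intro h
    rw [hit, Cfg.code_eq_zero_iff] at h
    by_contra hx
    obtain ⟨t, ht⟩ := hrej hx
    exact not_accept_and_reject h ht
  · intro hx
    obtain ⟨t, ht⟩ := hacc hx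
    refine iterate_eq_zero_of_le (t := t) codeMap_zero (codeMap_lt hpos) ?_ ?_ hT
    · rw [← code_init m]; exact hQ 0
    · rw [hit, Cfg.code_eq_zero_iff, ht]

end OfflineTM

/-! ### Logarithmic space by repeated squaring -/

/-- The cell for the task `(i, j, c, d, e)`: whether the configuration `c` reaches `d` in `2 ^ i`
steps, passing after half of them through a configuration `e'` with `e' / b ^ j = e`, where `b` is
the fan-in. For `i = 0` there is no intermediate configuration. -/
def taskCell (i j c d e : ℕ) : ℕ :=
  2 * (Nat.pair i (Nat.pair j (Nat.pair c (Nat.pair d e))) + 1)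

/-- The components of the task of a cell. -/
def taskI (u : ℕ) : ℕ := (u / 2 - 1).unpair.1

/-- See `taskI`. -/
def taskJ (u : ℕ) : ℕ := (u / 2 - 1).unpair.2.unpair.1

/-- See `taskI`. -/
def taskC (u : ℕ) : ℕ := (u / 2 - 1).unpair.2.unpair.2.unpair.1

/-- See `taskI`. -/
def taskD (u : ℕ) : ℕ := (u / 2 - 1).unpair.2.unpair.2.unpair.2.unpair.1

/-- See `taskI`. -/
def taskE (u : ℕ) : ℕ := (u / 2 - 1).unpair.2.unpair.2.unpair.2.unpair.2

section TaskCell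

variable (i j c d e : ℕ)

@[simp] theorem taskI_taskCell : taskI (taskCell i j c d e) = i := by simp [taskI, taskCell]
@[simp] theorem taskJ_taskCell : taskJ (taskCell i j c d e) = j := by simp [taskJ, taskCell]
@[simp] theorem taskC_taskCell : taskC (taskCell i j c d e) = c := by simp [taskC, taskCell]
@[simp] theorem taskD_taskCell : taskD (taskCell i j c d e) = d := by simp [taskD, taskCell]
@[simp] theorem taskE_taskCell : taskE (taskCell i j c d e) = e := by simp [taskE, taskCell]

theorem eqb_taskCell_mod : eqb (taskCell i j c d e % 2) 1 = false := by
  simp [eqb, taskCell]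

theorem eqb_taskCell_zero : eqb (taskCell i j c d e) 0 = false := by
  simp [eqb, taskCell]

variable {i j c d e}

theorem taskCell_lt {X : ℕ} (hi : i < X) (hj : j < X) (hc : c < X) (hd : d < X) (he : e < X) :
    taskCell i j c d e < 2 * X ^ 16 + 2 := by
  have hX : 0 < X := by omega
  have h₁ := pair_lt_sq hd he
  have h₂ := pair_lt_sq (hc.trans_le (Nat.le_self_pow two_ne_zero X)) h₁
  rw [← pow_mul] at h₂
  have h₃ := pair_lt_sq (hj.trans_le (Nat.le_self_pow (by norm_num : 2 * 2 ≠ 0) X)) h₂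
  rw [← pow_mul] at h₃
  have h₄ := pair_lt_sq (hi.trans_le (Nat.le_self_pow (by norm_num : 2 * 2 * 2 ≠ 0) X)) h₃
  rw [← pow_mul] at h₄
  norm_num at h₄
  unfold taskCell
  omega

theorem eq_taskCell {u : ℕ} (h₁ : u % 2 ≠ 1) (h₂ : u ≠ 0) :
    u = taskCell (taskI u) (taskJ u) (taskC u) (taskD u) (taskE u) := by
  simp only [taskCell, taskI, taskJ, taskC, taskD, taskE, Nat.pair_unpair]
  omega

end TaskCell

/-- The parameters of a network that squares the reachability relation of a machine: the fan-in
`root q N`, and `root q N ^ k` configurations. -/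
structure Squaring where
  M : OfflineTM
  q : ℕ
  k : ℕ

namespace Squaring

variable (P : Squaring)

/-- The number of configurations. -/
def size (N : ℕ) : ℕ := root P.q N ^ P.k

/-- The number of squarings, such that `2 ^ depth` exceeds the number of configurations. -/
def depth (N : ℕ) : ℕ := Nat.log 2 (P.size N) + 1

/-- Whether a cell is used. -/
def valid (N u : ℕ) : Bool :=
  ltb (taskI u) (P.depth N + 1) && ltb (taskJ u) (P.k + 1) && ltb (taskC u) (P.size N) &&
    ltb (taskD u) (P.size N) && ltb (taskE u) (P.size N)

/-- The cell with the input symbol scanned in a configuration. -/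
def inputArgs (N c : ℕ) : List ℕ :=
  bif ltb 0 (OfflineTM.codeInput c) && ltb (OfflineTM.codeInput c) (N + 1) then
    [2 * (OfflineTM.codeInput c - 1) + 1] else []

/-- The cells that a cell reads: the squaring of the relation for `2 ^ i` steps is a disjunction
over all intermediate configurations, computed by a tree. -/
def args (p : ℕ × ℕ) : List ℕ :=
  bif eqb (p.2 % 2) 1 then bif ltb (p.2 / 2) p.1 then [p.2] else []
  else bif eqb p.2 0 then [taskCell (P.depth p.1) P.k P.M.initCode 0 0]
  else bif P.valid p.1 p.2 then
    bif eqb (taskI p.2) 0 then inputArgs p.1 (taskC p.2)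
    else bif eqb (taskJ p.2) 0 then
      [taskCell (taskI p.2 - 1) P.k (taskC p.2) (taskE p.2) 0,
        taskCell (taskI p.2 - 1) P.k (taskE p.2) (taskD p.2) 0]
    else (List.range (root P.q p.1)).map fun a =>
      taskCell (taskI p.2) (taskJ p.2 - 1) (taskC p.2) (taskD p.2)
        (taskE p.2 * root P.q p.1 + a)
  else []

/-- The value of a cell, from the values that it reads. -/
def loc (p : ℕ × ℕ × List Bool) : Bool :=
  bif eqb (p.2.1 % 2) 1 then p.2.2.headD false
  else bif eqb p.2.1 0 then p.2.2.headD false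
  else bif eqb (taskI p.2.1) 0 then
    eqb (bif ltb (P.M.stepCode p.1 (taskC p.2.1) p.2.2[0]?) (P.size p.1) then
      P.M.stepCode p.1 (taskC p.2.1) p.2.2[0]? else 0) (taskD p.2.1)
  else bif eqb (taskJ p.2.1) 0 then p.2.2.getD 0 false && p.2.2.getD 1 false
  else p.2.2.any fun b => b

theorem computable_size : Computable P.size := by
  unfold size; fun_prop

attribute [local fun_prop] computable_size

theorem computable_depth : Computable P.depth := by
  unfold depth; fun_prop

attribute [local fun_prop] computable_depth OfflineTM.computable_stepCode
  OfflineTM.computable_codeInput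

/-- The network without queries that decides by repeated squaring whether a machine accepts; cell
`0` is for the reachability of the code `0` of the accepting configurations. -/
def network : Network where
  args := P.args
  query _ := false
  loc := P.loc
  args_computable := by
    unfold args valid inputArgs taskI taskJ taskC taskD taskE taskCell
    fun_prop
  query_computable := Computable.const false
  loc_computable := by
    unfold loc taskI taskJ taskC taskD
    fun_prop

end Squaring

namespace Squaring

variable {P : Squaring} {B : Language Bool} {x : List Bool}

/-- The map on codes of configurations whose iterates the network computes. -/
def next (P : Squaring) (x : List Bool) : ℕ → ℕ := P.M.codeMap x (P.size x.length)

theorem size_pos (N : ℕ) : 0 < P.size N :=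
  pow_pos (by have := two_le_root P.q N; omega) _

theorem iterate_next_lt {c : ℕ} (hc : c < P.size x.length) (n : ℕ) :
    (P.next x)^[n] c < P.size x.length := by
  cases n with
  | zero => exact hc
  | succ n =>
    rw [Function.iterate_succ_apply']
    exact OfflineTM.codeMap_lt (size_pos _) _

theorem board_input (t : ℕ) {i : ℕ} (hi : i < x.length) :
    P.network.board B x t (2 * i + 1) = x.getD i false := by
  have h₁ : eqb ((2 * i + 1) % 2) 1 = true := by simp [eqb]
  have h₂ : (2 * i + 1) / 2 = i := by omega
  induction t with
  | zero =>
    change Network.initial x (2 * i + 1) = _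
    simp [Network.initial, eqb, h₂]
  | succ t ih =>
    have h₃ : ltb i x.length = true := by simpa using hi
    have h₄ : P.args (x.length, 2 * i + 1) = [2 * i + 1] := by
      simp only [args, h₁, h₂, h₃, cond_true]
    have h₅ : P.network.board B x (t + 1) (2 * i + 1) = P.loc (x.length, 2 * i + 1,
        (P.args (x.length, 2 * i + 1)).map (P.network.board B x t)) := by
      rw [Network.board_succ]
      rfl
    rw [h₅, h₄]
    simp only [loc, h₁, cond_true, List.map_cons, List.headD_cons, ih]

/-- The value of a valid cell after a step. -/
theorem board_task (t : ℕ) {i j c d e : ℕ} (hi : i ≤ P.depth x.length) (hj : j ≤ P.k)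
    (hc : c < P.size x.length) (hd : d < P.size x.length) :
    P.network.board B x (t + 1) (taskCell i j c d e) =
      bif eqb i 0 then
        P.loc (x.length, taskCell i j c d e, (bif ltb e (P.size x.length) then
          inputArgs x.length c else []).map (P.network.board B x t))
      else bif ltb e (P.size x.length) then
        bif eqb j 0 then P.network.board B x t (taskCell (i - 1) P.k c e 0) &&
          P.network.board B x t (taskCell (i - 1) P.k e d 0)
        else (List.range (root P.q x.length)).any fun a =>
          P.network.board B x t (taskCell i (j - 1) c d (e * root P.q x.length + a))
      else false := by
  have hv : P.valid x.length (taskCell i j c d e) = ltb e (P.size x.length) := by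
    have h₁ : ltb i (P.depth x.length + 1) = true := by simp; omega
    have h₂ : ltb j (P.k + 1) = true := by simp; omega
    have h₃ : ltb c (P.size x.length) = true := by simpa using hc
    have h₄ : ltb d (P.size x.length) = true := by simpa using hd
    simp [valid, h₁, h₂, h₃, h₄]
  rw [Network.board_succ]
  simp only [Network.update, network, cond_false, args, eqb_taskCell_mod, eqb_taskCell_zero, hv,
    taskI_taskCell, taskJ_taskCell, taskC_taskCell, taskD_taskCell, taskE_taskCell]
  cases ltb e (P.size x.length)
  · cases hi0 : eqb i 0 <;> cases hj0 : eqb j 0 <;>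
      simp [loc, eqb_taskCell_mod, eqb_taskCell_zero, hi0, hj0]
  · cases hi0 : eqb i 0 <;> cases hj0 : eqb j 0 <;>
      simp [loc, eqb_taskCell_mod, eqb_taskCell_zero, hi0, hj0, List.any_map,
        Function.comp_def]

theorem getElem?_inputArgs (t c : ℕ) :
    ((inputArgs x.length c).map (P.network.board B x t))[0]? =
      OfflineTM.scan x (OfflineTM.codeInput c) := by
  rw [inputArgs, Bool.cond_eq_ite, OfflineTM.scan]
  simp only [Bool.and_eq_true, ltb_eq_true]
  by_cases h₀ : OfflineTM.codeInput c = 0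
  · simp [h₀]
  · by_cases h₁ : OfflineTM.codeInput c < x.length + 1
    · have h₂ : OfflineTM.codeInput c - 1 < x.length := by omega
      rw [if_pos ⟨by omega, h₁⟩, if_neg h₀]
      simp [board_input t h₂, h₂]
    · have h₂ : x.length ≤ OfflineTM.codeInput c - 1 := by omega
      rw [if_neg (by omega), if_neg h₀]
      simp [h₂]

/-- The relation for `2 ^ i` steps is known after `(i + 1) * (k + 1)` steps of the network. A
tree with `k` levels computes the disjunction over the intermediate configurations `e`; level `j`
takes those `e` together that agree up to the last `j` digits in base `root q N`. -/
theorem board_squaring {i : ℕ} (hi : i ≤ P.depth x.length) :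
    ∀ t, (i + 1) * (P.k + 1) ≤ t → ∀ c < P.size x.length, ∀ d < P.size x.length,
      P.network.board B x t (taskCell i P.k c d 0) = eqb ((P.next x)^[2 ^ i] c) d := by
  have hroot := two_le_root P.q x.length
  induction i with
  | zero =>
    intro t ht c hc d hd
    obtain ⟨t, rfl⟩ := Nat.exists_eq_add_of_le' (show 1 ≤ t by omega)
    have h₁ : ltb 0 (P.size x.length) = true := by simpa using size_pos _
    rw [board_task t hi le_rfl hc hd, h₁]
    simp only [loc, eqb_taskCell_mod, eqb_taskCell_zero, taskI_taskCell, taskC_taskCell,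
      taskD_taskCell, cond_true, cond_false, getElem?_inputArgs,
      show eqb (0 : ℕ) 0 = true from rfl]
    rfl
  | succ i ih =>
    have ih := ih (by omega)
    -- the tree of the disjunction over the intermediate configurations
    have tree : ∀ j ≤ P.k, ∀ t, (i + 1) * (P.k + 1) + 1 + j ≤ t → ∀ c < P.size x.length,
        ∀ d < P.size x.length, ∀ e, (P.network.board B x t (taskCell (i + 1) j c d e) = true ↔
          (P.next x)^[2 ^ i] c / root P.q x.length ^ j = e ∧
            (P.next x)^[2 ^ i] ((P.next x)^[2 ^ i] c) = d) := by
      intro j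
      induction j with
      | zero =>
        intro hj t ht c hc d hd e
        obtain ⟨t, rfl⟩ := Nat.exists_eq_add_of_le' (show 1 ≤ t by omega)
        rw [board_task t hi hj hc hd]
        simp only [show eqb (i + 1) 0 = false by simp [eqb], show eqb (0 : ℕ) 0 = true from rfl,
          cond_true, cond_false, Nat.add_sub_cancel, pow_zero, Nat.div_one]
        rcases Nat.lt_or_ge e (P.size x.length) with he | he
        · have h₁ : ltb e (P.size x.length) = true := by simpa using he
          rw [h₁, cond_true, ih t (by omega) c hc e he, ih t (by omega) e he d hd]
          simp only [Bool.and_eq_true, eqb_eq_true]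
          constructor
          · rintro ⟨rfl, h⟩
            exact ⟨rfl, h⟩
          · rintro ⟨rfl, h⟩
            exact ⟨rfl, h⟩
        · have h₁ : ltb e (P.size x.length) = false := by simp [ltb]; omega
          have h₂ := iterate_next_lt hc (2 ^ i)
          rw [h₁, cond_false]
          simp only [Bool.false_eq_true, false_iff, not_and]
          intro h
          omega
      | succ j ihj =>
        intro hj t ht c hc d hd e
        obtain ⟨t, rfl⟩ := Nat.exists_eq_add_of_le' (show 1 ≤ t by omega)
        rw [board_task t hi hj hc hd]
        simp only [show eqb (i + 1) 0 = false by simp [eqb],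
          show eqb (j + 1) 0 = false by simp [eqb], cond_false, Nat.add_sub_cancel]
        have hrpos : 0 < root P.q x.length := by omega
        have hdiv : (P.next x)^[2 ^ i] c / root P.q x.length ^ (j + 1) =
            (P.next x)^[2 ^ i] c / root P.q x.length ^ j / root P.q x.length := by
          rw [pow_succ, Nat.div_div_eq_div_mul]
        rcases Nat.lt_or_ge e (P.size x.length) with he | he
        · have h₁ : ltb e (P.size x.length) = true := by simpa using he
          rw [h₁, cond_true, List.any_eq_true, hdiv]
          simp only [List.mem_range]
          constructor
          · rintro ⟨a, ha, h⟩
            obtain ⟨h₂, h₃⟩ := (ihj (by omega) t (by omega) c hc d hd _).1 h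
            refine ⟨?_, h₃⟩
            rw [h₂, mul_comm, Nat.mul_add_div hrpos, Nat.div_eq_of_lt ha, add_zero]
          · rintro ⟨h₂, h₃⟩
            refine ⟨(P.next x)^[2 ^ i] c / root P.q x.length ^ j % root P.q x.length,
              Nat.mod_lt _ hrpos, (ihj (by omega) t (by omega) c hc d hd _).2 ⟨?_, h₃⟩⟩
            rw [← h₂]
            exact (Nat.div_add_mod' _ _).symm
        · have h₁ : ltb e (P.size x.length) = false := by simp [ltb]; omega
          have h₂ := iterate_next_lt hc (2 ^ i)
          have h₃ := Nat.div_le_self ((P.next x)^[2 ^ i] c) (root P.q x.length ^ (j + 1))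
          rw [h₁, cond_false]
          simp only [Bool.false_eq_true, false_iff, not_and]
          intro h
          omega
    intro t ht c hc d hd
    rw [Bool.eq_iff_iff, tree P.k le_rfl t (by rw [Nat.succ_mul] at ht; omega) c hc d hd,
      eqb_eq_true, pow_succ 2 i, mul_two, Function.iterate_add_apply]
    have h₁ := iterate_next_lt hc (2 ^ i)
    rw [show root P.q x.length ^ P.k = P.size x.length from rfl, Nat.div_eq_of_lt h₁]
    simp

/-- The number of steps after which the network has the result. -/
def steps (P : Squaring) (N : ℕ) : ℕ := (P.depth N + 1) * (P.k + 1) + 1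

theorem board_steps (h : P.M.initCode < P.size x.length) :
    P.network.board B x (P.steps x.length) 0 =
      eqb ((P.next x)^[2 ^ P.depth x.length] P.M.initCode) 0 := by
  rw [steps, Network.board_succ, ← board_squaring le_rfl _ le_rfl _ h _ (size_pos _)]
  rfl

theorem length_args_le (N u : ℕ) : (P.args (N, u)).length ≤ root P.q N := by
  have := two_le_root P.q N
  simp only [args, inputArgs, Bool.cond_eq_ite]
  split_ifs <;> simp <;> omega

theorem polyBounded_size : PolyBounded P.size := (PolyBounded.root P.q).pow P.k

theorem depth_le (N : ℕ) : P.depth N ≤ (Nat.log 2 N + 1) * (P.k + 1) := by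
  have h : P.size N = 2 ^ ((Nat.log 2 N / P.q + 1) * P.k) := by rw [size, root, ← pow_mul]
  rw [depth, h, Nat.log_pow one_lt_two]
  have : Nat.log 2 N / P.q ≤ Nat.log 2 N := Nat.div_le_self _ _
  have h₂ : (Nat.log 2 N / P.q + 1) * P.k ≤ (Nat.log 2 N + 1) * P.k :=
    Nat.mul_le_mul_right _ (by omega)
  rw [Nat.mul_succ]
  omega

theorem args_lt : ∃ z, ∀ N u, ∀ a ∈ P.args (N, u),
    a < (N + 2) ^ z ∧ u < (N + 2) ^ z := by
  -- a common bound for all numbers that occur in tasks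
  set X : ℕ → ℕ := fun N => P.depth N + 1 + (P.k + 1) + P.M.initCode + 1 +
    (P.size N + 1) * root P.q N with hX
  have hpoly : PolyBounded fun N => 2 * X N ^ 16 + 2 + 2 * N + 1 := by
    have hdepth : PolyBounded P.depth :=
      (((PolyBounded.id.add (PolyBounded.const 1)).mul (PolyBounded.const (P.k + 1)))).mono
        fun N => (P.depth_le N).trans
          (Nat.mul_le_mul_right _ (Nat.succ_le_succ (Nat.log_le_self 2 N)))
    have hXp : PolyBounded X :=
      ((((hdepth.add (.const 1)).add (.const (P.k + 1))).add (.const P.M.initCode)).add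
        (.const 1)).add ((polyBounded_size.add (.const 1)).mul (.root P.q))
    exact ((((PolyBounded.const 2).mul (hXp.pow 16)).add (.const 2)).add
      ((PolyBounded.const 2).mul .id)).add (.const 1)
  obtain ⟨z, hz⟩ := hpoly
  refine ⟨z, fun N u a ha => ?_⟩
  suffices h : a < 2 * X N ^ 16 + 2 + 2 * N + 1 ∧ u < 2 * X N ^ 16 + 2 + 2 * N + 1 from
    ⟨h.1.trans_le (hz N), h.2.trans_le (hz N)⟩
  have hroot := two_le_root P.q N
  have hsizeX : P.size N * root P.q N + root P.q N < X N := by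
    simp only [hX, Nat.succ_mul]; omega
  have hsize : P.size N ≤ P.size N * root P.q N := Nat.le_mul_of_pos_right _ (by omega)
  have hX₀ : P.depth N < X N := by simp only [hX]; omega
  have hX₁ : P.k < X N := by simp only [hX]; omega
  have hX₂ : P.M.initCode < X N := by simp only [hX]; omega
  simp only [args, inputArgs, Bool.cond_eq_ite, eqb_eq_true, ltb_eq_true, valid,
    Bool.and_eq_true] at ha
  split_ifs at ha with h₁ h₂ h₃ h₄ h₅ h₆ h₇
  · rw [List.mem_singleton] at ha
    omega
  · simp at ha
  · rw [List.mem_singleton] at ha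
    subst ha
    have := taskCell_lt hX₀ hX₁ hX₂ (show 0 < X N by omega) (show 0 < X N by omega)
    omega
  all_goals try simp at ha
  all_goals
    obtain ⟨⟨⟨⟨g₁, g₂⟩, g₃⟩, g₄⟩, g₅⟩ := h₄
    have hu := taskCell_lt (X := X N) (i := taskI u) (j := taskJ u) (c := taskC u) (d := taskD u)
      (e := taskE u) (by omega) (by omega) (by omega) (by omega) (by omega)
    rw [← eq_taskCell h₁ h₃] at hu
  · subst ha
    omega
  · have ha₁ := taskCell_lt (X := X N) (i := taskI u - 1) (j := P.k) (c := taskC u)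
      (d := taskE u) (e := 0) (by omega) (by omega) (by omega) (by omega) (by omega)
    have ha₂ := taskCell_lt (X := X N) (i := taskI u - 1) (j := P.k) (c := taskE u)
      (d := taskD u) (e := 0) (by omega) (by omega) (by omega) (by omega) (by omega)
    rcases ha with rfl | rfl <;> omega
  · obtain ⟨a', ha', rfl⟩ := ha
    have hmul : taskE u * root P.q N ≤ P.size N * root P.q N :=
      Nat.mul_le_mul_right _ g₅.le
    have := taskCell_lt (X := X N) (i := taskI u) (j := taskJ u - 1) (c := taskC u)
      (d := taskD u) (e := taskE u * root P.q N + a') (by omega) (by omega) (by omega)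
      (by omega) (by omega)
    omega

end Squaring

/-- An algorithm that rejects everything. -/
def rejectAll : MPCAlgorithm where
  machines N := N + 1
  memory _ := 1
  rounds _ := 0
  step _ := ([], [])
  answer _ := false
  machines_computable := by fun_prop
  memory_computable := by fun_prop
  rounds_computable := by fun_prop
  step_computable := by fun_prop
  answer_computable := by fun_prop

theorem rejectAll_decidesWith : rejectAll.DecidesWith 2 (0 : Language Bool) := by
  refine ⟨fun N => ⟨Nat.succ_pos N, ?_⟩, fun x D hD => ⟨fun k hk => ⟨fun t ht => ?_,
    fun t ht => absurd ht (Nat.not_lt_zero t)⟩, ?_⟩⟩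
  · change N ≤ (N + 1) * 1
    omega
  · obtain rfl : t = 0 := Nat.le_zero.1 ht
    simp only [MPCAlgorithm.run, List.length_nil, add_zero, List.append_nil]
    refine ⟨hD.2 k hk, fun w hw => ?_⟩
    have hw' : w ∈ (List.range (rejectAll.machines x.length)).flatMap D :=
      List.mem_flatMap.2 ⟨k, List.mem_range.2 hk, hw⟩
    have h₁ := (mem_inputWords.1 (hD.1.mem_iff.1 hw')).1
    nlinarith [Nat.div_add_mod w 2, Nat.mod_lt w two_pos]
  · simp only [MPCAlgorithm.result, rejectAll, Bool.false_eq_true, false_iff]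
    exact Language.notMem_zero x

/-- Logarithmic space can be simulated in a logarithmic number of rounds. -/
theorem mpcSolvable_of_mem_classL {A : Language Bool} (hA : A ∈ ClassL) {f : ℕ → ℝ}
    (hf : (fun N : ℕ => Real.log N) =O[atTop] f) : MPCSolvable f A := by
  obtain ⟨M, c, hM⟩ := hA
  intro ε hε₀ hε₁
  obtain ⟨q, hq⟩ := exists_nat_gt (2 / (1 - ε))
  have hε₂ : 0 < 1 - ε := by linarith
  have hq₀ : (0 : ℝ) < q := lt_trans (by positivity) hq
  have hq₁ : 1 ≤ q := by exact_mod_cast hq₀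
  have hqε : 2 / (q : ℝ) ≤ 1 - ε := by
    rw [div_lt_iff₀ hε₂] at hq
    rw [div_le_iff₀ hq₀]
    linarith
  -- the number of configurations is polynomial
  set m : ℕ → ℕ := fun N => c * (Nat.log 2 N + 1) with hm
  set X : ℕ → ℕ := fun N => M.numStates + 1 + (N + 2) + m N + (M.numSymbols + 1) ^ m N with hX
  have hXp : PolyBounded fun N => X N ^ 4 + 1 := by
    have hmp : PolyBounded m :=
      ((PolyBounded.const c).mul (PolyBounded.id.add (.const 1))).mono fun N =>
        Nat.mul_le_mul_left _ (Nat.succ_le_succ (Nat.log_le_self 2 N))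
    have hsp : PolyBounded fun N => (M.numSymbols + 1) ^ m N := by
      refine ((PolyBounded.two_pow_log.mul (.const 2)).pow ((M.numSymbols + 1) * c)).mono
        fun N => ?_
      rw [← pow_succ, ← pow_mul]
      calc (M.numSymbols + 1) ^ m N ≤ (2 ^ (M.numSymbols + 1)) ^ m N :=
            Nat.pow_le_pow_left Nat.lt_two_pow_self.le _
        _ = 2 ^ ((Nat.log 2 N + 1) * ((M.numSymbols + 1) * c)) := by
            rw [← pow_mul]; congr 1; simp only [hm]; ring
    exact ((((PolyBounded.const _).add (PolyBounded.id.add (.const 2))).add hmp).add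
      hsp).pow 4 |>.add (.const 1)
  obtain ⟨C, hC⟩ := hXp
  let P : Squaring := ⟨M, q, (q + 1) * C⟩
  have hsize : ∀ N, X N ^ 4 + 1 ≤ P.size N := fun N =>
    (hC N).trans (add_two_pow_le_root_pow hq₁ N C)
  have hcode : ∀ (x : List Bool) t, (M.run x t).code (m x.length) < P.size x.length := by
    intro x t
    refine lt_of_lt_of_le (OfflineTM.code_lt ?_ ?_ ?_ ?_ ((hM x).2.2 t)) (hsize _)
    · simp only [hX]; omega
    · have := OfflineTM.inputHead_le (M := M) (x := x) t
      simp only [hX]; omega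
    · simp only [hX]; omega
    · simp only [hX]; omega
  obtain ⟨z, hz⟩ := P.args_lt
  obtain ⟨z', hz'⟩ := PolyBounded.root q
  have hpow : ∀ {a b : ℕ} (N : ℕ), a ≤ b → (N + 2) ^ a ≤ (N + 2) ^ b :=
    fun N h => Nat.pow_le_pow_right (by omega) h
  have hlog : (fun _ : ℕ => (1 : ℝ)) =O[atTop] fun N : ℕ => Real.log N := by
    refine IsBigO.of_bound 1 ((eventually_ge_atTop 3).mono fun N hN => ?_)
    have h₁ : Real.exp 1 ≤ N := Real.exp_one_lt_three.le.trans (by exact_mod_cast hN)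
    have h₂ : 1 ≤ Real.log N := by
      rw [← Real.log_exp 1]
      exact Real.log_le_log (Real.exp_pos 1) h₁
    rw [norm_one, one_mul, Real.norm_of_nonneg (by linarith)]
    exact h₂
  have hstepsO : (fun N => (P.steps N * ((0 : ℕ) + 1) : ℝ)) =O[atTop] f := by
    refine IsBigO.trans ?_ hf
    have hnatlog : (fun N : ℕ => (Nat.log 2 N : ℝ)) =O[atTop] fun N : ℕ => Real.log N := by
      refine IsBigO.of_bound (1 / Real.log 2) ((eventually_ge_atTop 1).mono fun N hN => ?_)
      have h₁ := Real.natLog_le_logb N 2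
      have h₂ : (0 : ℝ) ≤ Real.log N := Real.log_natCast_nonneg N
      rw [Real.norm_of_nonneg (Nat.cast_nonneg _), Real.norm_of_nonneg h₂]
      rw [Real.logb] at h₁
      calc (Nat.log 2 N : ℝ) ≤ Real.log N / Real.log (2 : ℕ) := h₁
        _ = _ := by push_cast; ring
    have hbig := (hnatlog.add hlog).const_mul_left ((P.k + 2 : ℝ) * (P.k + 2))
    refine IsBigO.trans (IsBigO.of_bound 1 (Eventually.of_forall fun N => ?_)) hbig
    rw [Real.norm_of_nonneg (by positivity), Real.norm_of_nonneg (by positivity), one_mul]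
    have h₁ : P.steps N ≤ (P.k + 2) * (P.k + 2) * (Nat.log 2 N + 1) := by
      have := P.depth_le N
      unfold Squaring.steps
      have h₂ : (P.depth N + 1) * (P.k + 1) ≤
          ((Nat.log 2 N + 1) * (P.k + 1) + (Nat.log 2 N + 1)) * (P.k + 1) :=
        Nat.mul_le_mul_right _ (by omega)
      nlinarith
    have h₂ : (P.steps N : ℝ) ≤ (P.k + 2) * (P.k + 2) * (Nat.log 2 N + 1) := by exact_mod_cast h₁
    push_cast
    linarith
  refine solvableWith_of_network (K := 0) hε₀ P.network rejectAll rejectAll_decidesWith hq₁ hqε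
    (R := fun _ => 0) (T := P.steps) (z := z + z' + 1) (by fun_prop) ?_ (fun N u a ha => ?_)
    (fun N u => ?_) (fun N u _ => ?_) ?_ ?_ ?_ (fun x => ?_) (hlog.trans hf) hstepsO
  · have := P.computable_depth
    unfold Squaring.steps
    fun_prop
  · obtain ⟨h₁, h₂⟩ := hz N u a ha
    exact ⟨h₁.trans_le (hpow N (by omega)), h₂.trans_le (hpow N (by omega))⟩
  · exact (P.length_args_le N u).trans ((hz' N).trans (hpow N (by omega)))
  · exact (P.length_args_le N u).trans (Nat.le_self_pow two_ne_zero _)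
  · intro N u h; simp [Squaring.network] at h
  · intro N u h; simp [Squaring.network] at h
  · intro N u h; simp [Squaring.network] at h
  · have hinit : M.initCode < P.size x.length := by
      rw [← OfflineTM.code_init (m x.length)]
      exact hcode x 0
    rw [Squaring.board_steps hinit, eqb_eq_true]
    exact OfflineTM.mem_iff_iterate_codeMap (hM x).1 (hM x).2.1 (hM x).2.2 (hcode x)
      (Nat.lt_pow_succ_log_self one_lt_two _).le

/-! ### Uniform circuit families are computable -/

/-- Languages in `L` are decidable: they are decided by a massively parallel computation, which can
be simulated. -/
theorem exists_computable_of_mem_classL {A : Language Bool} (hA : A ∈ ClassL) :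
    ∃ d : List Bool → Bool, Computable d ∧ ∀ x, d x = true ↔ x ∈ A := by
  obtain ⟨M, hM, -⟩ := mpcSolvable_of_mem_classL hA (f := fun N : ℕ => Real.log N)
    (isBigO_refl _ _) (1 / 2) (by norm_num) (by norm_num)
  exact hM.exists_computable

theorem replicate_append_false_inj : ∀ {m n : ℕ} {s t : List Bool},
    List.replicate m true ++ false :: s = List.replicate n true ++ false :: t → m = n ∧ s = t
  | 0, 0, _, _, h => ⟨rfl, by simpa using h⟩
  | 0, n + 1, _, _, h => by simp [List.replicate_succ] at h
  | m + 1, 0, _, _, h => by simp [List.replicate_succ] at h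
  | m + 1, n + 1, s, t, h => by
    have := replicate_append_false_inj (m := m) (n := n) (s := s) (t := t)
      (by simpa [List.replicate_succ] using h)
    exact ⟨congrArg (· + 1) this.1, this.2⟩

theorem pairCode_inj {n i m j : ℕ} : pairCode n i = pairCode m j ↔ n = m ∧ i = j := by
  refine ⟨fun h => ?_, fun ⟨h₁, h₂⟩ => by rw [h₁, h₂]⟩
  obtain ⟨h₁, h₂⟩ := replicate_append_false_inj h
  refine ⟨h₁, Nat.eq_of_testBit_eq fun k => ?_⟩
  rw [Nat.testBit_eq_inth, Nat.testBit_eq_inth, h₂]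

@[fun_prop]
theorem computable_pairCode {α : Type*} [Primcodable α] {f g : α → ℕ} (hf : Computable f)
    (hg : Computable g) : Computable fun a => pairCode (f a) (g a) := by
  unfold pairCode
  fun_prop

/-- The bits of the string and its length can be looked up by deciding two languages, so that
the string is found by a search. -/
theorem ImplicitlyLogspaceComputable.computable {d : ℕ → List Bool}
    (h : ImplicitlyLogspaceComputable d) : Computable d := by
  obtain ⟨-, h₁, h₂⟩ := h
  obtain ⟨d₁, hd₁, h₁⟩ := exists_computable_of_mem_classL h₁
  obtain ⟨d₂, hd₂, h₂⟩ := exists_computable_of_mem_classL h₂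
  have h₁ : ∀ n i, d₁ (pairCode n i) = true ↔ i < (d n).length := fun n i =>
    (h₁ _).trans ⟨by rintro ⟨m, j, he, hj⟩; obtain ⟨rfl, rfl⟩ := pairCode_inj.1 he; exact hj,
      fun hi => ⟨n, i, rfl, hi⟩⟩
  have h₂ : ∀ n i, d₂ (pairCode n i) = true ↔ (d n)[i]? = some true := fun n i =>
    (h₂ _).trans ⟨by rintro ⟨m, j, he, hj⟩; obtain ⟨rfl, rfl⟩ := pairCode_inj.1 he; exact hj,
      fun hi => ⟨n, i, rfl, hi⟩⟩
  refine computable_of_graph (R := fun p => (List.range p.2.length).all (fun i =>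
      d₁ (pairCode p.1 i) && eqb (d₂ (pairCode p.1 i)) (p.2.getD i false)) &&
      !d₁ (pairCode p.1 p.2.length)) (by fun_prop) fun n w => ?_
  simp only [Bool.and_eq_true, List.all_eq_true, List.mem_range, h₁, eqb_eq_true,
    Bool.not_eq_true', ← Bool.not_eq_true, not_lt]
  constructor
  · rintro ⟨hw, hl⟩
    have hlen : (d n).length = w.length := by
      refine hl.antisymm ?_
      by_contra! hlt
      exact lt_irrefl _ (hw _ hlt).1
    refine List.ext_getElem hlen fun i hi hi' => ?_
    have := (hw i hi').2
    rw [Bool.eq_iff_iff, h₂] at this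
    simp only [List.getD_eq_getElem?_getD, List.getElem?_eq_getElem hi,
      List.getElem?_eq_getElem hi', Option.some.injEq, Option.getD_some] at this
    exact Bool.eq_iff_iff.2 this
  · rintro rfl
    refine ⟨fun i hi => ⟨hi, ?_⟩, le_rfl⟩
    rw [Bool.eq_iff_iff, h₂]
    simp [List.getD_eq_getElem?_getD, List.getElem?_eq_getElem hi]

/-- The unary code of a sequence of numbers. -/
def unary (l : List ℕ) : List Bool := l.flatMap fun k => List.replicate k true ++ [false]

theorem unary_injective : Function.Injective unary := by
  intro l
  induction l with
  | nil =>
    rintro (_ | ⟨k, l'⟩) h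
    · rfl
    · simp [unary] at h
  | cons k l ih =>
    rintro (_ | ⟨k', l'⟩) h
    · simp [unary] at h
    · have h' : List.replicate k true ++ false :: unary l =
          List.replicate k' true ++ false :: unary l' := by
        simpa [unary] using h
      obtain ⟨rfl, h''⟩ := replicate_append_false_inj h'
      rw [ih h'']

theorem length_le_length_unary (l : List ℕ) : l.length ≤ (unary l).length := by
  induction l with
  | nil => simp
  | cons k l ih => simp only [unary, List.flatMap_cons, List.length_append, List.length_cons,
      List.length_nil] at ih ⊢; omega

/-- The length of the code of a gate, read off from its first two entries. -/
def codeLength (g : List ℕ) : ℕ :=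
  bif eqb (g.headD 0) 5 then g.getD 1 0 + 2 else bif ltb 2 (g.headD 0) then 3 else 2

/-- The length of `g` is as its first two entries require. The words with this property form a
prefix code, and the codes of gates are among them. -/
def isCode (g : List ℕ) : Bool := ltb 1 g.length && eqb g.length (codeLength g)

theorem isCode_code (g : Gate) : isCode g.code = true := by
  cases g <;> simp [isCode, codeLength, Gate.code, eqb, ltb]

/-- A word of the prefix code is determined by any list that it begins. -/
theorem eq_of_isCode_append {g h s t : List ℕ} (hg : isCode g = true) (hh : isCode h = true)
    (e : g ++ s = h ++ t) : g = h ∧ s = t := by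
  simp only [isCode, Bool.and_eq_true, ltb_eq_true, eqb_eq_true] at hg hh
  refine List.append_inj e ?_
  rw [hg.2, hh.2]
  match g, h, hg.1, hh.1, e with
  | a :: b :: g, a' :: b' :: h, _, _, e =>
    simp only [List.cons_append, List.cons.injEq] at e
    simp [codeLength, e.1, e.2.1]

theorem eq_of_flatten_eq {l l' : List (List ℕ)} (hl : ∀ g ∈ l, isCode g = true)
    (hl' : ∀ g ∈ l', isCode g = true) (h : l.flatten = l'.flatten) : l = l' := by
  have pos : ∀ {g : List ℕ}, isCode g = true → g ≠ [] := by
    rintro _ hg rfl; simp [isCode] at hg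
  induction l generalizing l' with
  | nil =>
    rcases l' with _ | ⟨g', l'⟩
    · rfl
    · simp only [List.flatten_nil, List.flatten_cons, List.nil_eq, List.append_eq_nil_iff] at h
      exact absurd h.1 (pos (hl' g' (by simp)))
  | cons g l ih =>
    rcases l' with _ | ⟨g', l'⟩
    · simp only [List.flatten_nil, List.flatten_cons, List.append_eq_nil_iff] at h
      exact absurd h.1 (pos (hl g (by simp)))
    · rw [List.flatten_cons, List.flatten_cons] at h
      obtain ⟨rfl, h₂⟩ := eq_of_isCode_append (hl g (by simp)) (hl' g' (by simp)) h
      rw [ih (fun a ha => hl a (by simp [ha])) (fun a ha => hl' a (by simp [ha])) h₂]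

theorem Circuit.description_eq (C : Circuit) :
    C.description = unary (C.map Gate.code).flatten := by
  rw [Circuit.description, unary, List.flatMap_def (l := C)]

theorem Circuit.length_le_length_description (C : Circuit) :
    C.length ≤ C.description.length := by
  rw [description_eq]
  refine le_trans ?_ (length_le_length_unary _)
  induction C with
  | nil => simp
  | cons g C ih =>
    have : 1 ≤ g.code.length := by cases g <;> simp [Gate.code]
    simp only [List.map_cons, List.flatten_cons, List.length_append, List.length_cons] at ih ⊢
    omega

/-- A uniform family of circuits is computable, as a family of lists of codes of gates: the codes
are found by a search, since the description determines them. -/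
theorem computable_codes {C : ℕ → Circuit}
    (h : ImplicitlyLogspaceComputable fun n => (C n).description) :
    Computable fun n => (C n).map Gate.code := by
  have hd := h.computable
  refine computable_of_graph (R := fun p => eqb (p.2.flatMap fun g => g.flatMap fun k =>
    List.replicate k true ++ [false]) (C p.1).description && p.2.all isCode) ?_ fun n l => ?_
  · unfold isCode codeLength
    have hd' : Computable fun p : ℕ × List (List ℕ) => (C p.1).description :=
      hd.comp Computable.fst
    fun_prop
  · have hl : (l.flatMap fun g => g.flatMap fun k => List.replicate k true ++ [false]) =
        unary l.flatten := by
      induction l with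
      | nil => rfl
      | cons g l ih => rw [List.flatMap_cons, ih]; simp [unary]
    simp only [Bool.and_eq_true, eqb_eq_true, List.all_eq_true, hl, Circuit.description_eq]
    have hC : ∀ g ∈ (C n).map Gate.code, isCode g = true := by
      simp only [List.mem_map]
      rintro _ ⟨g, -, rfl⟩
      exact isCode_code g
    exact ⟨fun ⟨h₁, h₂⟩ => (eq_of_flatten_eq h₂ hC (unary_injective h₁)).symm,
      by rintro rfl; exact ⟨rfl, hC⟩⟩

/-! ### Recursion along a circuit -/

section Build

variable {α β : Type*}

/-- The list of the values of the nodes of `G`, where `F` computes the value of a node from the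
values of the earlier nodes. -/
def build (F : List β → α → β) (G : List α) : List β := G.foldl (fun v g => v ++ [F v g]) []

theorem build_append (F : List β → α → β) (G : List α) (g : α) :
    build F (G ++ [g]) = build F G ++ [F (build F G) g] := by
  simp [build]

@[simp]
theorem length_build (F : List β → α → β) (G : List α) : (build F G).length = G.length := by
  induction G using List.reverseRecOn with
  | nil => rfl
  | append_singleton G g ih => simp [build_append, ih]

theorem take_build (F : List β → α → β) (G : List α) (k : ℕ) :
    (build F G).take k = build F (G.take k) := by
  induction G using List.reverseRecOn with
  | nil => simp [build]
  | append_singleton G g ih =>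
    rcases le_or_gt k G.length with h | h
    · rw [build_append, List.take_append_of_le_length (by simpa using h),
        List.take_append_of_le_length h, ih]
    · rw [List.take_of_length_le (by simpa using h), List.take_of_length_le (by simpa using h)]

theorem getD_build {F : List β → α → β} {G : List α} {k : ℕ} {g : α} (h : G[k]? = some g)
    (d : β) : (build F G).getD k d = F ((build F G).take k) g := by
  obtain ⟨hk, rfl⟩ := List.getElem?_eq_some_iff.1 h
  have h₁ : (build F G).getD k d = (build F (G.take (k + 1))).getD k d := by
    rw [← take_build, List.getD_eq_getElem?_getD, List.getD_eq_getElem?_getD,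
      List.getElem?_take_of_lt (Nat.lt_succ_self k)]
  rw [h₁, List.take_succ_eq_append_getElem hk, build_append, take_build,
    List.getD_append_right _ _ _ _ (by simp)]
  simp [hk.le]

theorem getD_take {l : List β} {a k : ℕ} (h : a < k) (d : β) :
    (l.take k).getD a d = l.getD a d := by
  rw [List.getD_eq_getElem?_getD, List.getD_eq_getElem?_getD, List.getElem?_take_of_lt h]

@[fun_prop]
theorem computable_build {γ σ τ : Type*} [Primcodable γ] [Primcodable σ] [Primcodable τ]
    {G : γ → List τ} {F : γ → List σ → τ → σ} (hG : Computable G)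
    (hF : Computable fun p : γ × List σ × τ => F p.1 p.2.1 p.2.2) :
    Computable fun a => build (F a) (G a) := by
  unfold build
  exact computable_foldl hG (by fun_prop) (by fun_prop)

end Build

/-! ### Gates -/

section Gates

/-- The arguments of a gate, from its code. -/
def inputs (g : List ℕ) : List ℕ :=
  bif eqb (g.headD 0) 5 then g.tail.tail else bif ltb 1 (g.headD 0) then g.tail else []

/-- The contribution of a gate to the depth, from its code. -/
def weight (g : List ℕ) : ℕ :=
  bif eqb (g.headD 0) 5 then Nat.clog 2 ((inputs g).length + 1)
  else bif ltb 1 (g.headD 0) then 1 else 0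

/-- The value of a gate that is not an input, from its code and the values of its arguments; `d`
decides the oracle. -/
def gateValue (d : List Bool → Bool) (v : List Bool) (g : List ℕ) : Bool :=
  bif eqb (g.headD 0) 1 then eqb (g.getD 1 0) 1
  else bif eqb (g.headD 0) 2 then !v.getD (g.getD 1 0) false
  else bif eqb (g.headD 0) 3 then v.getD (g.getD 1 0) false && v.getD (g.getD 2 0) false
  else bif eqb (g.headD 0) 4 then v.getD (g.getD 1 0) false || v.getD (g.getD 2 0) false
  else d ((inputs g).map fun a => v.getD a false)

/-- The depths of the nodes, from the codes of the gates. -/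
def codeDepths (G : List (List ℕ)) : List ℕ :=
  build (fun d g => ((inputs g).map fun a => d.getD a 0).foldl max 0 + weight g) G

/-- Gates that are not evaluated locally: inputs, and oracle gates of depth more than `L`. -/
def isOpaque (L : ℕ) (g : List ℕ) : Bool :=
  eqb (g.headD 0) 0 || eqb (g.headD 0) 5 && ltb L (weight g)

/-- Whether the evaluation of gates of level `l` stops at the node `k`. The level of a node is its
depth divided by `L`. -/
def isLeaf (L : ℕ) (D : List ℕ) (l k : ℕ) (g : List ℕ) : Bool :=
  isOpaque L g || ltb (D.getD k 0 / L) l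

/-- For every node, the nodes at which its evaluation stops, if gates of level at least `l` are
expanded. -/
def leaves (L : ℕ) (D : List ℕ) (l : ℕ) (G : List (List ℕ)) : List (List ℕ) :=
  build (fun v g => bif isLeaf L D l v.length g then [v.length]
    else (inputs g).flatMap fun a => v.getD a []) G

/-- The values of the nodes, from the values `b` of the leaves `S`. -/
def expand (d : List Bool → Bool) (L : ℕ) (D : List ℕ) (l : ℕ) (G : List (List ℕ)) (S : List ℕ)
    (b : List Bool) : List Bool :=
  build (fun v g => bif isLeaf L D l v.length g then b.getD (S.idxOf v.length) false
    else gateValue d v g) G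

variable {γ : Type*} [Primcodable γ]

@[fun_prop]
theorem computable_inputs {f : γ → List ℕ} (hf : Computable f) :
    Computable fun a => inputs (f a) := by
  unfold inputs; fun_prop

@[fun_prop]
theorem computable_weight {f : γ → List ℕ} (hf : Computable f) :
    Computable fun a => weight (f a) := by
  unfold weight; fun_prop

theorem computable_gateValue {d : List Bool → Bool} (hd : Computable d) {v : γ → List Bool}
    {f : γ → List ℕ} (hv : Computable v) (hf : Computable f) :
    Computable fun a => gateValue d (v a) (f a) := by
  unfold gateValue; fun_prop

@[fun_prop]
theorem computable_codeDepths {f : γ → List (List ℕ)} (hf : Computable f) :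
    Computable fun a => codeDepths (f a) := by
  unfold codeDepths; fun_prop

@[fun_prop]
theorem computable_isOpaque {L : γ → ℕ} {f : γ → List ℕ} (hL : Computable L) (hf : Computable f) :
    Computable fun a => isOpaque (L a) (f a) := by
  unfold isOpaque; fun_prop

@[fun_prop]
theorem computable_isLeaf {L l k : γ → ℕ} {D f : γ → List ℕ} (hL : Computable L)
    (hD : Computable D) (hl : Computable l) (hk : Computable k) (hf : Computable f) :
    Computable fun a => isLeaf (L a) (D a) (l a) (k a) (f a) := by
  unfold isLeaf; fun_prop

@[fun_prop]
theorem computable_leaves {L l : γ → ℕ} {D : γ → List ℕ} {G : γ → List (List ℕ)}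
    (hL : Computable L) (hD : Computable D) (hl : Computable l) (hG : Computable G) :
    Computable fun a => leaves (L a) (D a) (l a) (G a) := by
  unfold leaves; fun_prop

theorem computable_expand {d : List Bool → Bool} (hd : Computable d) {L l : γ → ℕ}
    {D S : γ → List ℕ} {G : γ → List (List ℕ)} {b : γ → List Bool} (hL : Computable L)
    (hD : Computable D) (hl : Computable l) (hG : Computable G) (hS : Computable S)
    (hb : Computable b) :
    Computable fun a => expand d (L a) (D a) (l a) (G a) (S a) (b a) := by
  have h : Computable fun p : List Bool × List ℕ => gateValue d p.1 p.2 :=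
    computable_gateValue hd (by fun_prop) (by fun_prop)
  have h' : Computable fun p : γ × List Bool × List ℕ => gateValue d p.2.1 p.2.2 :=
    h.comp (by fun_prop : Computable fun p : γ × List Bool × List ℕ => (p.2.1, p.2.2))
  unfold expand
  fun_prop

theorem inputs_code (g : Gate) : inputs g.code = g.args := by
  cases g <;> simp [inputs, Gate.code, Gate.args, eqb, ltb]

theorem weight_code (g : Gate) : weight g.code = g.cost := by
  cases g <;> simp [weight, inputs, Gate.code, Gate.cost, eqb, ltb]

theorem gateValue_code {B : Language Bool} {d : List Bool → Bool}
    (hd : ∀ x, d x = true ↔ x ∈ B) (x v : List Bool) (g : Gate) (hg : ∀ i, g ≠ .input i) :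
    gateValue d v g.code = g.value B x v := by
  cases g with
  | input i => exact absurd rfl (hg i)
  | const b => cases b <;> rfl
  | oracle l =>
    rw [Bool.eq_iff_iff]
    simp [gateValue, inputs, Gate.code, Gate.value, hd, eqb]
  | _ => simp [gateValue, Gate.code, Gate.value, eqb]

theorem codeDepths_map_code (C : Circuit) : codeDepths (C.map Gate.code) = C.depths := by
  simp only [codeDepths, build, List.foldl_map, Circuit.depths, inputs_code, weight_code,
    List.foldl_eq_foldr]

theorem isOpaque_code {L : ℕ} {g : Gate} : isOpaque L g.code = true ↔
    (∃ i, g = .input i) ∨ (∃ l, g = .oracle l) ∧ L < g.cost := by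
  rw [isOpaque, weight_code]
  cases g <;> simp [Gate.code, eqb, ltb]

end Gates

/-! ### Values and depths of the nodes of a circuit -/

namespace Circuit

variable (B : Language Bool) (x : List Bool) (C : Circuit)

/-- The value of node `k`. -/
noncomputable def val (k : ℕ) : Bool := (C.values B x).getD k false

/-- The depth of node `k`. -/
def nodeDepth (k : ℕ) : ℕ := C.depths.getD k 0

variable {B x C} {n k : ℕ} {g : Gate}

theorem value_congr {v w : List Bool} (h : ∀ a ∈ g.args, v.getD a false = w.getD a false) :
    g.value B x v = g.value B x w := by
  cases g with
  | oracle l =>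
    simp only [Gate.value]
    rw [List.map_congr_left (l := l) h]
  | input i => rfl
  | const b => rfl
  | _ =>
    simp only [Gate.args, List.mem_cons, List.not_mem_nil, or_false, forall_eq_or_imp,
      forall_eq] at h
    simp only [Gate.value, h]

theorem val_eq (hC : C.WellFormed n) (hg : C[k]? = some g) :
    C.val B x k = g.value B x (C.values B x) := by
  have h₀ : C.val B x k = g.value B x ((C.values B x).take k) := getD_build hg false
  rw [h₀]
  exact value_congr fun a ha => getD_take ((hC.2 k g hg).1 a ha) _

theorem nodeDepth_add_cost_le (hC : C.WellFormed n) (hg : C[k]? = some g) {a : ℕ}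
    (ha : a ∈ g.args) : C.nodeDepth a + g.cost ≤ C.nodeDepth k := by
  have h₀ : C.nodeDepth k = (g.args.map fun a => (C.depths.take k).getD a 0).foldr max 0 + g.cost :=
    getD_build hg 0
  rw [h₀]
  refine Nat.add_le_add_right ?_ _
  refine List.le_max_of_le' 0 (List.mem_map.2 ⟨a, ha, rfl⟩) ?_
  rw [getD_take ((hC.2 k g hg).1 a ha)]
  rfl

theorem cost_le_nodeDepth (hg : C[k]? = some g) : g.cost ≤ C.nodeDepth k := by
  have h₀ : C.nodeDepth k = (g.args.map fun a => (C.depths.take k).getD a 0).foldr max 0 + g.cost :=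
    getD_build hg 0
  rw [h₀]
  exact Nat.le_add_left _ _

theorem nodeDepth_le (k : ℕ) : C.nodeDepth k ≤ C.depth := by
  rw [nodeDepth, List.getD_eq_getElem?_getD]
  rcases h : C.depths[k]? with _ | d
  · simp
  · exact List.le_max_of_le' 0 (List.mem_of_getElem? h) le_rfl

theorem length_values : (C.values B x).length = C.length := length_build _ _

theorem eval_eq (hC : C ≠ []) : C.eval B x = C.val B x (C.length - 1) := by
  have h : C.values B x ≠ [] := by
    rw [← List.length_pos_iff, length_values]
    exact List.length_pos_iff.2 hC
  rw [eval, val, List.getLastD_eq_getLast?, List.getLast?_eq_getElem?, length_values,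
    List.getD_eq_getElem?_getD]

theorem length_args_le_two_pow (g : Gate) : g.args.length ≤ 2 ^ g.cost := by
  cases g with
  | oracle l => exact (Nat.le_succ _).trans (Nat.le_pow_clog one_lt_two _)
  | _ => simp [Gate.args, Gate.cost]

end Circuit

/-! ### The evaluation of a circuit from the values of its leaves -/

namespace Circuit

variable {B : Language Bool} {x : List Bool} {C : Circuit} {n L l k : ℕ} {g : Gate}

/-- The nodes at which the evaluation of node `k` stops. -/
def leavesAt (C : Circuit) (L l k : ℕ) : List ℕ :=
  (leaves L C.depths l (C.map Gate.code)).getD k []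

theorem getElem?_map_code (hg : C[k]? = some g) : (C.map Gate.code)[k]? = some g.code := by
  rw [List.getElem?_map, hg]; rfl

theorem length_take_build {α β : Type*} {F : List β → α → β} {G : List α} {a : α}
    (h : G[k]? = some a) : ((build F G).take k).length = k := by
  obtain ⟨hk, -⟩ := List.getElem?_eq_some_iff.1 h
  rw [List.length_take, length_build, min_eq_left hk.le]

theorem leavesAt_of_isLeaf (hg : C[k]? = some g) (h : isLeaf L C.depths l k g.code = true) :
    C.leavesAt L l k = [k] := by
  rw [leavesAt, leaves, getD_build (getElem?_map_code hg),
    length_take_build (getElem?_map_code hg), h]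
  rfl

theorem leavesAt_of_not_isLeaf (hC : C.WellFormed n) (hg : C[k]? = some g)
    (h : isLeaf L C.depths l k g.code = false) :
    C.leavesAt L l k = g.args.flatMap (C.leavesAt L l) := by
  rw [leavesAt, leaves, getD_build (getElem?_map_code hg),
    length_take_build (getElem?_map_code hg), h, cond_false, inputs_code]
  refine List.flatMap_congr fun a ha => ?_
  rw [getD_take ((hC.2 k g hg).1 a ha)]
  rfl

theorem exists_gate (hC : C.WellFormed n) (hg : C[k]? = some g) {a : ℕ} (ha : a ∈ g.args) :
    ∃ h, C[a]? = some h := by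
  have h₁ := (hC.2 k g hg).1 a ha
  obtain ⟨h₂, -⟩ := List.getElem?_eq_some_iff.1 hg
  exact ⟨_, List.getElem?_eq_getElem (h₁.trans h₂)⟩

/-- The leaves of a node are among the node and its predecessors, and the evaluation stops there. -/
theorem of_mem_leavesAt (hC : C.WellFormed n) {j : ℕ} (hg : C[k]? = some g)
    (hj : j ∈ C.leavesAt L l k) : j ≤ k ∧ C.nodeDepth j ≤ C.nodeDepth k ∧
      ∃ h, C[j]? = some h ∧ isLeaf L C.depths l j h.code = true := by
  induction k using Nat.strong_induction_on generalizing g with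
  | _ k ih =>
    cases h : isLeaf L C.depths l k g.code
    · rw [leavesAt_of_not_isLeaf hC hg h, List.mem_flatMap] at hj
      obtain ⟨a, ha, hj⟩ := hj
      obtain ⟨g', hg'⟩ := exists_gate hC hg ha
      have hak := (hC.2 k g hg).1 a ha
      obtain ⟨h₁, h₂, h₃⟩ := ih a hak hg' hj
      exact ⟨h₁.trans hak.le,
        h₂.trans ((Nat.le_add_right _ _).trans (nodeDepth_add_cost_le hC hg ha)), h₃⟩
    · rw [leavesAt_of_isLeaf hg h, List.mem_singleton] at hj
      subst hj
      exact ⟨le_rfl, le_rfl, g, hg, h⟩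

/-- A gate that is expanded contributes its cost `c ≤ L` to the depth and has at most `2 ^ c`
arguments, and the expansion stops at the latest `L` below the lower end of the level. -/
theorem length_leavesAt_le (hC : C.WellFormed n) (hL : 1 ≤ L) (hg : C[k]? = some g) :
    (C.leavesAt L l k).length ≤ 2 ^ (C.nodeDepth k + L - l * L) := by
  induction k using Nat.strong_induction_on generalizing g with
  | _ k ih =>
    cases h : isLeaf L C.depths l k g.code
    · have hl : l * L ≤ C.nodeDepth k := by
        have : ¬ C.nodeDepth k / L < l := by
          intro hlt
          have : ltb (C.depths.getD k 0 / L) l = true := ltb_eq_true.2 hlt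
          rw [isLeaf, this, Bool.or_true] at h
          exact absurd h (by decide)
        exact (Nat.le_div_iff_mul_le hL).1 (not_lt.1 this)
      have hcost : g.cost ≤ L := by
        by_contra! hlt
        have h₁ : isOpaque L g.code = false := by
          rw [isLeaf, Bool.or_eq_false_iff] at h; exact h.1
        rw [← Bool.not_eq_true, isOpaque_code] at h₁
        refine h₁ ?_
        cases g with
        | input i => exact Or.inl ⟨i, rfl⟩
        | oracle m => exact Or.inr ⟨⟨m, rfl⟩, hlt⟩
        | _ => simp only [Gate.cost] at hlt; omega
      rw [leavesAt_of_not_isLeaf hC hg h, List.length_flatMap]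
      have hsum : ∀ a ∈ g.args, (C.leavesAt L l a).length ≤
          2 ^ (C.nodeDepth k + L - l * L - g.cost) := by
        intro a ha
        obtain ⟨g', hg'⟩ := exists_gate hC hg ha
        refine (ih a ((hC.2 k g hg).1 a ha) hg').trans (Nat.pow_le_pow_right two_pos ?_)
        have := nodeDepth_add_cost_le hC hg ha
        omega
      calc (g.args.map fun a => (C.leavesAt L l a).length).sum
          ≤ g.args.length * 2 ^ (C.nodeDepth k + L - l * L - g.cost) := by
            have := List.sum_le_card_nsmul (g.args.map fun a => (C.leavesAt L l a).length)
              (2 ^ (C.nodeDepth k + L - l * L - g.cost)) (by simpa using hsum)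
            simpa using this
        _ ≤ 2 ^ g.cost * 2 ^ (C.nodeDepth k + L - l * L - g.cost) :=
            Nat.mul_le_mul_right _ (length_args_le_two_pow g)
        _ = 2 ^ (C.nodeDepth k + L - l * L) := by
            rw [← pow_add]; congr 1; omega
    · rw [leavesAt_of_isLeaf hg h]
      exact Nat.one_le_two_pow

theorem not_isOpaque_input {i : ℕ} (h : isOpaque L g.code = false) : g ≠ .input i := by
  rintro rfl
  rw [isOpaque_code.2 (Or.inl ⟨i, rfl⟩)] at h
  exact absurd h (by decide)

/-- The value of a node is found from the values of any list of nodes that contains its leaves. -/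
theorem getD_expand {d : List Bool → Bool} (hd : ∀ x, d x = true ↔ x ∈ B) (hC : C.WellFormed n)
    {S : List ℕ} (hg : C[k]? = some g) (hS : ∀ j ∈ C.leavesAt L l k, j ∈ S) :
    (expand d L C.depths l (C.map Gate.code) S (S.map (C.val B x))).getD k false =
      C.val B x k := by
  induction k using Nat.strong_induction_on generalizing g with
  | _ k ih =>
    rw [expand, getD_build (getElem?_map_code hg), length_take_build (getElem?_map_code hg)]
    cases h : isLeaf L C.depths l k g.code
    · rw [leavesAt_of_not_isLeaf hC hg h] at hS
      have h₁ : isOpaque L g.code = false := by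
        rw [isLeaf, Bool.or_eq_false_iff] at h; exact h.1
      rw [cond_false, gateValue_code hd x _ g fun i => not_isOpaque_input h₁, val_eq hC hg]
      refine value_congr fun a ha => ?_
      obtain ⟨g', hg'⟩ := exists_gate hC hg ha
      have hak := (hC.2 k g hg).1 a ha
      rw [getD_take hak]
      exact ih a hak hg' fun j hj => hS j (List.mem_flatMap.2 ⟨a, ha, hj⟩)
    · rw [leavesAt_of_isLeaf hg h] at hS
      have hk : k ∈ S := hS k (List.mem_singleton_self k)
      have hlt : S.idxOf k < S.length := List.idxOf_lt_length_iff.2 hk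
      simp [List.getD_eq_getElem?_getD, hlt]

end Circuit

/-! ### The network of a circuit family -/

/-- The data of the network that evaluates a family of circuits: the codes of the gates, a decision
procedure for the oracle, and the parameter `q` of the memory bound. Nodes are grouped in levels by
their depth divided by `cutoff N`, which is about `log N / q`, so that there are boundedly many
levels. Cell `2 * k + 2` is in charge of node `k`, and cell `0` of the output. A gate that is not
opaque is evaluated from its leaves, which are opaque or of a lower level, in one step; oracle
gates of large depth are queries. -/
structure Layering where
  codes : ℕ → List (List ℕ)
  dec : List Bool → Bool
  q : ℕ
  codes_computable : Computable codes
  dec_computable : Computable dec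

attribute [fun_prop] Layering.codes_computable Layering.dec_computable

namespace Layering

variable (Λ : Layering)

/-- The depth of a level. -/
def cutoff (N : ℕ) : ℕ := Nat.log 2 N / Λ.q + 1

/-- The code of node `k`. -/
def gate (N k : ℕ) : List ℕ := (Λ.codes N).getD k []

/-- The level of node `k`. -/
def level (N k : ℕ) : ℕ := (codeDepths (Λ.codes N)).getD k 0 / Λ.cutoff N

/-- The leaves of node `k`. -/
def leafList (N k : ℕ) : List ℕ :=
  (leaves (Λ.cutoff N) (codeDepths (Λ.codes N)) (Λ.level N k) (Λ.codes N)).getD k []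

/-- The cells that the cell of node `k` reads. -/
def nodeArgs (N k : ℕ) : List ℕ :=
  bif ltb k (Λ.codes N).length then
    bif eqb ((Λ.gate N k).headD 0) 0 then [2 * (Λ.gate N k).getD 1 0 + 1]
    else bif isOpaque (Λ.cutoff N) (Λ.gate N k) then
      (inputs (Λ.gate N k)).map fun a => 2 * (a + 1)
    else (Λ.leafList N k).map fun a => 2 * (a + 1)
  else []

/-- The cells that cell `u` reads. Input cells read themselves. -/
def args (N u : ℕ) : List ℕ :=
  bif eqb (u % 2) 1 then bif ltb (u / 2) N then [u] else []
  else bif eqb u 0 then [2 * (Λ.codes N).length]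
  else Λ.nodeArgs N (u / 2 - 1)

/-- Whether cell `u` queries the oracle. -/
def query (N u : ℕ) : Bool :=
  eqb (u % 2) 0 && ltb 0 u && ltb (u / 2 - 1) (Λ.codes N).length &&
    isOpaque (Λ.cutoff N) (Λ.gate N (u / 2 - 1)) && !eqb ((Λ.gate N (u / 2 - 1)).headD 0) 0

/-- The new value of cell `u`, from the values `b` that it reads. -/
def loc (N u : ℕ) (b : List Bool) : Bool :=
  bif eqb (u % 2) 1 || eqb u 0 || eqb ((Λ.gate N (u / 2 - 1)).headD 0) 0 then b.headD false
  else (expand Λ.dec (Λ.cutoff N) (codeDepths (Λ.codes N)) (Λ.level N (u / 2 - 1)) (Λ.codes N)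
    (Λ.leafList N (u / 2 - 1)) b).getD (u / 2 - 1) false

section Computability

variable {γ : Type*} [Primcodable γ]

@[fun_prop]
theorem computable_cutoff {f : γ → ℕ} (hf : Computable f) :
    Computable fun a => Λ.cutoff (f a) := by
  unfold cutoff; fun_prop

@[fun_prop]
theorem computable_gate {f g : γ → ℕ} (hf : Computable f) (hg : Computable g) :
    Computable fun a => Λ.gate (f a) (g a) := by
  unfold gate; fun_prop

@[fun_prop]
theorem computable_level {f g : γ → ℕ} (hf : Computable f) (hg : Computable g) :
    Computable fun a => Λ.level (f a) (g a) := by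
  unfold level; fun_prop

@[fun_prop]
theorem computable_leafList {f g : γ → ℕ} (hf : Computable f) (hg : Computable g) :
    Computable fun a => Λ.leafList (f a) (g a) := by
  unfold leafList; fun_prop

@[fun_prop]
theorem computable_nodeArgs {f g : γ → ℕ} (hf : Computable f) (hg : Computable g) :
    Computable fun a => Λ.nodeArgs (f a) (g a) := by
  unfold nodeArgs; fun_prop

end Computability

/-- The network that evaluates a circuit family. -/
def network : Network where
  args p := Λ.args p.1 p.2
  query p := Λ.query p.1 p.2
  loc p := Λ.loc p.1 p.2.1 p.2.2
  args_computable := by unfold args; fun_prop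
  query_computable := by unfold query; fun_prop
  loc_computable := by
    unfold loc
    refine computable_cond (by fun_prop) (by fun_prop) (computable_getD ?_ ?_ ?_)
    · refine computable_expand Λ.dec_computable ?_ ?_ ?_ ?_ ?_ ?_ <;> fun_prop
    · fun_prop
    · fun_prop

end Layering

/-! ### Correctness and size of the network of a circuit family -/

namespace Layering

/-- `Λ` describes the circuit family `C` with oracle `B`. -/
structure Describes (Λ : Layering) (C : ℕ → Circuit) (B : Language Bool) : Prop where
  codes_eq : ∀ N, Λ.codes N = (C N).map Gate.code
  wellFormed : ∀ N, (C N).WellFormed N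
  dec_iff : ∀ x, Λ.dec x = true ↔ x ∈ B

variable {Λ : Layering} {C : ℕ → Circuit} {B : Language Bool} {N k : ℕ} {g : Gate}

theorem one_le_cutoff : 1 ≤ Λ.cutoff N := Nat.le_add_left _ _

theorem board_succ_of_not_query {x : List Bool} {u : ℕ} (t : ℕ)
    (hq : Λ.query x.length u = false) : Λ.network.board B x (t + 1) u =
      Λ.loc x.length u ((Λ.args x.length u).map (Λ.network.board B x t)) := by
  rw [Network.board_succ, Network.update,
    show Λ.network.query (x.length, u) = false from hq, cond_false]
  rfl

open Classical in
theorem board_succ_of_query {x : List Bool} {u : ℕ} (t : ℕ)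
    (hq : Λ.query x.length u = true) : Λ.network.board B x (t + 1) u =
      decide ((Λ.args x.length u).map (Λ.network.board B x t) ∈ B) := by
  rw [Network.board_succ, Network.update,
    show Λ.network.query (x.length, u) = true from hq, cond_true]
  rfl

theorem args_odd (N i : ℕ) : Λ.args N (2 * i + 1) = bif ltb i N then [2 * i + 1] else [] := by
  have h₁ : (2 * i + 1) % 2 = 1 := by omega
  have h₂ : (2 * i + 1) / 2 = i := by omega
  simp only [args, h₁, h₂, show eqb (1 : ℕ) 1 = true from rfl, cond_true]

theorem query_odd (N i : ℕ) : Λ.query N (2 * i + 1) = false := by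
  have h₁ : (2 * i + 1) % 2 = 1 := by omega
  simp only [query, h₁, show eqb (1 : ℕ) 0 = false from rfl, Bool.false_and]

theorem loc_odd (N i : ℕ) (b : List Bool) : Λ.loc N (2 * i + 1) b = b.headD false := by
  have h₁ : (2 * i + 1) % 2 = 1 := by omega
  simp only [loc, h₁, show eqb (1 : ℕ) 1 = true from rfl, Bool.true_or, cond_true]

theorem args_node (N k : ℕ) : Λ.args N (2 * (k + 1)) = Λ.nodeArgs N k := by
  have h₁ : 2 * (k + 1) % 2 = 0 := by omega
  have h₂ : 2 * (k + 1) / 2 - 1 = k := by omega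
  have h₄ : eqb (2 * (k + 1)) 0 = false := by simp [eqb]
  simp only [args, h₁, h₂, h₄, show eqb (0 : ℕ) 1 = false from rfl, cond_false]

theorem query_node (N k : ℕ) : Λ.query N (2 * (k + 1)) =
    (ltb k (Λ.codes N).length && isOpaque (Λ.cutoff N) (Λ.gate N k) &&
      !eqb ((Λ.gate N k).headD 0) 0) := by
  have h₁ : 2 * (k + 1) % 2 = 0 := by omega
  have h₂ : 2 * (k + 1) / 2 - 1 = k := by omega
  have h₃ : ltb 0 (2 * (k + 1)) = true := ltb_eq_true.2 (by omega)
  simp only [query, h₁, h₂, h₃, show eqb (0 : ℕ) 0 = true from rfl, Bool.true_and]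

theorem loc_node (N k : ℕ) (b : List Bool) : Λ.loc N (2 * (k + 1)) b =
    bif eqb ((Λ.gate N k).headD 0) 0 then b.headD false
    else (expand Λ.dec (Λ.cutoff N) (codeDepths (Λ.codes N)) (Λ.level N k) (Λ.codes N)
      (Λ.leafList N k) b).getD k false := by
  have h₁ : 2 * (k + 1) % 2 = 0 := by omega
  have h₂ : 2 * (k + 1) / 2 - 1 = k := by omega
  have h₄ : eqb (2 * (k + 1)) 0 = false := by simp [eqb]
  simp only [loc, h₁, h₂, h₄, show eqb (0 : ℕ) 1 = false from rfl, Bool.false_or]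

namespace Describes

variable (h : Λ.Describes C B)
include h

theorem level_eq (N k : ℕ) : Λ.level N k = (C N).nodeDepth k / Λ.cutoff N := by
  rw [level, h.codes_eq, codeDepths_map_code]
  rfl

theorem leafList_eq (N k : ℕ) :
    Λ.leafList N k = (C N).leavesAt (Λ.cutoff N) (Λ.level N k) k := by
  rw [leafList, h.codes_eq, codeDepths_map_code]
  rfl

theorem gate_eq (hg : (C N)[k]? = some g) : Λ.gate N k = g.code := by
  rw [gate, h.codes_eq, List.getD_eq_getElem?_getD, Circuit.getElem?_map_code hg]
  rfl

theorem length_codes (N : ℕ) : (Λ.codes N).length = (C N).length := by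
  rw [h.codes_eq, List.length_map]

theorem ltb_of_getElem? (hg : (C N)[k]? = some g) : ltb k (Λ.codes N).length = true := by
  rw [ltb_eq_true, h.length_codes]
  exact (List.getElem?_eq_some_iff.1 hg).1

theorem isLeaf_self_eq (N k : ℕ) (c : List ℕ) :
    isLeaf (Λ.cutoff N) (C N).depths (Λ.level N k) k c = isOpaque (Λ.cutoff N) c := by
  have : ltb ((C N).depths.getD k 0 / Λ.cutoff N) (Λ.level N k) = false := by
    rw [← Bool.not_eq_true, ltb_eq_true, h.level_eq]
    exact lt_irrefl _
  rw [isLeaf, this, Bool.or_false]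

theorem input_cell {i : ℕ} (hg : (C N)[k]? = some (.input i)) :
    Λ.query N (2 * (k + 1)) = false ∧ Λ.args N (2 * (k + 1)) = [2 * i + 1] ∧
      ∀ b, Λ.loc N (2 * (k + 1)) b = b.headD false := by
  have h₁ : eqb ((Gate.input i).code.headD 0) 0 = true := rfl
  rw [query_node, args_node, nodeArgs, h.gate_eq hg, h.ltb_of_getElem? hg, h₁]
  refine ⟨by simp, rfl, fun b => ?_⟩
  rw [loc_node, h.gate_eq hg, h₁, cond_true]

theorem query_cell {l : List ℕ} (hg : (C N)[k]? = some (.oracle l))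
    (hc : Λ.cutoff N < (Gate.oracle l).cost) :
    Λ.query N (2 * (k + 1)) = true ∧ Λ.args N (2 * (k + 1)) = l.map fun a => 2 * (a + 1) := by
  have h₁ : eqb ((Gate.oracle l).code.headD 0) 0 = false := rfl
  have h₂ : isOpaque (Λ.cutoff N) (Gate.oracle l).code = true :=
    isOpaque_code.2 (Or.inr ⟨⟨l, rfl⟩, hc⟩)
  rw [query_node, args_node, nodeArgs, h.gate_eq hg, h.ltb_of_getElem? hg, h₁, h₂]
  exact ⟨rfl, by simp only [cond_true, cond_false, inputs_code, Gate.args]⟩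

theorem local_cell (hg : (C N)[k]? = some g) (hop : isOpaque (Λ.cutoff N) g.code = false) :
    Λ.query N (2 * (k + 1)) = false ∧
      (Λ.args N (2 * (k + 1)) = (Λ.leafList N k).map fun a => 2 * (a + 1)) ∧
      ∀ b, Λ.loc N (2 * (k + 1)) b = (expand Λ.dec (Λ.cutoff N) (C N).depths (Λ.level N k)
        ((C N).map Gate.code) (Λ.leafList N k) b).getD k false := by
  have h₁ : eqb (g.code.headD 0) 0 = false := by
    rw [isOpaque, Bool.or_eq_false_iff] at hop
    exact hop.1
  rw [query_node, args_node, nodeArgs, h.gate_eq hg, h.ltb_of_getElem? hg, h₁, hop]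
  refine ⟨rfl, rfl, fun b => ?_⟩
  rw [loc_node, h.gate_eq hg, h₁, cond_false, h.codes_eq, codeDepths_map_code]

omit h in
theorem board_input (x : List Bool) (t : ℕ) {i : ℕ} (hi : i < x.length) :
    Λ.network.board B x t (2 * i + 1) = x.getD i false := by
  induction t with
  | zero =>
    have h₁ : (2 * i + 1) % 2 = 1 := by omega
    have h₂ : (2 * i + 1) / 2 = i := by omega
    change Network.initial x (2 * i + 1) = _
    rw [Network.initial, h₁, h₂]
    rfl
  | succ t ih =>
    rw [board_succ_of_not_query t (query_odd _ _), loc_odd, args_odd, ltb_eq_true.2 hi, cond_true]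
    exact ih

/-- A node of level `l` has its value from step `2 * l + 1` on if it is opaque, and from step
`2 * l + 2` on in any case. -/
theorem board_node (x : List Bool) {k : ℕ} {g : Gate} (hg : (C x.length)[k]? = some g) {t : ℕ}
    (ht : 2 * Λ.level x.length k + 1 ≤ t)
    (ht' : isOpaque (Λ.cutoff x.length) g.code = false → 2 * Λ.level x.length k + 2 ≤ t) :
    Λ.network.board B x t (2 * (k + 1)) = (C x.length).val B x k := by
  have hC := h.wellFormed x.length
  induction k using Nat.strong_induction_on generalizing g t with
  | _ k ih =>
    obtain ⟨t, rfl⟩ := Nat.exists_eq_add_of_le' (show 1 ≤ t by omega)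
    cases hop : isOpaque (Λ.cutoff x.length) g.code
    · -- the leaves of a gate that is evaluated locally are opaque or have a lower level
      obtain ⟨h₁, h₂, h₃⟩ := h.local_cell hg hop
      have hnl := (h.isLeaf_self_eq x.length k g.code).trans hop
      have hval : (Λ.leafList x.length k).map
          (Λ.network.board B x t ∘ fun a => 2 * (a + 1)) =
          (Λ.leafList x.length k).map ((C x.length).val B x) := by
        refine List.map_congr_left fun j hj => ?_
        rw [h.leafList_eq] at hj
        obtain ⟨hjk, hd, g', hg', hleaf⟩ := Circuit.of_mem_leavesAt hC hg hj
        have hne : j ≠ k := by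
          rintro rfl
          rw [hg] at hg'
          obtain rfl := Option.some.inj hg'
          rw [hnl] at hleaf
          exact absurd hleaf (by decide)
        have ht₂ := ht' hop
        have hle : Λ.level x.length j ≤ Λ.level x.length k := by
          rw [h.level_eq, h.level_eq]
          exact Nat.div_le_div_right hd
        refine ih j (lt_of_le_of_ne hjk hne) hg' (by omega) fun hop' => ?_
        rw [isLeaf, hop', Bool.false_or, ltb_eq_true] at hleaf
        have : Λ.level x.length j < Λ.level x.length k := by
          rw [h.level_eq x.length j]; exact hleaf
        omega
      rw [board_succ_of_not_query t h₁, h₂, h₃, List.map_map, hval]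
      refine Circuit.getD_expand h.dec_iff hC hg fun j hj => ?_
      rw [h.leafList_eq]
      exact hj
    · rcases isOpaque_code.1 hop with ⟨i, rfl⟩ | ⟨⟨l, rfl⟩, hcost⟩
      · obtain ⟨h₁, h₂, h₃⟩ := h.input_cell hg
        rw [board_succ_of_not_query t h₁, h₂, h₃, Circuit.val_eq hC hg]
        exact board_input x t ((hC.2 k _ hg).2 i rfl)
      · -- the arguments of a query have a lower level
        obtain ⟨h₁, h₂⟩ := h.query_cell hg hcost
        have hval : l.map (Λ.network.board B x t ∘ fun a => 2 * (a + 1)) =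
            l.map fun a => ((C x.length).values B x).getD a false := by
          refine List.map_congr_left fun a ha => ?_
          obtain ⟨g', hg'⟩ := Circuit.exists_gate hC hg (a := a) ha
          have hd := Circuit.nodeDepth_add_cost_le hC hg (a := a) ha
          have hlt : Λ.level x.length a < Λ.level x.length k := by
            rw [h.level_eq, h.level_eq, ← Nat.succ_le_iff, Nat.succ_eq_add_one,
              ← Nat.add_div_right _ one_le_cutoff]
            exact Nat.div_le_div_right (by omega)
          exact ih a ((hC.2 k _ hg).1 a ha) hg' (by omega) fun _ => by omega
        rw [board_succ_of_query t h₁, h₂, Circuit.val_eq hC hg, List.map_map, hval]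
        rfl

/-- Cell `0` has the output of the circuit one step after all nodes have their values. -/
theorem board_output (x : List Bool) {l : ℕ}
    (hl : ∀ k, Λ.level x.length k ≤ l) :
    Λ.network.board B x (2 * l + 3) 0 = (C x.length).eval B x := by
  have hC := (h.wellFormed x.length).1
  have hpos := List.length_pos_iff.2 hC
  have hg : (C x.length)[(C x.length).length - 1]? = some (C x.length)[(C x.length).length - 1] :=
    List.getElem?_eq_getElem (by omega)
  have h₁ := hl ((C x.length).length - 1)
  have := h.board_node x hg (t := 2 * l + 2) (by omega) fun _ => by omega
  rw [Nat.sub_add_cancel hpos] at this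
  have h₂ : Λ.query x.length 0 = false := rfl
  have h₃ : Λ.args x.length 0 = [2 * (Λ.codes x.length).length] := rfl
  rw [Circuit.eval_eq hC, ← this, board_succ_of_not_query _ h₂, h₃, h.length_codes]
  rfl

/-- A node of level `l` has depth less than `(l + 1) * cutoff`, so that the bound on the number of
its leaves is `2 ^ (2 * cutoff)`. -/
theorem length_leafList_le (hg : (C N)[k]? = some g) :
    (Λ.leafList N k).length ≤ root Λ.q N ^ 2 := by
  rw [h.leafList_eq]
  refine (Circuit.length_leavesAt_le (h.wellFormed N) one_le_cutoff hg).trans ?_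
  rw [root, ← pow_mul]
  refine Nat.pow_le_pow_right two_pos ?_
  have h₁ := Nat.div_add_mod ((C N).nodeDepth k) (Λ.cutoff N)
  have h₂ := Nat.mod_lt ((C N).nodeDepth k) (one_le_cutoff (Λ := Λ) (N := N))
  rw [← h.level_eq, mul_comm] at h₁
  have h₃ : Λ.cutoff N = Nat.log 2 N / Λ.q + 1 := rfl
  omega

/-- The cells that read anything are the output cell, the cells of the inputs, and the cells of
the nodes. -/
theorem args_cases (N u : ℕ) :
    Λ.args N u = [] ∧ Λ.query N u = false ∨
    (∃ i < N, u = 2 * i + 1 ∧ Λ.args N u = [u] ∧ Λ.query N u = false) ∨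
    (u = 0 ∧ Λ.args N u = [2 * (C N).length] ∧ Λ.query N u = false) ∨
    ∃ k < (C N).length, u = 2 * (k + 1) ∧
      ((∃ i < N, Λ.args N u = [2 * i + 1] ∧ Λ.query N u = false) ∨
        (∃ l, (C N)[k]? = some (.oracle l) ∧ Λ.cutoff N < (Gate.oracle l).cost ∧
          Λ.args N u = l.map (fun a => 2 * (a + 1)) ∧ Λ.query N u = true) ∨
        (∃ g, (C N)[k]? = some g ∧ Λ.args N u = (Λ.leafList N k).map (fun a => 2 * (a + 1)) ∧
          Λ.query N u = false)) := by
  rcases Nat.even_or_odd' u with ⟨k, rfl | rfl⟩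
  · rcases k with _ | k
    · refine Or.inr (Or.inr (Or.inl ⟨rfl, ?_, rfl⟩))
      rw [← h.length_codes]
      rfl
    · rcases lt_or_ge k (C N).length with hk | hk
      · refine Or.inr (Or.inr (Or.inr ⟨k, hk, rfl, ?_⟩))
        have hg : (C N)[k]? = some (C N)[k] := List.getElem?_eq_getElem hk
        cases hop : isOpaque (Λ.cutoff N) (C N)[k].code
        · obtain ⟨h₁, h₂, -⟩ := h.local_cell hg hop
          exact Or.inr (Or.inr ⟨_, hg, h₂, h₁⟩)
        · rcases isOpaque_code.1 hop with ⟨i, hi⟩ | ⟨⟨l, hl⟩, hcost⟩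
          · rw [hi] at hg
            obtain ⟨h₁, h₂, -⟩ := h.input_cell hg
            exact Or.inl ⟨i, ((h.wellFormed N).2 k _ hg).2 i rfl, h₂, h₁⟩
          · rw [hl] at hg hcost
            obtain ⟨h₁, h₂⟩ := h.query_cell hg hcost
            exact Or.inr (Or.inl ⟨l, hg, hcost, h₂, h₁⟩)
      · have hk' : ltb k (Λ.codes N).length = false := by
          rw [← Bool.not_eq_true, ltb_eq_true, h.length_codes]
          omega
        rw [args_node, query_node, nodeArgs, hk']
        exact Or.inl ⟨rfl, rfl⟩
  · rw [args_odd, query_odd]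
    cases hi : ltb k N
    · exact Or.inl ⟨rfl, rfl⟩
    · exact Or.inr (Or.inl ⟨k, ltb_eq_true.1 hi, rfl, rfl, rfl⟩)

end Describes

end Layering

/-! ### Reductions -/

/-- A bound for large `n` holds for all `n ≥ 1`, with another constant, if the bounding function is
positive there. -/
theorem IsBigO.exists_nat_bound {u v : ℕ → ℝ} (h : u =O[atTop] v) (hv : ∀ n, 1 ≤ n → 0 < v n) :
    ∃ K : ℕ, ∀ n, 1 ≤ n → u n ≤ K * v n := by
  have h' : u =O[atTop] fun n => if n = 0 then 1 else v n :=
    h.congr' EventuallyEq.rfl ((eventually_ge_atTop 1).mono fun n hn => by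
      simp [Nat.one_le_iff_ne_zero.1 hn])
  obtain ⟨c, hc⟩ := (isBigO_nat_atTop_iff fun n hn => by
    rcases Nat.eq_zero_or_pos n with rfl | h₀
    · simp at hn
    · rw [if_neg h₀.ne'] at hn
      exact absurd hn (hv n h₀).ne').1 h'
  refine ⟨⌈c⌉₊, fun n hn => (le_abs_self _).trans ((hc n).trans ?_)⟩
  rw [if_neg (Nat.one_le_iff_ne_zero.1 hn), Real.norm_of_nonneg (hv n hn).le]
  exact mul_le_mul_of_nonneg_right (Nat.le_ceil c) (hv n hn).le

theorem le_polyMax (f : ℕ → ℝ) {c N m : ℕ} (h : m ≤ (N + 2) ^ c) : f m ≤ polyMax f c N :=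
  Finset.le_sup' f (Finset.mem_range.2 (Nat.lt_succ_of_le h))

theorem MPCSolvable.mono {A : Language Bool} {f g : ℕ → ℝ} (h : MPCSolvable f A)
    (hfg : f =O[atTop] g) : MPCSolvable g A := by
  intro ε h₀ h₁
  obtain ⟨M, hM, hr, hM'⟩ := h ε h₀ h₁
  exact ⟨M, hM, hr.trans hfg, hM'⟩

/-- The maximal number of rounds for inputs of length at most `m`. -/
def MPCAlgorithm.maxRounds (M : MPCAlgorithm) (m : ℕ) : ℕ :=
  ((List.range (m + 1)).map M.rounds).foldl max 0

theorem MPCAlgorithm.computable_maxRounds (M : MPCAlgorithm) : Computable M.maxRounds := by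
  unfold maxRounds; fun_prop

theorem MPCAlgorithm.rounds_le_maxRounds (M : MPCAlgorithm) {r m : ℕ} (h : r ≤ m) :
    M.rounds r ≤ M.maxRounds m := by
  rw [maxRounds, List.foldl_eq_foldr]
  exact List.le_max_of_le' 0 (List.mem_map.2 ⟨r, List.mem_range.2 (Nat.lt_succ_of_le h), rfl⟩)
    le_rfl

theorem MPCAlgorithm.maxRounds_le (M : MPCAlgorithm) {m b : ℕ} (h : ∀ r ≤ m, M.rounds r ≤ b) :
    M.maxRounds m ≤ b := by
  rw [maxRounds, List.foldl_eq_foldr]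
  refine List.max_le_of_forall_le _ _ fun a ha => ?_
  obtain ⟨r, hr, rfl⟩ := List.mem_map.1 ha
  exact h r (Nat.lt_succ_iff.1 (List.mem_range.1 hr))

/-- An algorithm for an oracle yields one for every language that is `NC¹` reducible to it. The
exponent `c` bounds the fan-in of the oracle gates, so it does not depend on `ε`. The oracle
algorithm does: it is chosen with a memory of `O(r ^ (1 / p))` words for a query of length `r`,
where `p` is so large that this is `O(N ^ (1 / q))`. -/
theorem mpcSolvable_of_nc1Reducible {A B : Language Bool} {f : ℕ → ℝ} (hf : ∀ N, 0 < f N)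
    (hAB : NC1Reducible A B) (hB : MPCSolvable f B) : ∃ c : ℕ, MPCSolvable (polyMax f c) A := by
  obtain ⟨C, hdesc, ⟨c, hdepth⟩, hwf, heval⟩ := hAB
  have hcodes := computable_codes hdesc
  obtain ⟨⟨c', hc'⟩, -⟩ := hdesc
  have hsize : PolyBounded fun N => (C N).length :=
    ⟨c', fun N => (C N).length_le_length_description.trans (hc' N)⟩
  have hfan : PolyBounded fun N => 2 ^ (c * (Nat.log 2 N + 1)) := by
    refine ((PolyBounded.two_pow_log.mul (.const 2)).pow c).mono fun N => ?_
    rw [← pow_succ, ← pow_mul, mul_comm]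
  obtain ⟨e, he⟩ := id hfan
  refine ⟨e, fun ε hε₀ hε₁ => ?_⟩
  obtain ⟨q, hq⟩ := exists_nat_gt (2 / (1 - ε))
  have hε₂ : 0 < 1 - ε := by linarith
  have hq₀ : (0 : ℝ) < q := lt_trans (by positivity) hq
  have hq₁ : 1 ≤ q := by exact_mod_cast hq₀
  have hqε : 2 / (q : ℝ) ≤ 1 - ε := by
    rw [div_lt_iff₀ hε₂] at hq
    rw [div_le_iff₀ hq₀]
    linarith
  set p : ℕ := (c + 2) * q with hp
  have hp₂ : 2 ≤ p := by nlinarith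
  have hp₂' : (2 : ℝ) ≤ p := by exact_mod_cast hp₂
  have hpinv : (p : ℝ)⁻¹ < 1 := inv_lt_one_of_one_lt₀ (by linarith)
  obtain ⟨M, hM, hMr, hMm, -, γ, hγ, hMt⟩ := hB (1 - (p : ℝ)⁻¹) (by linarith)
    (by linarith [inv_pos.2 (show (0 : ℝ) < p by linarith)])
  rw [sub_sub_cancel] at hMm
  obtain ⟨κ, hκ⟩ := hM.exists_decidesWith
  obtain ⟨d, hd, hdB⟩ := hM.exists_computable
  have hrpow : ∀ (s : ℝ) (n : ℕ), 1 ≤ n → 0 < (n : ℝ) ^ s := fun s n hn =>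
    Real.rpow_pos_of_pos (by exact_mod_cast hn) s
  obtain ⟨K, hK⟩ := IsBigO.exists_nat_bound hMm (hrpow _)
  obtain ⟨K', hK'⟩ := IsBigO.exists_nat_bound hMt (hrpow _)
  obtain ⟨K'', hK''⟩ := (isBigO_nat_atTop_iff fun n hn => absurd hn (hf n).ne').1 hMr
  obtain ⟨γ', hγ'⟩ := exists_nat_ge (1 + γ)
  let Λ : Layering := ⟨fun N => (C N).map Gate.code, d, q, hcodes, hd⟩
  have h : Λ.Describes C B := ⟨fun _ => rfl, hwf, hdB⟩
  -- the fan-in `r` of a query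
  have hfanin : ∀ {N k : ℕ} {l : List ℕ}, (C N)[k]? = some (.oracle l) →
      l.length ≤ 2 ^ (c * (Nat.log 2 N + 1)) := fun {N k l} hg =>
    (Circuit.length_args_le_two_pow (.oracle l)).trans (Nat.pow_le_pow_right two_pos
      ((Circuit.cost_le_nodeDepth hg).trans ((Circuit.nodeDepth_le k).trans (hdepth N))))
  have hpos : ∀ {N : ℕ} {l : List ℕ}, Λ.cutoff N < (Gate.oracle l).cost → 1 ≤ l.length := by
    intro N l hl
    by_contra! h₀
    rw [Nat.lt_one_iff] at h₀
    simp [Gate.cost, h₀] at hl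
  have hfanroot : ∀ N, 2 ^ (c * (Nat.log 2 N + 1)) ≤ root q N ^ p := by
    intro N
    rw [root, ← pow_mul]
    refine Nat.pow_le_pow_right two_pos ?_
    calc c * (Nat.log 2 N + 1) ≤ (c + 2) * (q * (Nat.log 2 N / q + 1)) :=
          Nat.mul_le_mul (by omega) (log_lt_mul hq₁ N)
      _ = (Nat.log 2 N / q + 1) * p := by rw [hp]; ring
  have hmem : ∀ N r, 1 ≤ r → r ≤ 2 ^ (c * (Nat.log 2 N + 1)) → M.memory r ≤ K * root q N ^ 2 := by
    intro N r hr₁ hr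
    have h₁ : (r : ℝ) ^ (p : ℝ)⁻¹ ≤ root q N := by
      rw [← Real.pow_rpow_inv_natCast (Nat.cast_nonneg (root q N)) (show p ≠ 0 by omega)]
      refine Real.rpow_le_rpow (Nat.cast_nonneg r) ?_ (by positivity)
      exact_mod_cast hr.trans (hfanroot N)
    have h₂ : (M.memory r : ℝ) ≤ K * root q N :=
      (hK r hr₁).trans (mul_le_mul_of_nonneg_left h₁ (Nat.cast_nonneg K))
    have h₃ : M.memory r ≤ K * root q N := by exact_mod_cast h₂
    exact h₃.trans (Nat.mul_le_mul_left _ (Nat.le_self_pow two_ne_zero _))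
  have hmach : ∀ N r, 1 ≤ r → r ≤ 2 ^ (c * (Nat.log 2 N + 1)) →
      M.machines r ≤ K' * (2 ^ (c * (Nat.log 2 N + 1))) ^ γ' := by
    intro N r hr₁ hr
    have h₀ : 1 ≤ M.memory r := by
      by_contra! h₀
      have := (hκ.1 r).2
      rw [Nat.lt_one_iff.1 h₀, mul_zero] at this
      omega
    have h₁ : (M.totalMemory r : ℝ) ≤ K' * (r : ℝ) ^ γ' := by
      refine (hK' r hr₁).trans (mul_le_mul_of_nonneg_left ?_ (Nat.cast_nonneg _))
      rw [← Real.rpow_natCast]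
      exact Real.rpow_le_rpow_of_exponent_le (by exact_mod_cast hr₁) hγ'
    have h₂ : M.totalMemory r ≤ K' * r ^ γ' := by exact_mod_cast h₁
    calc M.machines r ≤ M.totalMemory r := Nat.le_mul_of_pos_right _ h₀
      _ ≤ K' * r ^ γ' := h₂
      _ ≤ _ := Nat.mul_le_mul_left _ (Nat.pow_le_pow_left hr _)
  obtain ⟨z, hz⟩ : PolyBounded fun N => (2 * (C N).length + 2 * N + 3) +
      2 ^ (c * (Nat.log 2 N + 1)) + root q N ^ 2 + K' * (2 ^ (c * (Nat.log 2 N + 1))) ^ γ' :=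
    (((((PolyBounded.const 2).mul hsize).add ((PolyBounded.const 2).mul .id)).add (.const 3)).add
      hfan).add ((PolyBounded.root q).pow 2) |>.add ((PolyBounded.const K').mul (hfan.pow γ'))
  beta_reduce at hz
  have hfanpos : ∀ N, 0 < 2 ^ (c * (Nat.log 2 N + 1)) := fun N => Nat.two_pow_pos _
  have hlevel : ∀ N k, Λ.level N k ≤ c * q := by
    intro N k
    rw [h.level_eq]
    refine Nat.div_le_of_le_mul ?_
    calc (C N).nodeDepth k ≤ c * (Nat.log 2 N + 1) := (Circuit.nodeDepth_le k).trans (hdepth N)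
      _ ≤ c * (q * (Nat.log 2 N / q + 1)) := Nat.mul_le_mul_left _ (log_lt_mul hq₁ N)
      _ = Λ.cutoff N * (c * q) := by rw [show Λ.cutoff N = Nat.log 2 N / q + 1 from rfl]; ring
  have hquery : ∀ N u, Λ.query N u = true → ∃ r, 1 ≤ r ∧ r ≤ 2 ^ (c * (Nat.log 2 N + 1)) ∧
      (Λ.args N u).length = r := by
    intro N u hu
    rcases h.args_cases N u with ⟨-, hn⟩ | ⟨_, _, _, _, hn⟩ | ⟨_, _, hn⟩ |
      ⟨k, _, _, ⟨_, _, _, hn⟩ | ⟨l, hg, hl, ha, -⟩ | ⟨_, _, _, hn⟩⟩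
    case inr.inr.inr.inr.inl =>
      exact ⟨l.length, hpos hl, hfanin hg, by rw [ha, List.length_map]⟩
    all_goals rw [hu] at hn; exact absurd hn (by decide)
  have hlocal : ∀ N u, Λ.query N u = false → (Λ.args N u).length ≤ root q N ^ 2 := by
    intro N u hu
    have hone : 1 ≤ root q N ^ 2 := Nat.one_le_pow _ _ (by have := two_le_root q N; omega)
    rcases h.args_cases N u with ⟨ha, -⟩ | ⟨_, _, _, ha, -⟩ | ⟨_, ha, -⟩ |
      ⟨k, _, _, ⟨_, _, ha, -⟩ | ⟨l, _, _, _, hn⟩ | ⟨g, hg, ha, -⟩⟩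
    case inr.inr.inr.inr.inl => rw [hu] at hn; exact absurd hn (by decide)
    case inr.inr.inr.inr.inr =>
      rw [ha, List.length_map]
      exact h.length_leafList_le hg
    all_goals rw [ha]; simp only [List.length_nil, List.length_singleton]; omega
  have hmaxpos : ∀ N, f 0 ≤ polyMax f e N := fun N => le_polyMax f (Nat.zero_le _)
  have hmax₀ : ∀ N, 0 < polyMax f e N := fun N => (hf 0).trans_le (hmaxpos N)
  have hone : ∀ N, 1 ≤ (f 0)⁻¹ * polyMax f e N := fun N => by
    rw [inv_mul_eq_div, one_le_div (hf 0)]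
    exact hmaxpos N
  have hR : ∀ N, (M.maxRounds ((N + 2) ^ e) : ℝ) ≤ K'' * polyMax f e N + 1 := by
    intro N
    have hK₀ : 0 ≤ K'' := by
      by_contra! hlt
      have := (norm_nonneg _).trans (hK'' 0)
      rw [Real.norm_of_nonneg (hf 0).le] at this
      nlinarith [hf 0]
    have h₁ : M.maxRounds ((N + 2) ^ e) ≤ ⌈K'' * polyMax f e N⌉₊ := by
      refine M.maxRounds_le fun r hr => ?_
      have h₂ := (le_abs_self _).trans (hK'' r)
      rw [Real.norm_of_nonneg (hf r).le] at h₂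
      have h₃ : (M.rounds r : ℝ) ≤ ⌈K'' * polyMax f e N⌉₊ :=
        (h₂.trans (mul_le_mul_of_nonneg_left (le_polyMax f hr) hK₀)).trans (Nat.le_ceil _)
      exact_mod_cast h₃
    refine (Nat.cast_le.2 h₁).trans (Nat.ceil_lt_add_one ?_).le
    exact mul_nonneg hK₀ (hmax₀ N).le
  refine solvableWith_of_network (K := K) (z := z) hε₀ Λ.network M hκ hq₁ hqε
    (R := fun N => M.maxRounds ((N + 2) ^ e)) (T := fun _ => 2 * (c * q) + 3) ?_ (by fun_prop)
    (fun N u a ha => ?_) (fun N u => ?_) hlocal (fun N u hu => ?_) (fun N u hu => ?_)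
    (fun N u hu => ?_) (fun x => ?_) ?_ ?_
  · exact M.computable_maxRounds.comp (by fun_prop : Computable fun N => (N + 2) ^ e)
  · have := hfanpos N
    suffices hs : a < 2 * (C N).length + 2 * N + 3 ∧ u < 2 * (C N).length + 2 * N + 3 from
      ⟨lt_of_lt_of_le (by omega) (hz N), lt_of_lt_of_le (by omega) (hz N)⟩
    change a ∈ Λ.args N u at ha
    rcases h.args_cases N u with ⟨hu, -⟩ | ⟨i, hi, rfl, hu, -⟩ | ⟨rfl, hu, -⟩ |
      ⟨k, hk, rfl, ⟨i, hi, hu, -⟩ | ⟨l, hg, -, hu, -⟩ | ⟨g, hg, hu, -⟩⟩ <;> rw [hu] at ha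
    · simp at ha
    · rw [List.mem_singleton] at ha; omega
    · rw [List.mem_singleton] at ha; omega
    · rw [List.mem_singleton] at ha; omega
    · obtain ⟨j, hj, rfl⟩ := List.mem_map.1 ha
      have := ((hwf N).2 k _ hg).1 j hj
      omega
    · obtain ⟨j, hj, rfl⟩ := List.mem_map.1 ha
      rw [h.leafList_eq] at hj
      have := (Circuit.of_mem_leavesAt (hwf N) hg hj).1
      omega
  · change (Λ.args N u).length ≤ _
    refine le_trans ?_ (hz N)
    have := hfanpos N
    cases hu : Λ.query N u
    · have := hlocal N u hu
      omega
    · obtain ⟨r, -, hr, hu⟩ := hquery N u hu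
      omega
  · obtain ⟨r, hr₁, hr, ha⟩ := hquery N u hu
    change M.memory (Λ.args N u).length ≤ _
    rw [ha]
    exact hmem N r hr₁ hr
  · obtain ⟨r, hr₁, hr, ha⟩ := hquery N u hu
    change M.machines (Λ.args N u).length ≤ _
    rw [ha]
    have := hmach N r hr₁ hr
    exact le_trans (by omega) (hz N)
  · obtain ⟨r, hr₁, hr, ha⟩ := hquery N u hu
    change M.rounds (Λ.args N u).length ≤ _
    rw [ha]
    exact M.rounds_le_maxRounds (hr.trans (he N))
  · rw [h.board_output x (hlevel x.length)]
    exact heval x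
  · refine IsBigO.of_bound (f 0)⁻¹ (Eventually.of_forall fun N => ?_)
    rw [norm_one, Real.norm_of_nonneg (hmax₀ N).le]
    exact hone N
  · refine IsBigO.of_bound ((2 * (c * q) + 3) * (K'' + 2 * (f 0)⁻¹))
      (Eventually.of_forall fun N => ?_)
    rw [Real.norm_of_nonneg (by positivity), Real.norm_of_nonneg (hmax₀ N).le, mul_assoc]
    push_cast
    refine mul_le_mul_of_nonneg_left ?_ (by positivity)
    linarith [hR N, hone N]

end MPCLogspace

theorem mainTheorem1 (f : ℕ → ℝ) (hf : ∀ N, 0 < f N) :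
    ((∃ B, LHard B ∧ MPCSolvable f B) →
      ∀ A ∈ ClassL, ∃ c : ℕ, MPCSolvable (polyMax f c) A) ∧
    (((∀ c : ℕ, polyMax f c =O[atTop] f) ∨ (fun N : ℕ => Real.log N) =O[atTop] f) →
      ((∃ B, LHard B ∧ MPCSolvable f B) → ∀ A ∈ ClassL, MPCSolvable f A) ∧
      ((∀ B, LComplete B → MPCSolvable f B) ∨ (∀ B, LComplete B → ¬ MPCSolvable f B))) := by
  refine ⟨fun ⟨B, hB, hBf⟩ A hA => mpcSolvable_of_nc1Reducible hf (hB A hA) hBf, fun h => ?_⟩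
  have key : (∃ B, LHard B ∧ MPCSolvable f B) → ∀ A ∈ ClassL, MPCSolvable f A := by
    rintro ⟨B, hB, hBf⟩ A hA
    rcases h with h | h
    · obtain ⟨c, hc⟩ := mpcSolvable_of_nc1Reducible hf (hB A hA) hBf
      exact hc.mono (h c)
    · exact mpcSolvable_of_mem_classL hA h
  refine ⟨key, ?_⟩
  by_cases hc : ∃ B, LComplete B ∧ MPCSolvable f B
  · obtain ⟨B, hB, hBf⟩ := hc
    exact Or.inl fun A hA => key ⟨B, hB.2, hBf⟩ A hA.1
  · exact Or.inr fun B hB hBf => hc ⟨B, hB, hBf⟩
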